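/- **Extended Clausius relation for a quasi-static protocol.** *Class of models.* Fix a nonempty finite set $\mathcal S$; a connectivity function $c(x,y)=c(y,x)\ge 0$ ($x\ne y$) such that any two states are joined by a chain of pairs with $c\neq0$; $\beta>0$; constants $\bar E$, $\bar\epsilon$, $L\ge 0$; and one of the two equilibrium rules $R^{(\beta,\nu)}_{x\to y}=c(x,y)e^{\beta H^\nu_x}$ or $R^{(\beta,\nu)}_{x\to y}=c(x,y)e^{(\beta/2)(H^\nu_x-H^\nu_y)}$. A model of the class consists of sets $\mathcal N\subset\mathbb R^d$, $\mathcal K\subset\mathbb R^m$ and functions $H^\nu_x$, $\xi^\kappa_{x\to y}$ with $|H^\nu_x|\le\bar E$ for $\nu\in\mathcal N$, $|\xi^\kappa_{x\to y}|\le 1$ for $\kappa\in\mathcal K$ (for $x\ne y$ with $c(x,y)\ne0$), both $L$-Lipschitz in the parameter on $\mathcal N$, $\mathcal K$. (If $\mathcal N,\mathcal K$ are compact and $H,\xi$ depend smoothly on the parameters, such an $L$ always exists.) For $\alpha=(\beta,\epsilon,\nu,\kappa)$ the rates are $R^\alpha_{x\to y}=e^{\epsilon\xi^\kappa_{x\to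 y}}R^{(\beta,\nu)}_{x\to y}$, with escape rates $\lambda^\alpha_x=\sum_{y\ne x}R^\alpha_{x\to y}$ and unique stationary distribution $\rho^\alpha$. *Paths.* A path on $[a,b]$ is $\hat x=(n,(x_0,\dots,x_n),(t_1,\dots,t_n))$ with $x_{j-1}\neq x_j$ and $a=t_0<t_1<\dots<t_n<t_{n+1}=b$. Under a protocol $\hat\alpha=(\alpha(t))$, whose component for the Hamiltonian is $\nu(t)$, its weight is $\mathcal T^{\hat\alpha}[\hat x]=\prod_{j=1}^nR^{\alpha(t_j)}_{x_{j-1}\to x_j}\prod_{j=0}^n e^{-\int_{t_j}^{t_{j+1}}\lambda^{\alpha(t)}_{x_j}dt}$. Let $\langle\cdot\rangle^{\hat\alpha}$ be the expectation over paths on $[-\tau,\tau]$ with density $\rho^{\alpha(-\tau)}_{x_0}\mathcal T^{\hat\alpha}$, and ${}^{\rm c}\langle X^k\rangle^{\hat\alpha}=\partial_u^k\log\langle e^{uX}\rangle^{\hat\alpha}|_{u=0}$. Put $\theta^\alpha_{x\to y}=\log(R^\alpha_{x\to y}/R^\alpha_{y\to x})$, $\psi^\alpha_{x\to y}=\theta^\alpha_{x\to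 y}-\beta(H^\nu_x-H^\nu_y)$, $\Theta^{\hat\alpha}=\sum_{j=1}^n\theta^{\alpha(t_j)}_{x_{j-1}\to x_j}$, $\Psi^{\hat\alpha}=\sum_{j=1}^n\psi^{\alpha(t_j)}_{x_{j-1}\to x_j}$, $W^{\hat\alpha}=\sum_{j=0}^n(H^{\nu(t_{j+1})}_{x_j}-H^{\nu(t_j)}_{x_j})$. The reversed protocol is $\hat\alpha^\dagger=(\alpha(-t))$. *Free energy and entropy.* $F(\alpha)$ is the number with $$e^{-\beta F(\alpha)}=e^{-\beta H^\nu_x}\lim_{\tau\to\infty}\frac{\langle e^{-\Psi/2}\rangle^{[-\tau,-\tau/2]}_{x\to}}{[e^{-\Psi/2}]^{[\tau/2,\tau]}_{{\rm st}\to x}}\qquad\text{for every }x\in\mathcal S,$$ where, for the constant protocol $\alpha$, the numerator is the expectation over paths on $[-\tau,-\tau/2]$ started at $x$, and the denominator is the expectation over paths on $[\tau/2,\tau]$ started from $\rho^\alpha$, restricted to those ending at $x$. Put $S(\alpha)=\beta\bigl(\sum_xH^\nu_x\rho^\alpha_x-F(\alpha)\bigr)$. *Protocol.* Given $\alpha=(\beta,\epsilon,\nu,\kappa)$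 and $\alpha'=(\beta,\epsilon,\nu',\kappa')$, the $N$-step protocol $\hat\alpha$ on $[-\tau,\tau]$ takes the value $\alpha_j=\bigl(\beta,\epsilon,\frac{(N-j)\nu+j\nu'}N,\frac{(N-j)\kappa+j\kappa'}N\bigr)$ for $t\in[-\tau+\frac{2\tau j}{N+1},-\tau+\frac{2\tau(j+1)}{N+1})$, $j=0,\dots,N$, and $\alpha(\tau)=\alpha_N$. **Theorem.** For every class of models there are positive constants $B$ and $C_n$ ($n=1,2,\dots$), depending only on the class (that is, on $\mathcal S,c,\beta$, the rule, $\bar E,\bar\epsilon,L$), such that for every model of the class, every $\epsilon\in[0,\bar\epsilon]$ and all $\nu,\nu',\kappa,\kappa'$ whose segments $[\nu,\nu']$, $[\kappa,\kappa']$ lie in $\mathcal N$, $\mathcal K$, with $\delta=|\nu-\nu'|+B\epsilon|\kappa-\kappa'|$, the following iterated limits exist and satisfy: 1. for every $n\ge1$, $$\Bigl|F(\alpha')-F(\alpha)+\frac1\beta\lim_{N\to\infty}\lim_{\tau\to\infty}\sum_{k=1}^{2n-1}\frac{(-1)^k}{2^kk!}\Bigl\{{}^{\rm c}\langle(\beta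 W^{\hat\alpha}+\Psi^{\hat\alpha})^k\rangle^{\hat\alpha}-{}^{\rm c}\langle(\beta W^{\hat\alpha^\dagger}+\Psi^{\hat\alpha^\dagger})^k\rangle^{\hat\alpha^\dagger}\Bigr\}\Bigr|\le C_n\epsilon^{2n}\delta;$$ 2. with $C=\beta C_1$, $$\Bigl|S(\alpha')-S(\alpha)+\lim_{N\to\infty}\lim_{\tau\to\infty}\tfrac12\bigl(\langle\Theta^{\hat\alpha}\rangle^{\hat\alpha}-\langle\Theta^{\hat\alpha^\dagger}\rangle^{\hat\alpha^\dagger}\bigr)\Bigr|\le C\epsilon^2\delta;$$ 3. if moreover $\nu=\nu'$, the left-hand side of 2 is at most $C''\epsilon^3|\kappa-\kappa'|$ with $C''=BC$. -/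

import Mathlib

open MeasureTheory ProbabilityTheory Filter Topology
open scoped Matrix NNReal

namespace SST

noncomputable section

/-! ### The class of models -/

/-- The two rules for the equilibrium transition rates at inverse temperature `β`:
`c(x,y) e^{β H_x}` and `c(x,y) e^{(β/2)(H_x - H_y)}`. -/
inductive EquilibriumRule
  | exponential
  | symmetric

/-- A class of models on the finite state space `S`: the connectivity function, the reference
inverse temperature, the rule for the equilibrium rates, and the uniform bounds: `Ebar` for the
energies, `epsBar` for the degree of nonequilibrium, and `lip`, a common Lipschitz constant for the
dependence of the energies and of the nonequilibrium functions on their parameters. -/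
structure ModelClass (S : Type*) where
  c : S → S → ℝ
  c_nonneg : ∀ x y, x ≠ y → 0 ≤ c x y
  c_symm : ∀ x y, x ≠ y → c x y = c y x
  c_connected : ∀ x y, Relation.ReflTransGen (fun a b => a ≠ b ∧ c a b ≠ 0) x y
  β : ℝ
  β_pos : 0 < β
  rule : EquilibriumRule
  Ebar : ℝ
  epsBar : ℝ
  lip : ℝ≥0

/-- A model of the class `M`: a Hamiltonian `H ν x` with parameter `ν ∈ 𝒩 ⊆ ℝ^d`, and a
nonequilibrium function `ξ κ x y` with parameter `κ ∈ 𝒦 ⊆ ℝ^m`. -/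
structure Model {S : Type*} (M : ModelClass S) (d m : ℕ) where
  𝒩 : Set (EuclideanSpace ℝ (Fin d))
  𝒦 : Set (EuclideanSpace ℝ (Fin m))
  H : EuclideanSpace ℝ (Fin d) → S → ℝ
  ξ : EuclideanSpace ℝ (Fin m) → S → S → ℝ
  H_bound : ∀ ν ∈ 𝒩, ∀ x, |H ν x| ≤ M.Ebar
  H_lipschitz : ∀ x, LipschitzOnWith M.lip (fun ν => H ν x) 𝒩
  ξ_bound : ∀ κ ∈ 𝒦, ∀ x y, x ≠ y → M.c x y ≠ 0 → |ξ κ x y| ≤ 1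
  ξ_lipschitz : ∀ x y, x ≠ y → M.c x y ≠ 0 → LipschitzOnWith M.lip (fun κ => ξ κ x y) 𝒦

/-- The parameters `α = (β, ε, ν, κ)`; the fixed `β` is kept in the class of models. -/
@[ext]
structure Param (d m : ℕ) where
  ε : ℝ
  ν : EuclideanSpace ℝ (Fin d)
  κ : EuclideanSpace ℝ (Fin m)

/-- A path `(n, (x_0, …, x_n), (t_1, …, t_n))`: the number of jumps, the visited states and the
jump times. -/
abbrev Path (S : Type*) : Type _ := Σ n : ℕ, (Fin (n + 1) → S) × (Fin n → ℝ)

namespace Path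

variable {S : Type*}

/-- The initial state `x_0`. -/
def initial (p : Path S) : S := p.2.1 0

/-- The final state `x_n`. -/
def final (p : Path S) : S := p.2.1 (Fin.last p.1)

/-- The times `t_0 = a, t_1, …, t_n, t_{n+1} = b` of a path on `[a, b]`. -/
def times (a b : ℝ) (p : Path S) : Fin (p.1 + 2) → ℝ :=
  Fin.snoc (α := fun _ => ℝ) (Fin.cons (α := fun _ => ℝ) a p.2.2) b

/-- The "Lebesgue measure" over all paths on the time interval `[a, b]`: sum over `n`, sum over
`x_0, …, x_n` with `x_{j-1} ≠ x_j`, and integral over `a < t_1 < ⋯ < t_n < b`. -/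
def base [MeasurableSpace S] (a b : ℝ) : Measure (Path S) :=
  Measure.sum fun n : ℕ =>
    (((Measure.count : Measure (Fin (n + 1) → S)).prod (volume : Measure (Fin n → ℝ))).restrict
      {q | (∀ j : Fin n, q.1 j.castSucc ≠ q.1 j.succ) ∧ StrictMono q.2 ∧
        ∀ j, q.2 j ∈ Set.Ioo a b}).map
      (fun q => (⟨n, q⟩ : Path S))

end Path

/-- The `k`-th cumulant `∂_u^k log ⟨e^{uX}⟩ |_{u=0}`. -/
def cumulant {Ω : Type*} [MeasurableSpace Ω] (k : ℕ) (X : Ω → ℝ) (μ : Measure Ω) : ℝ :=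
  iteratedDeriv k (cgf X μ) 0

/-- `lim_{N → ∞} lim_{τ → ∞} f N τ` exists and equals `l`. -/
def HasIteratedLimit (f : ℕ → ℝ → ℝ) (l : ℝ) : Prop :=
  ∃ g : ℕ → ℝ, (∀ N, 1 ≤ N → Tendsto (f N) atTop (𝓝 (g N))) ∧ Tendsto g atTop (𝓝 l)

/-- The protocol with `N` steps on `[-τ, τ]`: on
`[-τ + 2τj/(N+1), -τ + 2τ(j+1)/(N+1))`, `j = 0, …, N`, it takes the value
`(ε, ((N-j)ν + jν')/N, ((N-j)κ + jκ')/N)`. -/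
def stepProtocol {d m : ℕ} (ε : ℝ) (ν ν' : EuclideanSpace ℝ (Fin d))
    (κ κ' : EuclideanSpace ℝ (Fin m)) (N : ℕ) (τ : ℝ) (t : ℝ) : Param d m :=
  let j : ℕ := min N ⌊(t + τ) * (N + 1) / (2 * τ)⌋₊
  { ε := ε
    ν := (N : ℝ)⁻¹ • (((N : ℝ) - j) • ν + (j : ℝ) • ν')
    κ := (N : ℝ)⁻¹ • (((N : ℝ) - j) • κ + (j : ℝ) • κ') }

/-- The time-reversed protocol. -/
def reversed {d m : ℕ} (a : ℝ → Param d m) (t : ℝ) : Param d m := a (-t)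

namespace Model

variable {S : Type*} {M : ModelClass S} {d m : ℕ} (X : Model M d m)

/-! ### Rates and stationary distribution -/

/-- The equilibrium transition rate from `x` to `y`. -/
def eqRate (ν : EuclideanSpace ℝ (Fin d)) (x y : S) : ℝ :=
  match M.rule with
  | .exponential => M.c x y * Real.exp (M.β * X.H ν x)
  | .symmetric => M.c x y * Real.exp (M.β / 2 * (X.H ν x - X.H ν y))

/-- The transition rate from `x` to `y ≠ x`. -/
def rate (α : Param d m) (x y : S) : ℝ := Real.exp (α.ε * X.ξ α.κ x y) * X.eqRate α.ν x y

section Finite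

variable [Fintype S] [DecidableEq S]

/-- The escape rate from `x`. -/
def escapeRate (α : Param d m) (x : S) : ℝ := ∑ y ∈ Finset.univ.erase x, X.rate α x y

/-- The transition rate matrix, acting on column vectors. -/
def rateMatrix (α : Param d m) : Matrix S S ℝ :=
  Matrix.of fun y x => if x = y then -X.escapeRate α x else X.rate α x y

/-- `ρ` is a stationary probability distribution. -/
def IsStationary (α : Param d m) (ρ : S → ℝ) : Prop :=
  (∀ x, 0 ≤ ρ x) ∧ ∑ x, ρ x = 1 ∧ X.rateMatrix α *ᵥ ρ = 0

/-- The stationary distribution (it exists and is unique for parameters of the model). -/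
def stationary (α : Param d m) : S → ℝ := Classical.epsilon (X.IsStationary α)

end Finite

/-! ### Entropy production and work -/

/-- The entropy production of the transition `x → y`. -/
def θ (α : Param d m) (x y : S) : ℝ := Real.log (X.rate α x y / X.rate α y x)

/-- The nonequilibrium part of the entropy production of the transition `x → y`. -/
def ψ (α : Param d m) (x y : S) : ℝ := X.θ α x y - M.β * (X.H α.ν x - X.H α.ν y)

/-- The total entropy production in a path. -/
def Θ (a : ℝ → Param d m) (p : Path S) : ℝ :=
  ∑ j : Fin p.1, X.θ (a (p.2.2 j)) (p.2.1 j.castSucc) (p.2.1 j.succ)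

/-- The nonequilibrium part of the entropy production in a path. -/
def Ψ (a : ℝ → Param d m) (p : Path S) : ℝ :=
  ∑ j : Fin p.1, X.ψ (a (p.2.2 j)) (p.2.1 j.castSucc) (p.2.1 j.succ)

/-- The work done on the system in a path on `[t₀, t₁]`. -/
def W (t₀ t₁ : ℝ) (a : ℝ → Param d m) (p : Path S) : ℝ :=
  ∑ j : Fin (p.1 + 1),
    (X.H (a (p.times t₀ t₁ j.succ)).ν (p.2.1 j) - X.H (a (p.times t₀ t₁ j.castSucc)).ν (p.2.1 j))

/-! ### Path measures -/

variable [Fintype S] [DecidableEq S]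

/-- The weight (transition probability density) of a path on `[t₀, t₁]`. -/
def weight (t₀ t₁ : ℝ) (a : ℝ → Param d m) (p : Path S) : ℝ :=
  (∏ j : Fin p.1, X.rate (a (p.2.2 j)) (p.2.1 j.castSucc) (p.2.1 j.succ)) *
    ∏ j : Fin (p.1 + 1),
      Real.exp (-∫ t in (p.times t₀ t₁ j.castSucc)..(p.times t₀ t₁ j.succ),
        X.escapeRate (a t) (p.2.1 j))

variable [MeasurableSpace S]

/-- The law of the path on `[t₀, t₁]` under the protocol `a`, started from the distribution `q`. -/
def pathLaw (t₀ t₁ : ℝ) (a : ℝ → Param d m) (q : S → ℝ) : Measure (Path S) :=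
  (Path.base t₀ t₁).withDensity fun p => ENNReal.ofReal (q p.initial * X.weight t₀ t₁ a p)

/-- The law of the path on `[-τ, τ]` under the protocol `a`, started from the steady state for the
initial parameters `a (-τ)`. -/
def steadyLaw (τ : ℝ) (a : ℝ → Param d m) : Measure (Path S) :=
  X.pathLaw (-τ) τ a (X.stationary (a (-τ)))

/-! ### Free energy and entropy -/

/-- The expectation of `e^{-Ψ/2}` on `[-τ, -τ/2]` for constant parameters `α` and initial
state `x`. -/
def expFrom (α : Param d m) (x : S) (τ : ℝ) : ℝ :=
  ∫ p, Real.exp (-X.Ψ (fun _ => α) p / 2)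
    ∂X.pathLaw (-τ) (-τ / 2) (fun _ => α) (Pi.single x 1)

/-- The unnormalized expectation of `e^{-Ψ/2}` on `[τ/2, τ]` for constant parameters `α`, started
from the steady state and ending in the state `x`. -/
def expTo (α : Param d m) (x : S) (τ : ℝ) : ℝ :=
  ∫ p in {p : Path S | p.final = x}, Real.exp (-X.Ψ (fun _ => α) p / 2)
    ∂X.pathLaw (τ / 2) τ (fun _ => α) (X.stationary α)

/-- The free energy `F(α)`: the real number such that
`e^{-β F(α)} = e^{-β H_x} lim_{τ → ∞} expFrom α x τ / expTo α x τ` for every state `x`. -/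
def freeEnergy (α : Param d m) : ℝ :=
  Classical.epsilon fun F : ℝ => ∀ x : S,
    Tendsto (fun τ => Real.exp (-M.β * X.H α.ν x) * (X.expFrom α x τ / X.expTo α x τ)) atTop
      (𝓝 (Real.exp (-M.β * F)))

/-- The nonequilibrium entropy `S(α) = β (⟨H⟩_st - F(α))`. -/
def entropy (α : Param d m) : ℝ :=
  M.β * (∑ x, X.H α.ν x * X.stationary α x - X.freeEnergy α)

/-! ### The quantities of the thermodynamic relations -/

/-- The `k`-th cumulant of `βW + Ψ` under the protocol `a` on `[-τ, τ]`, started from the steady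
state. -/
def workCumulant (k : ℕ) (τ : ℝ) (a : ℝ → Param d m) : ℝ :=
  cumulant k (fun p => M.β * X.W (-τ) τ a p + X.Ψ a p) (X.steadyLaw τ a)

/-- The truncated sum `∑_{k=1}^{2n-1} (-1)^k/(2^k k!) {…}` of the differences between the cumulants
for the protocol and for its time-reversal. -/
def truncatedSum (n : ℕ) (τ : ℝ) (a : ℝ → Param d m) : ℝ :=
  ∑ k ∈ Finset.Icc 1 (2 * n - 1), (-1 : ℝ) ^ k / (2 ^ k * (k.factorial : ℝ)) *
    (X.workCumulant k τ a - X.workCumulant k τ (reversed a))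

/-- The expectation of the total entropy production on `[-τ, τ]`, started from the steady state. -/
def meanΘ (τ : ℝ) (a : ℝ → Param d m) : ℝ := ∫ p, X.Θ a p ∂X.steadyLaw τ a

end Model

end

end SST

/-!
Write `p = u + 1/2` for the argument `u` of the generating function of `β W + Ψ`. The tilted rates
`R e^{u ψ}`, conjugated by `e^{β H / 2}`, form a matrix `hat ε z v` that depends on `p` only through
`v = p ε`, with `z` the pair of the energies and the nonequilibrium functions, and
`hat ε z (-v)` is the transpose of `hat ε z v` (the fluctuation symmetry). For piecewise constant
protocols the generating function is therefore an alternating product of exponentials of `hat` and of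
diagonal work factors (`Model.integral_pathLaw`): the Dyson series over the paths is the unique
bounded solution of the forward equation (`IsSolution.tsum_dyson`).

For slow steps each exponential is dominated by its Perron projection, built from the left Perron
vector `phi v` and the right one `phi (-v)`. The exponential growth cancels between the protocol and
its reversal, and the difference between the cumulant generating functions tends to
`Model.limitFun`: a boundary term at each end, plus one term `stepFun` for each step, which is odd
in `p`. As the dominant eigenvalue is simple it extends holomorphically to complex `p`, the
convergence is locally uniform there, and by Cauchy's formula all derivatives at `p = 1/2`, that is
all cumulants, converge (`Model.tendsto_iteratedDeriv_log_genFun`).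

The function `limitFun` vanishes at `p = 1/2`, where `hat` is conjugate to the generator, and its
value at `p = 0` is `β` times the difference between the free energies (`Model.freeEnergy_eq`). The
truncated sum of cumulants is the Taylor polynomial of `limitFun` at `1/2`, evaluated at `0`, so the
error in the first claim is a Taylor remainder (`Model.taylorRem_limitFun`). Since `p` enters
through `ε p`, derivatives of order `2n` carry `ε^{2n}`; oddness of the step terms shifts the order
to `2n + 1`, which gains another factor `ε`, except in the work term, where an explicit factor `p` is
not accompanied by `ε`. This gives the weights `‖ν - ν'‖ + ε ‖κ - κ'‖`
(`ModelClass.exists_variation_bound`, `ModelClass.exists_bdry_bound`). The remainder of one step is a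
smooth two-point function that vanishes on the diagonal, so its sums over refined partitions
converge (`exists_tendsto_partition_sum`), and the terms of second order in the steps do not
contribute to the limit.

The second claim is the case `n = 1` of the first: along every path `Θ` is `β W + Ψ` minus `β` times
the difference between the final and the initial energy, and for slow steps the final state is
distributed according to the steady state.
-/

namespace SST

/-! ### Exponentials in Banach algebras -/

section BanachAlgebra

variable {A : Type*} [NormedRing A] [NormedAlgebra ℝ A] [CompleteSpace A]

open NormedSpace (exp)

lemma exp_add_of_commute' {x y : A} (h : Commute x y) : exp (x + y) = exp x * exp y := by
  let _ : NormedAlgebra ℚ A := NormedAlgebra.restrictScalars ℚ ℝ A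
  exact NormedSpace.exp_add_of_commute h

lemma exp_nsmul' (n : ℕ) (x : A) : exp (n • x) = exp x ^ n := by
  let _ : NormedAlgebra ℚ A := NormedAlgebra.restrictScalars ℚ ℝ A
  exact NormedSpace.exp_nsmul n x

lemma exp_mul_eq_smul {X P : A} {c : ℝ} (h : X * P = c • P) : exp X * P = Real.exp c • P := by
  have hpow : ∀ n : ℕ, X ^ n * P = c ^ n • P := by
    intro n
    induction n with
    | zero => simp
    | succ n ih => rw [pow_succ, mul_assoc, h, mul_smul_comm, ih, smul_smul, pow_succ, mul_comm]
  have h1 := (NormedSpace.exp_series_hasSum_exp' (𝕂 := ℝ) X).mul_right P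
  have h2 := (NormedSpace.exp_series_hasSum_exp' (𝕂 := ℝ) c).smul_const P
  rw [← Real.exp_eq_exp_ℝ] at h2
  refine h1.unique (h2.congr_fun ?_)
  intro n
  simp [hpow, smul_smul]

/-- The exponential of `X` splits along an idempotent `P` annihilated by `X`. -/
lemma exp_smul_eq_add {X P : A} (hXP : X * P = 0) (hPX : P * X = 0) (hP : P * P = P) (t : ℝ) :
    exp (t • X) = P + exp (t • (X - P)) * (1 - P) := by
  have hc : Commute (t • (X - P)) (t • P) := by
    simp [Commute, SemiconjBy, sub_mul, mul_sub, hXP, hPX]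
  have h0 : exp (t • P) * (1 - P) = 1 - P := by
    have := exp_mul_eq_smul (X := t • P) (P := 1 - P) (c := 0) (by simp [mul_sub, hP])
    simpa using this
  have h1 : exp (t • X) * P = P := by
    have := exp_mul_eq_smul (X := t • X) (P := P) (c := 0) (by simp [hXP])
    simpa using this
  have h2 : exp (t • X) = exp (t • (X - P)) * exp (t • P) := by
    rw [← exp_add_of_commute' hc, ← smul_add, sub_add_cancel]
  calc exp (t • X) = exp (t • X) * P + exp (t • X) * (1 - P) := by rw [mul_sub, mul_one]; abel
    _ = P + exp (t • (X - P)) * (1 - P) := by rw [h1, h2, mul_assoc, h0]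

/-- Subtracting `P` turns the eigenvalue `0` of `X` on the range of `P` into the eigenvalue `-1`. -/
lemma exp_smul_sub_eq {X P : A} (hXP : X * P = 0) (hPX : P * X = 0) (hP : P * P = P) (t : ℝ) :
    exp (t • (X - P)) = exp (t • X) - P + Real.exp (-t) • P := by
  have h3 : exp (t • (X - P)) * P = Real.exp (-t) • P := by
    apply exp_mul_eq_smul
    simp [sub_mul, hXP, hP]
  have := exp_smul_eq_add hXP hPX hP t
  rw [this, mul_sub, h3]
  simp

lemma norm_exp_le_exp_norm [NormOneClass A] (X : A) : ‖exp X‖ ≤ Real.exp ‖X‖ := by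
  have h1 := (NormedSpace.exp_series_hasSum_exp' (𝕂 := ℝ) X)
  have h2 := (NormedSpace.exp_series_hasSum_exp' (𝕂 := ℝ) ‖X‖)
  rw [← Real.exp_eq_exp_ℝ] at h2
  refine h1.norm_le_of_bounded h2 ?_
  intro n
  rw [norm_smul, norm_inv, Real.norm_natCast, smul_eq_mul]
  gcongr
  exact norm_pow_le X n

/-- A semigroup that contracts at one time decays exponentially. -/
lemma norm_exp_smul_le [NormOneClass A] {X : A} {T₀ C t : ℝ} (hT : 0 < T₀) (hC : ‖X‖ ≤ C)
    (hX : ‖exp (T₀ • X)‖ ≤ 1 / 2) (ht : 0 ≤ t) :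
    ‖exp (t • X)‖ ≤ Real.exp (C * T₀) * (1 / 2) ^ ⌊t / T₀⌋₊ := by
  set n := ⌊t / T₀⌋₊ with hn
  have h1 : (n : ℝ) * T₀ ≤ t := by
    rw [← le_div_iff₀ hT]; exact Nat.floor_le (by positivity)
  have h2 : t < (n + 1 : ℝ) * T₀ := by
    rw [← div_lt_iff₀ hT]; exact Nat.lt_floor_add_one _
  have hc : Commute (n • (T₀ • X)) ((t - n * T₀) • X) := by
    apply Commute.smul_left; apply Commute.smul_left; apply Commute.smul_right; rfl
  have e : t • X = n • (T₀ • X) + (t - n * T₀) • X := by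
    rw [← Nat.cast_smul_eq_nsmul ℝ, smul_smul, ← add_smul]; ring_nf
  rw [e, exp_add_of_commute' hc, exp_nsmul', mul_comm (Real.exp _)]
  refine (norm_mul_le _ _).trans ?_
  gcongr
  · refine (norm_pow_le _ _).trans ?_
    gcongr
  · refine (norm_exp_le_exp_norm _).trans ?_
    rw [Real.exp_le_exp, norm_smul, Real.norm_of_nonneg (by linarith), mul_comm C]
    have := (norm_nonneg X).trans hC
    gcongr
    linarith

/-- If `exp (n X)` tends to zero at one point, then `exp (t X)` tends to zero near it, jointly in the
time and the point. -/
lemma eventually_tendsto_exp [NormOneClass A] {E : Type*} [TopologicalSpace E] {X : E → A}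
    {p₀ : E} (hX : ContinuousAt X p₀)
    (h0 : Tendsto (fun n : ℕ => exp ((n : ℝ) • X p₀)) atTop (𝓝 0)) :
    ∀ᶠ p in 𝓝 p₀, Tendsto (fun q : ℝ × E => exp (q.1 • X q.2)) (atTop ×ˢ 𝓝 p) (𝓝 0) := by
  obtain ⟨n, hn, hn0⟩ := ((h0.norm.eventually (gt_mem_nhds (show ‖(0 : A)‖ < 1 / 2 by
    rw [norm_zero]; norm_num))).and (eventually_gt_atTop 0)).exists
  have hn' : (0 : ℝ) < n := by exact_mod_cast hn0
  have hcont : ContinuousAt (fun p => ‖exp ((n : ℝ) • X p)‖) p₀ := by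
    let _ : NormedAlgebra ℚ A := NormedAlgebra.restrictScalars ℚ ℝ A
    exact (NormedSpace.exp_continuous.continuousAt.comp (hX.const_smul (n : ℝ))).norm
  have hW := (hcont.eventually (gt_mem_nhds hn)).and
    (hX.norm.eventually (gt_mem_nhds (lt_add_one ‖X p₀‖)))
  filter_upwards [hW.eventually_nhds] with p hp
  have h1 : Tendsto (fun t : ℝ => ⌊t / n⌋₊) atTop atTop :=
    tendsto_nat_floor_atTop.comp (tendsto_id.atTop_div_const hn')
  have h2 := ((tendsto_pow_atTop_nhds_zero_of_lt_one (r := (1 / 2 : ℝ)) (by norm_num)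
    (by norm_num)).comp h1).const_mul (Real.exp ((‖X p₀‖ + 1) * n))
  rw [mul_zero] at h2
  refine squeeze_zero_norm' ?_ (h2.comp (tendsto_fst (g := 𝓝 p)))
  filter_upwards [(eventually_ge_atTop (0 : ℝ)).prod_mk hp] with q hq
  exact norm_exp_smul_le hn' hq.2.2.le hq.2.1.le hq.1

end BanachAlgebra

/-! ### Exponentials of matrices -/

section MatrixExp

open NormedSpace (exp)

variable {S 𝕜 : Type*} [Fintype S] [DecidableEq S] [RCLike 𝕜]

section

open scoped Matrix.Norms.Operator

lemma matrix_exp_mul_eq_smul {X P : Matrix S S 𝕜} {c : ℝ} (h : X * P = c • P) :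
    exp X * P = Real.exp c • P :=
  exp_mul_eq_smul h

lemma matrix_exp_smul_eq_add {X P : Matrix S S 𝕜} (hXP : X * P = 0) (hPX : P * X = 0)
    (hP : P * P = P) (t : ℝ) : exp (t • X) = P + exp (t • (X - P)) * (1 - P) :=
  exp_smul_eq_add hXP hPX hP t

lemma matrix_exp_smul_sub_eq {X P : Matrix S S 𝕜} (hXP : X * P = 0) (hPX : P * X = 0)
    (hP : P * P = P) (t : ℝ) :
    exp (t • (X - P)) = exp (t • X) - P + Real.exp (-t) • P :=
  exp_smul_sub_eq hXP hPX hP t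

lemma hasSum_matrix_exp (A : Matrix S S ℝ) :
    HasSum (fun n : ℕ => ((n.factorial : ℝ)⁻¹) • A ^ n) (exp A) :=
  NormedSpace.exp_series_hasSum_exp' (𝕂 := ℝ) A

lemma matrix_eventually_tendsto_exp [Nonempty S] {E : Type*} [TopologicalSpace E]
    {X : E → Matrix S S 𝕜} {p₀ : E} (hX : ContinuousAt X p₀)
    (h0 : Tendsto (fun n : ℕ => exp ((n : ℝ) • X p₀)) atTop (𝓝 0)) :
    ∀ᶠ p in 𝓝 p₀, Tendsto (fun q : ℝ × E => exp (q.1 • X q.2)) (atTop ×ˢ 𝓝 p) (𝓝 0) :=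
  eventually_tendsto_exp hX h0

end

end MatrixExp

/-! ### The Perron–Frobenius theorem -/

section Perron

open NormedSpace (exp)

variable {S : Type*} [Fintype S] [DecidableEq S]

/-- `K` has nonnegative off-diagonal entries, and any two indices are joined by a chain of positive
entries (column index first). -/
structure IsMetzler (K : Matrix S S ℝ) : Prop where
  nonneg : ∀ y x, y ≠ x → 0 ≤ K y x
  connected : ∀ x y, Relation.ReflTransGen (fun a b => a ≠ b ∧ 0 < K b a) x y

omit [Fintype S] [DecidableEq S] in
lemma IsMetzler.transpose {K : Matrix S S ℝ} (hK : IsMetzler K) : IsMetzler Kᵀ := by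
  refine ⟨fun y x h => hK.nonneg x y h.symm, fun x y => ?_⟩
  have := Relation.reflTransGen_swap.2 (hK.connected y x)
  exact Relation.ReflTransGen.mono (fun a b h => ⟨h.1.symm, h.2⟩) _ _ this

lemma exp_mulVec_of_eq_zero {K : Matrix S S ℝ} {w : S → ℝ} (h : K *ᵥ w = 0) :
    exp K *ᵥ w = w := by
  have := matrix_exp_mul_eq_smul (X := K) (P := Matrix.of fun i (_ : S) => w i) (c := 0) (by
    ext i j
    simpa [Matrix.mul_apply, Matrix.mulVec, dotProduct] using congrFun h i)
  ext i
  have h2 := congrFun (congrFun this i) i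
  rw [Matrix.mul_apply] at h2
  simpa [Matrix.mulVec, dotProduct] using h2

lemma vecMul_exp_of_eq_zero {K : Matrix S S ℝ} {w : S → ℝ} (h : w ᵥ* K = 0) :
    w ᵥ* exp K = w := by
  rw [← Matrix.mulVec_transpose, ← Matrix.exp_transpose]
  apply exp_mulVec_of_eq_zero
  rw [Matrix.mulVec_transpose, h]

/-- Every chain of positive entries contributes a positive term to the exponential series of
`K + s`. -/
lemma IsMetzler.exp_pos {K : Matrix S S ℝ} (hK : IsMetzler K) (y x : S) : 0 < exp K y x := by
  set s : ℝ := ∑ i, |K i i| with hs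
  set A : Matrix S S ℝ := K + s • 1 with hA
  have hA0 : ∀ i j, 0 ≤ A i j := by
    intro i j
    by_cases h : i = j
    · subst h
      have h1 : |K i i| ≤ s :=
        Finset.single_le_sum (f := fun i => |K i i|) (fun _ _ => abs_nonneg _) (Finset.mem_univ i)
      have := neg_abs_le (K i i)
      simp [hA]; linarith
    · simpa [hA, h] using hK.nonneg i j h
  have hpow0 : ∀ (n : ℕ) i j, 0 ≤ (A ^ n) i j := by
    intro n
    induction n with
    | zero => intro i j; by_cases h : i = j <;> simp [h]
    | succ n ih =>
      intro i j
      rw [pow_succ, Matrix.mul_apply]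
      exact Finset.sum_nonneg fun k _ => mul_nonneg (ih _ _) (hA0 _ _)
  have hex : ∃ n, 0 < (A ^ n) y x := by
    induction hK.connected x y with
    | refl => exact ⟨0, by simp⟩
    | tail _ h ih =>
      rename_i b c _
      obtain ⟨n, hn⟩ := ih
      refine ⟨n + 1, ?_⟩
      rw [pow_succ', Matrix.mul_apply]
      refine Finset.sum_pos' (fun k _ => mul_nonneg (hA0 _ _) (hpow0 _ _ _)) ⟨b, Finset.mem_univ _, ?_⟩
      refine mul_pos ?_ hn
      simpa [hA, h.1.symm] using h.2
  have e : exp K = Real.exp (-s) • exp A := by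
    have hc : Commute A (-(s • (1 : Matrix S S ℝ))) :=
      ((Commute.one_right A).smul_right s).neg_right
    have : exp (-(s • (1 : Matrix S S ℝ))) = Real.exp (-s) • (1 : Matrix S S ℝ) := by
      have := matrix_exp_mul_eq_smul (X := (-(s • (1 : Matrix S S ℝ)))) (P := 1) (c := -s) (by simp)
      simpa using this
    calc exp K = exp (A + -(s • (1 : Matrix S S ℝ))) := by simp [hA]
      _ = Real.exp (-s) • exp A := by
        rw [Matrix.exp_add_of_commute _ _ hc, this, mul_smul_comm, mul_one]
  obtain ⟨n, hn⟩ := hex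
  have hsum := hasSum_matrix_exp A
  have hsum' : HasSum (fun n : ℕ => ((n.factorial : ℝ)⁻¹ • A ^ n) y x) (exp A y x) :=
    Pi.hasSum.1 (Pi.hasSum.1 hsum y) x
  rw [e, Matrix.smul_apply, smul_eq_mul]
  refine mul_pos (Real.exp_pos _) (lt_of_lt_of_le ?_ (le_hasSum hsum' n ?_))
  · rw [Matrix.smul_apply, smul_eq_mul]; positivity
  · intro j _
    rw [Matrix.smul_apply, smul_eq_mul]
    have := hpow0 j y x
    positivity

omit [DecidableEq S] in
lemma mulVec_pos_of_pos {B : Matrix S S ℝ} (hB : ∀ y x, 0 < B y x) {v : S → ℝ}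
    (hv : ∀ x, 0 ≤ v x) (hne : v ≠ 0) (y : S) : 0 < (B *ᵥ v) y := by
  obtain ⟨x, hx⟩ := Function.ne_iff.1 hne
  refine Finset.sum_pos' (fun k _ => mul_nonneg (hB _ _).le (hv _)) ⟨x, Finset.mem_univ _, ?_⟩
  exact mul_pos (hB _ _) (lt_of_le_of_ne (hv x) (Ne.symm hx))

/-- Existence of the Perron vector: it maximizes the Collatz–Wielandt function
`w ↦ min_x (K w)_x / w_x` over the image of the simplex under `exp K`. -/
lemma IsMetzler.exists_eigenvector [Nonempty S] {K : Matrix S S ℝ} (hK : IsMetzler K) :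
    ∃ (μ : ℝ) (r : S → ℝ), (∀ x, 0 < r x) ∧ K *ᵥ r = μ • r := by
  set B := exp K with hBdef
  have hB : ∀ y x, 0 < B y x := hK.exp_pos
  have hKB : K * B = B * K := (Commute.refl K).exp_right
  have hpos : ∀ w ∈ stdSimplex ℝ S, ∀ x, 0 < (B *ᵥ w) x := by
    intro w hw
    refine mulVec_pos_of_pos hB hw.1 ?_
    rintro rfl
    simpa using hw.2
  set f : (S → ℝ) → ℝ := fun w =>
    Finset.univ.inf' Finset.univ_nonempty (fun x => (K *ᵥ (B *ᵥ w)) x / (B *ᵥ w) x) with hf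
  have hcont : ContinuousOn f (stdSimplex ℝ S) := by
    intro w hw
    apply ContinuousWithinAt.finset_inf'_apply
    intro x _
    have h1 : Continuous fun w : S → ℝ => (K *ᵥ (B *ᵥ w)) x := by
      have : Continuous fun w : S → ℝ => (K *ᵥ (B *ᵥ w)) := by fun_prop
      exact (continuous_apply x).comp this
    have h2 : Continuous fun w : S → ℝ => (B *ᵥ w) x := by
      have : Continuous fun w : S → ℝ => (B *ᵥ w) := by fun_prop
      exact (continuous_apply x).comp this
    exact (h1.continuousAt.div h2.continuousAt (hpos w hw x).ne').continuousWithinAt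
  obtain ⟨w, hw, hmax⟩ := (isCompact_stdSimplex (𝕜 := ℝ) S).exists_isMaxOn
    ⟨_, single_mem_stdSimplex ℝ (Classical.arbitrary S)⟩ hcont
  set l := B *ᵥ w with hl
  have hlpos : ∀ x, 0 < l x := hpos w hw
  have hle : ∀ x, f w * l x ≤ (K *ᵥ l) x := by
    intro x
    rw [← le_div_iff₀ (hlpos x)]
    exact Finset.inf'_le (f := fun x => (K *ᵥ (B *ᵥ w)) x / (B *ᵥ w) x) (Finset.mem_univ x)
  refine ⟨f w, l, hlpos, ?_⟩
  by_contra hne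
  have hBv : ∀ x, 0 < (B *ᵥ (K *ᵥ l - f w • l)) x := by
    refine mulVec_pos_of_pos hB (fun x => ?_) (sub_ne_zero.2 hne)
    simpa using hle x
  set σ := ∑ x, l x with hσ
  have hσpos : 0 < σ := Finset.sum_pos (fun x _ => hlpos x) Finset.univ_nonempty
  have hw' : σ⁻¹ • l ∈ stdSimplex ℝ S := by
    refine ⟨fun x => by have := (hlpos x).le; simp; positivity, ?_⟩
    simp [← Finset.mul_sum, ← hσ, hσpos.ne']
  -- if `l` is no eigenvector, applying `exp K` once more makes all inequalities strict
  have hlt : f w < f (σ⁻¹ • l) := by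
    rw [hf]
    simp only
    rw [Finset.lt_inf'_iff]
    intro x _
    have h1 := hpos _ hw' x
    rw [lt_div_iff₀ h1]
    have h2 := hBv x
    have h3 : B *ᵥ (K *ᵥ l) = K *ᵥ (B *ᵥ l) := by
      rw [Matrix.mulVec_mulVec l, Matrix.mulVec_mulVec l, hKB]
    rw [Matrix.mulVec_sub, Matrix.mulVec_smul, h3] at h2
    simp only [Pi.sub_apply, Pi.smul_apply, smul_eq_mul, sub_pos, Matrix.mulVec_smul] at h2 ⊢
    have : 0 < σ⁻¹ := by positivity
    calc _ = σ⁻¹ * (f w * (B *ᵥ l) x) := by simp only [hf]; ring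
      _ < _ := by gcongr
  exact absurd (hmax hw') (not_le.2 hlt)

omit [DecidableEq S] in
lemma vecMulVec_mul_self {R : Type*} [CommRing R] {r l : S → R} (h : l ⬝ᵥ r = 1) :
    Matrix.vecMulVec r l * Matrix.vecMulVec r l = Matrix.vecMulVec r l := by
  rw [Matrix.vecMulVec_mul_vecMulVec, h, one_smul]

/-- The semigroup of `K`, divided by `exp (t μ)`, converges to the rank-one projection built from
the left eigenvector `l` and the right eigenvector `r`. -/
structure IsDominant {𝕜 : Type*} [RCLike 𝕜] (K : Matrix S S 𝕜) (μ : 𝕜) (l r : S → 𝕜) : Prop where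
  left_eq : l ᵥ* K = μ • l
  right_eq : K *ᵥ r = μ • r
  dot : l ⬝ᵥ r = 1
  tendsto : Tendsto (fun t : ℝ => exp (t • (K - μ • 1))) atTop (𝓝 (Matrix.vecMulVec r l))

/-- The Perron–Frobenius data of `K`: a dominant eigenvalue with positive eigenvectors. -/
structure IsPerron (K : Matrix S S ℝ) (μ : ℝ) (l r : S → ℝ) : Prop extends
    IsDominant K μ l r where
  left_pos : ∀ x, 0 < l x
  right_pos : ∀ x, 0 < r x

omit [DecidableEq S] in
/-- A positive matrix fixing a positive row vector `l` contracts the vectors orthogonal to `l` in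
the weighted norm `∑ l_x |w_x|` (Doeblin's argument). -/
lemma exists_contraction [Nonempty S] {B : Matrix S S ℝ} (hB : ∀ y x, 0 < B y x) {l : S → ℝ}
    (hl : ∀ x, 0 < l x) (hlB : l ᵥ* B = l) :
    ∃ q : ℝ, 0 ≤ q ∧ q < 1 ∧ ∀ w : S → ℝ, l ⬝ᵥ w = 0 →
      ∑ y, l y * |(B *ᵥ w) y| ≤ q * ∑ x, l x * |w x| := by
  -- `η l_x` is the largest multiple of `l` below all rows of `B`
  obtain ⟨⟨y₀, x₀⟩, -, hmin⟩ := Finset.exists_min_image (Finset.univ : Finset (S × S))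
    (fun i => B i.1 i.2 / l i.2) Finset.univ_nonempty
  set η := B y₀ x₀ / l x₀ with hη
  have hηpos : 0 < η := div_pos (hB _ _) (hl _)
  have hη' : ∀ y x, 0 ≤ B y x - η * l x := by
    intro y x
    have := hmin (y, x) (Finset.mem_univ _)
    rw [le_div_iff₀ (hl x)] at this
    simpa using this
  have hcol : ∀ x, ∑ y, l y * (B y x - η * l x) = (1 - η * ∑ y, l y) * l x := by
    intro x
    have : ∑ y, l y * B y x = l x := congrFun hlB x
    simp only [mul_sub, Finset.sum_sub_distrib, this, ← Finset.sum_mul]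
    ring
  refine ⟨1 - η * ∑ y, l y, ?_, ?_, ?_⟩
  · have h1 := Finset.sum_nonneg (s := Finset.univ)
      (fun y _ => mul_nonneg (hl y).le (hη' y x₀))
    rw [hcol] at h1
    exact nonneg_of_mul_nonneg_left h1 (hl _)
  · have : 0 < ∑ y, l y := Finset.sum_pos (fun x _ => hl x) Finset.univ_nonempty
    nlinarith [mul_pos hηpos this]
  · intro w hw
    calc ∑ y, l y * |(B *ᵥ w) y| ≤ ∑ y, l y * ∑ x, (B y x - η * l x) * |w x| := by
          refine Finset.sum_le_sum fun y _ => mul_le_mul_of_nonneg_left ?_ (hl y).le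
          have : (B *ᵥ w) y = ∑ x, (B y x - η * l x) * w x := by
            simp only [sub_mul, Finset.sum_sub_distrib, mul_assoc, ← Finset.mul_sum]
            have : ∑ x, l x * w x = 0 := hw
            rw [this]; simp [Matrix.mulVec, dotProduct]
          rw [this]
          refine (Finset.abs_sum_le_sum_abs _ _).trans (Finset.sum_le_sum fun x _ => ?_)
          rw [abs_mul, abs_of_nonneg (hη' y x)]
      _ = ∑ x, (∑ y, l y * (B y x - η * l x)) * |w x| := by
          simp only [Finset.mul_sum, Finset.sum_mul]
          rw [Finset.sum_comm]
          simp only [mul_assoc]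
      _ = _ := by simp only [hcol, Finset.mul_sum, mul_assoc]

/-- Perron–Frobenius theorem: the contraction by `exp (K - μ)` on the vectors orthogonal to `l` gives
the convergence of the semigroup. -/
theorem IsMetzler.exists_isPerron [Nonempty S] {K : Matrix S S ℝ} (hK : IsMetzler K) :
    ∃ μ l r, IsPerron K μ l r := by
  obtain ⟨μ, l, hl, hleq⟩ := hK.transpose.exists_eigenvector
  rw [Matrix.mulVec_transpose] at hleq
  obtain ⟨μ', r', hr', hreq'⟩ := hK.exists_eigenvector
  have hdot : 0 < l ⬝ᵥ r' := Finset.sum_pos (fun x _ => mul_pos (hl x) (hr' x)) Finset.univ_nonempty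
  have hμ : μ' = μ := by
    have h1 : l ⬝ᵥ (K *ᵥ r') = (l ᵥ* K) ⬝ᵥ r' := Matrix.dotProduct_mulVec _ _ _
    rw [hreq', hleq, dotProduct_smul, smul_dotProduct] at h1
    exact mul_right_cancel₀ hdot.ne' h1
  set r := (l ⬝ᵥ r')⁻¹ • r' with hr
  have hlr : l ⬝ᵥ r = 1 := by rw [hr, dotProduct_smul, smul_eq_mul, inv_mul_cancel₀ hdot.ne']
  have hreq : K *ᵥ r = μ • r := by
    rw [hr, Matrix.mulVec_smul, hreq', hμ, smul_comm]
  refine ⟨μ, l, r, ⟨hleq, hreq, hlr, ?_⟩, hl, fun x => mul_pos (inv_pos.2 hdot) (hr' x)⟩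
  set X := K - μ • (1 : Matrix S S ℝ) with hX
  set P := Matrix.vecMulVec r l with hPdef
  have hXr : X *ᵥ r = 0 := by simp [hX, Matrix.sub_mulVec, hreq, Matrix.smul_mulVec]
  have hlX : l ᵥ* X = 0 := by simp [hX, Matrix.vecMul_sub, hleq, Matrix.vecMul_smul]
  have hXP : X * P = 0 := by
    rw [hPdef, Matrix.mul_vecMulVec, hXr]; ext; simp [Matrix.vecMulVec_apply]
  have hPX : P * X = 0 := by
    rw [hPdef, Matrix.vecMulVec_mul, hlX]; ext; simp [Matrix.vecMulVec_apply]
  have hPP : P * P = P := vecMulVec_mul_self hlr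
  set B := exp X with hBdef
  have hXM : IsMetzler X := by
    refine ⟨fun y x h => ?_, fun x y => Relation.ReflTransGen.mono ?_ _ _ (hK.connected x y)⟩
    · simpa [hX, h] using hK.nonneg y x h
    · intro a b h
      exact ⟨h.1, by simpa [hX, h.1.symm] using h.2⟩
  obtain ⟨q, hq0, hq1, hq⟩ := exists_contraction hXM.exp_pos hl (vecMul_exp_of_eq_zero hlX)
  have hB : ∀ (w : S → ℝ), l ⬝ᵥ w = 0 → ∀ n : ℕ, l ⬝ᵥ (B ^ n *ᵥ w) = 0 ∧
      ∑ y, l y * |(B ^ n *ᵥ w) y| ≤ q ^ n * ∑ x, l x * |w x| := by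
    intro w hw n
    induction n with
    | zero => simp [hw]
    | succ n ih =>
      rw [pow_succ', ← Matrix.mulVec_mulVec]
      refine ⟨?_, (hq _ ih.1).trans ?_⟩
      · rw [Matrix.dotProduct_mulVec, vecMul_exp_of_eq_zero hlX, ih.1]
      · rw [pow_succ', mul_assoc]
        exact mul_le_mul_of_nonneg_left ih.2 hq0
  have hBtend : ∀ (w : S → ℝ), l ⬝ᵥ w = 0 → ∀ y, Tendsto (fun n : ℕ => (B ^ n *ᵥ w) y) atTop (𝓝 0) := by
    intro w hw y
    refine squeeze_zero_norm (a := fun n => (l y)⁻¹ * (q ^ n * ∑ x, l x * |w x|)) ?_ ?_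
    · intro n
      rw [Real.norm_eq_abs, ← div_eq_inv_mul, le_div_iff₀ (hl y), mul_comm]
      refine le_trans ?_ (hB w hw n).2
      exact Finset.single_le_sum (f := fun y => l y * |(B ^ n *ᵥ w) y|)
        (fun y _ => mul_nonneg (hl y).le (abs_nonneg _)) (Finset.mem_univ y)
    · have := ((tendsto_pow_atTop_nhds_zero_of_lt_one hq0 hq1).mul_const (∑ x, l x * |w x|)).const_mul (l y)⁻¹
      simpa using this
  have hBP : Tendsto (fun n : ℕ => B ^ n * (1 - P)) atTop (𝓝 0) := by
    refine tendsto_pi_nhds.2 fun y => tendsto_pi_nhds.2 fun x => ?_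
    have hcol : l ⬝ᵥ ((1 - P) *ᵥ Pi.single x 1) = 0 := by
      rw [Matrix.dotProduct_mulVec, Matrix.vecMul_sub, hPdef, Matrix.vecMul_vecMulVec, hlr]
      simp
    have := hBtend _ hcol y
    rw [Matrix.zero_apply]
    refine this.congr fun n => ?_
    rw [Matrix.mulVec_mulVec, Matrix.mulVec_single_one]
    rfl
  have hexpn : ∀ n : ℕ, exp ((n : ℝ) • (X - P)) = B ^ n * (1 - P) + Real.exp (-n) • P := by
    intro n
    have hBnP : B ^ n * P = P := by
      have h := matrix_exp_mul_eq_smul (X := (n : ℝ) • X) (P := P) (c := 0) (by simp [hXP])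
      rw [Nat.cast_smul_eq_nsmul ℝ, Matrix.exp_nsmul] at h
      simpa using h
    rw [matrix_exp_smul_sub_eq hXP hPX hPP, Nat.cast_smul_eq_nsmul ℝ, Matrix.exp_nsmul, mul_sub, hBnP,
      mul_one]
  have hdec : Tendsto (fun n : ℕ => exp ((n : ℝ) • (X - P))) atTop (𝓝 0) := by
    simp only [hexpn]
    have h2 : Tendsto (fun n : ℕ => Real.exp (-(n : ℝ)) • P) atTop (𝓝 ((0 : ℝ) • P)) :=
      (Real.tendsto_exp_neg_atTop_nhds_zero.comp tendsto_natCast_atTop_atTop).smul_const P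
    simpa using hBP.add h2
  have hzero : Tendsto (fun t : ℝ => exp (t • (X - P))) atTop (𝓝 0) := by
    have h := (matrix_eventually_tendsto_exp (E := ℝ) (X := fun _ => X - P)
      (p₀ := 0) continuousAt_const hdec).self_of_nhds
    exact h.comp (tendsto_id.prodMk tendsto_const_nhds)
  have := (hzero.mul_const (1 - P)).const_add P
  simp only [zero_mul, add_zero] at this
  refine this.congr fun t => ?_
  rw [matrix_exp_smul_eq_add hXP hPX hPP]

end Perron

end SST

namespace SST

/-! ### Perturbation of a dominant eigenvalue -/

section Perturbation

open NormedSpace (exp)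

variable {S : Type*} [Fintype S] [DecidableEq S]

omit [DecidableEq S] in
/-- A simple eigenvalue and its eigenvector, normalized by `l₀ ⬝ᵥ r = 1`, depend smoothly on the
matrix entries (implicit function theorem). -/
lemma exists_smooth_eigenvector {𝕜 : Type*} [RCLike 𝕜] {E : Type*} [NormedAddCommGroup E]
    [NormedSpace 𝕜 E] [CompleteSpace E] {n : WithTop ℕ∞} (hn : n ≠ 0) {K : E → Matrix S S 𝕜}
    {x₀ : E} (hK : ∀ y x, ContDiffAt 𝕜 n (fun e => K e y x) x₀) {μ₀ : 𝕜} {l₀ r₀ : S → 𝕜}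
    (hr : K x₀ *ᵥ r₀ = μ₀ • r₀) (hl : l₀ ᵥ* K x₀ = μ₀ • l₀) (hlr : l₀ ⬝ᵥ r₀ = 1)
    (hsimple : ∀ w, K x₀ *ᵥ w = μ₀ • w → l₀ ⬝ᵥ w = 0 → w = 0) :
    ∃ (μ : E → 𝕜) (r : E → S → 𝕜), ContDiffAt 𝕜 n μ x₀ ∧ ContDiffAt 𝕜 n r x₀ ∧
      μ x₀ = μ₀ ∧ r x₀ = r₀ ∧ ∀ᶠ e in 𝓝 x₀, K e *ᵥ r e = μ e • r e ∧ l₀ ⬝ᵥ r e = 1 := by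
  set f : E × (𝕜 × (S → 𝕜)) → 𝕜 × (S → 𝕜) := fun q =>
    (∑ x, l₀ x * q.2.2 x, fun y => ∑ x, K q.1 y x * q.2.2 x - q.2.1 * q.2.2 y) with hf
  set u : E × (𝕜 × (S → 𝕜)) := (x₀, μ₀, r₀) with hu
  have hK' : ∀ y x, ContDiffAt 𝕜 n (fun q : E × (𝕜 × (S → 𝕜)) => K q.1 y x) u := fun y x =>
    ContDiffAt.comp u (hK y x) contDiffAt_fst
  have h2 : ∀ x, ContDiffAt 𝕜 n (fun q : E × (𝕜 × (S → 𝕜)) => q.2.2 x) u := fun x => by fun_prop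
  have hfc : ContDiffAt 𝕜 n f u := by
    refine ContDiffAt.prodMk ?_ (contDiffAt_pi.2 fun y => ?_)
    · exact ContDiffAt.sum fun x _ => contDiffAt_const.mul (h2 x)
    · refine (ContDiffAt.sum fun x _ => (hK' y x).mul (h2 x)).sub (ContDiffAt.mul ?_ (h2 y))
      fun_prop
  -- the partial derivative in `(μ, r)`, read off from the quadratic map `v ↦ f (x₀, v)`
  have hpart : ∀ v : 𝕜 × (S → 𝕜), (fderiv 𝕜 f u ∘L .inr 𝕜 E (𝕜 × (S → 𝕜))) v =
      (∑ x, l₀ x * v.2 x, fun y => ∑ x, K x₀ y x * v.2 x - (v.1 * r₀ y + μ₀ * v.2 y)) := by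
    intro v
    have hd : HasFDerivAt f (fderiv 𝕜 f u) u := (hfc.differentiableAt hn).hasFDerivAt
    have hline : HasDerivAt (fun t : 𝕜 => u + t • ((0 : E), v)) ((0 : E), v) 0 := by
      simpa using ((hasDerivAt_id (0 : 𝕜)).smul_const ((0 : E), v)).const_add u
    have h1 : HasDerivAt (fun t : 𝕜 => f (u + t • ((0 : E), v))) (fderiv 𝕜 f u ((0 : E), v)) 0 := by
      have := HasFDerivAt.comp_hasDerivAt (f := fun t : 𝕜 => u + t • ((0 : E), v)) (x := (0 : 𝕜))
        (l := f) (l' := fderiv 𝕜 f u) (by simpa using hd) hline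
      exact this
    have h3 : HasDerivAt (fun t : 𝕜 => f (u + t • ((0 : E), v)))
        (∑ x, l₀ x * v.2 x, fun y => ∑ x, K x₀ y x * v.2 x - (v.1 * r₀ y + μ₀ * v.2 y)) 0 := by
      simp only [hf, hu]
      have hr' : ∀ x, HasDerivAt (fun t : 𝕜 => r₀ x + t * v.2 x) (v.2 x) 0 := fun x => by
        simpa using ((hasDerivAt_id (0 : 𝕜)).mul_const (v.2 x)).const_add (r₀ x)
      have hm' : HasDerivAt (fun t : 𝕜 => μ₀ + t * v.1) v.1 0 := by
        simpa using ((hasDerivAt_id (0 : 𝕜)).mul_const v.1).const_add μ₀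
      refine HasDerivAt.prodMk ?_ (hasDerivAt_pi.2 fun y => ?_)
      · simpa using HasDerivAt.fun_sum (u := Finset.univ) fun x _ => (hr' x).const_mul (l₀ x)
      · have := (HasDerivAt.fun_sum (u := Finset.univ) fun x _ => (hr' x).const_mul (K x₀ y x)).sub
          (hm'.mul (hr' y))
        simp only [zero_mul, add_zero] at this
        refine this.congr_of_eventuallyEq (Eventually.of_forall fun t => ?_)
        simp
    exact h1.unique h3
  -- the partial derivative is injective because the eigenvalue is simple
  have hinv : (fderiv 𝕜 f u ∘L .inr 𝕜 E (𝕜 × (S → 𝕜))).IsInvertible := by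
    set T := (fderiv 𝕜 f u ∘L .inr 𝕜 E (𝕜 × (S → 𝕜))) with hT
    have hinj : Function.Injective T.toLinearMap := by
      rw [← LinearMap.ker_eq_bot, LinearMap.ker_eq_bot']
      intro v hv
      have hv' : T v = 0 := hv
      rw [hpart v] at hv'
      have hv1 : l₀ ⬝ᵥ v.2 = 0 := congrArg Prod.fst hv'
      have hv2 : K x₀ *ᵥ v.2 = v.1 • r₀ + μ₀ • v.2 := by
        ext y
        have := congrFun (congrArg Prod.snd hv') y
        exact sub_eq_zero.1 this
      have h3 : l₀ ⬝ᵥ (K x₀ *ᵥ v.2) = (l₀ ᵥ* K x₀) ⬝ᵥ v.2 := Matrix.dotProduct_mulVec _ _ _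
      rw [hv2, hl, dotProduct_add, dotProduct_smul, dotProduct_smul, smul_dotProduct, hv1, hlr] at h3
      have h4 : v.1 = 0 := by simpa using h3
      rw [h4, zero_smul, zero_add] at hv2
      exact Prod.ext h4 (hsimple _ hv2 hv1)
    exact ⟨(LinearEquiv.ofInjectiveEndo T.toLinearMap hinj).toContinuousLinearEquiv, by
      ext v <;> rfl⟩
  set ψ := hfc.implicitFunction hn hinv with hψ
  have hψc : ContDiffAt 𝕜 n ψ x₀ := hfc.contDiffAt_implicitFunction hn hinv
  have hψ0 : ψ x₀ = (μ₀, r₀) := hfc.implicitFunction_apply_self hn hinv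
  have hψe : ∀ᶠ e in 𝓝 x₀, f (e, ψ e) = f u := hfc.eventually_apply_implicitFunction hn hinv
  have hfu : f u = (1, 0) := by
    refine Prod.ext hlr ?_
    ext y
    have := congrFun hr y
    simp only [Matrix.mulVec, dotProduct] at this
    simp [hf, hu, this]
  refine ⟨fun e => (ψ e).1, fun e => (ψ e).2, contDiffAt_fst.comp x₀ hψc,
    contDiffAt_snd.comp x₀ hψc, congrArg Prod.fst hψ0, congrArg Prod.snd hψ0, ?_⟩
  filter_upwards [hψe] with e he
  rw [hfu] at he
  refine ⟨?_, congrArg Prod.fst he⟩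
  ext y
  exact sub_eq_zero.1 (congrFun (congrArg Prod.snd he) y)

lemma matrix_exp_map_ofReal (A : Matrix S S ℝ) :
    (exp A).map ((↑) : ℝ → ℂ) = exp (A.map ((↑) : ℝ → ℂ)) := by
  have hc : Continuous (Complex.ofRealHom.mapMatrix : Matrix S S ℝ →+* Matrix S S ℂ) :=
    continuous_id.matrix_map Complex.continuous_ofReal
  open scoped Matrix.Norms.Operator in
  exact NormedSpace.map_exp (Complex.ofRealHom.mapMatrix : Matrix S S ℝ →+* Matrix S S ℂ) hc A

namespace IsDominant

variable {𝕜 : Type*} [RCLike 𝕜] {K : Matrix S S 𝕜} {μ : 𝕜} {l r : S → 𝕜}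

lemma transpose (h : IsDominant K μ l r) : IsDominant Kᵀ μ r l := by
  refine ⟨by rw [Matrix.vecMul_transpose, h.right_eq], by rw [Matrix.mulVec_transpose, h.left_eq],
    by rw [dotProduct_comm, h.dot], ?_⟩
  have h1 := ((continuous_id.matrix_transpose (A := fun M : Matrix S S 𝕜 => M)).tendsto _).comp
    h.tendsto
  rw [Matrix.transpose_vecMulVec] at h1
  refine h1.congr fun t => ?_
  simp only [Function.comp]
  rw [← Matrix.exp_transpose]
  simp

/-- A dominant eigenvalue is simple: an eigenvector orthogonal to `l` is fixed by the normalized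
semigroup, whose limit annihilates it. -/
lemma simple (h : IsDominant K μ l r) {w : S → 𝕜} (hw : K *ᵥ w = μ • w) (hlw : l ⬝ᵥ w = 0) :
    w = 0 := by
  have hX : (K - μ • 1) * Matrix.of (fun i (_ : S) => w i) = 0 := by
    ext i j
    have := congrFun hw i
    simp only [Matrix.mulVec, dotProduct, Pi.smul_apply, smul_eq_mul] at this
    rw [sub_mul, Matrix.smul_mul, one_mul]
    simp [Matrix.mul_apply, this]
  have hfix : ∀ t : ℝ, exp (t • (K - μ • 1)) * Matrix.of (fun i (_ : S) => w i) =
      Matrix.of (fun i (_ : S) => w i) := by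
    intro t
    have := matrix_exp_mul_eq_smul (X := t • (K - μ • 1)) (P := Matrix.of (fun i (_ : S) => w i))
      (c := 0) (by rw [smul_mul_assoc, hX]; simp)
    simpa using this
  have hlim := h.tendsto.mul_const (Matrix.of (fun i (_ : S) => w i))
  simp only [hfix] at hlim
  have := tendsto_nhds_unique tendsto_const_nhds hlim
  ext i
  have h2 := congrFun (congrFun this i) i
  have h3 : ∑ x, r i * l x * w x = 0 := by
    simp only [mul_assoc, ← Finset.mul_sum]
    have : ∑ x, l x * w x = 0 := hlw
    rw [this, mul_zero]
  simpa [Matrix.mul_apply, Matrix.vecMulVec_apply, h3] using h2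

lemma ofReal {K : Matrix S S ℝ} {μ : ℝ} {l r : S → ℝ} (h : IsDominant K μ l r) :
    IsDominant (K.map ((↑) : ℝ → ℂ)) (μ : ℂ) (fun x => (l x : ℂ)) (fun x => (r x : ℂ)) := by
  have hmap : ∀ t : ℝ, exp (t • (K.map ((↑) : ℝ → ℂ) - (μ : ℂ) • 1)) =
      (exp (t • (K - μ • 1))).map ((↑) : ℝ → ℂ) := fun t => by
    rw [matrix_exp_map_ofReal]
    congr 1
    ext i j
    by_cases hij : i = j <;> simp [hij]
  refine ⟨?_, ?_, ?_, ?_⟩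
  · ext x
    have := congrFun h.left_eq x
    simp only [Matrix.vecMul, dotProduct, Pi.smul_apply, smul_eq_mul, Matrix.map_apply] at this ⊢
    exact_mod_cast this
  · ext x
    have := congrFun h.right_eq x
    simp only [Matrix.mulVec, dotProduct, Pi.smul_apply, smul_eq_mul, Matrix.map_apply] at this ⊢
    exact_mod_cast this
  · have := h.dot
    simp only [dotProduct] at this ⊢
    exact_mod_cast this
  · simp only [hmap]
    refine tendsto_pi_nhds.2 fun i => tendsto_pi_nhds.2 fun j => ?_
    have h1 := tendsto_pi_nhds.1 (tendsto_pi_nhds.1 h.tendsto i) j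
    have h2 := (Complex.continuous_ofReal.tendsto _).comp h1
    simp only [Matrix.map_apply, Matrix.vecMulVec_apply, Complex.ofReal_mul] at h2 ⊢
    exact h2

end IsDominant

/-- A positive left eigenvector is a multiple of the Perron vector. -/
lemma IsPerron.eq_smul_of_pos [Nonempty S] {K : Matrix S S ℝ} {μ μ' : ℝ} {l r l' : S → ℝ}
    (h : IsPerron K μ l r) (hl' : ∀ x, 0 < l' x) (he : l' ᵥ* K = μ' • l') :
    μ' = μ ∧ l' = (l' ⬝ᵥ r) • l := by
  have hpos : 0 < l' ⬝ᵥ r :=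
    Finset.sum_pos (fun x _ => mul_pos (hl' x) (h.right_pos x)) Finset.univ_nonempty
  have hμ : μ' = μ := by
    have h1 : l' ⬝ᵥ (K *ᵥ r) = (l' ᵥ* K) ⬝ᵥ r := Matrix.dotProduct_mulVec _ _ _
    rw [h.right_eq, he, dotProduct_smul, smul_dotProduct] at h1
    exact (mul_right_cancel₀ hpos.ne' h1).symm
  refine ⟨hμ, sub_eq_zero.1 (h.toIsDominant.transpose.simple ?_ ?_)⟩
  · rw [Matrix.mulVec_transpose, Matrix.sub_vecMul, he, Matrix.smul_vecMul, h.left_eq, hμ, smul_sub,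
      smul_comm]
  · rw [dotProduct_sub, dotProduct_smul, dotProduct_comm r l, h.dot, dotProduct_comm]
    simp

/-- A dominant eigenvalue persists, with holomorphic eigenvectors and locally uniform convergence of
the normalized semigroup, under holomorphic perturbation. -/
lemma exists_holomorphic_dominant [Nonempty S] {K : ℂ → Matrix S S ℂ}
    (hK : ∀ y x, Differentiable ℂ (fun e => K e y x)) {p₀ : ℂ} {μ₀ : ℂ} {l₀ r₀ : S → ℂ}
    (h : IsDominant (K p₀) μ₀ l₀ r₀) :
    ∃ (μ : ℂ → ℂ) (P : ℂ → Matrix S S ℂ), P p₀ = Matrix.vecMulVec r₀ l₀ ∧ ContinuousAt P p₀ ∧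
      ∀ᶠ p in 𝓝 p₀, Tendsto (fun q : ℝ × ℂ => exp (q.1 • (K q.2 - μ q.2 • 1))) (atTop ×ˢ 𝓝 p)
        (𝓝 (P p)) := by
  have hcd : ∀ y x, ContDiffAt ℂ 1 (fun e => K e y x) p₀ := fun y x =>
    (hK y x).contDiff.contDiffAt
  obtain ⟨μ, r, hμc, hrc, hμ0, hr0, hev⟩ := exists_smooth_eigenvector one_ne_zero hcd h.right_eq
    h.left_eq h.dot (fun w hw hw' => h.simple hw hw')
  obtain ⟨μ', l, hμc', hlc, hμ0', hl0, hev'⟩ := exists_smooth_eigenvector (l₀ := r₀) one_ne_zero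
    (K := fun p => (K p)ᵀ) (fun y x => hcd x y) h.transpose.right_eq
    h.transpose.left_eq h.transpose.dot (fun w hw hw' => h.transpose.simple hw hw')
  have hdotc : ContinuousAt (fun p => l p ⬝ᵥ r p) p₀ := by
    have h1 := hlc.continuousAt
    have h2 := hrc.continuousAt
    exact ContinuousAt.comp (f := fun p => (l p, r p)) (g := fun q : (S → ℂ) × (S → ℂ) => q.1 ⬝ᵥ q.2)
      (by fun_prop) (h1.prodMk h2)
  have hdot0 : l p₀ ⬝ᵥ r p₀ = 1 := by rw [hl0, hr0, h.dot]
  have hne : ∀ᶠ p in 𝓝 p₀, l p ⬝ᵥ r p ≠ 0 := hdotc.eventually_ne (by rw [hdot0]; exact one_ne_zero)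
  set P : ℂ → Matrix S S ℂ := fun p => (l p ⬝ᵥ r p)⁻¹ • Matrix.vecMulVec (r p) (l p) with hP
  have hP0 : P p₀ = Matrix.vecMulVec r₀ l₀ := by simp only [hP]; rw [hdot0, hl0, hr0]; simp
  have hPc : ∀ᶠ p in 𝓝 p₀, ContinuousAt P p := by
    filter_upwards [hne, hlc.eventually (by simp), hrc.eventually (by simp)] with p h0 h1 h2
    have h3 : ContinuousAt (fun p => Matrix.vecMulVec (r p) (l p)) p :=
      continuousAt_pi.2 fun i => continuousAt_pi.2 fun j =>
        (continuousAt_pi.1 h2.continuousAt i).mul (continuousAt_pi.1 h1.continuousAt j)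
    have h4 : ContinuousAt (fun p => l p ⬝ᵥ r p) p :=
      ContinuousAt.comp (f := fun p => (l p, r p))
        (g := fun q : (S → ℂ) × (S → ℂ) => q.1 ⬝ᵥ q.2) (by fun_prop)
        (h1.continuousAt.prodMk h2.continuousAt)
    exact (h4.inv₀ h0).smul h3
  set X : ℂ → Matrix S S ℂ := fun p => K p - μ p • 1 with hX
  have hXc : ContinuousAt X p₀ := by
    have h1 : ContinuousAt K p₀ := continuousAt_pi.2 fun i => continuousAt_pi.2 fun j =>
      (hK i j).continuous.continuousAt
    exact h1.sub (hμc.continuousAt.smul continuousAt_const)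
  -- `P p` is the spectral projection of `X p` for the eigenvalue zero
  have halg : ∀ᶠ p in 𝓝 p₀, X p * P p = 0 ∧ P p * X p = 0 ∧ P p * P p = P p := by
    filter_upwards [hev, hev', hne] with p h1 h2 h3
    rw [Matrix.mulVec_transpose] at h2
    have hμμ : μ p = μ' p := by
      have h4 : l p ⬝ᵥ (K p *ᵥ r p) = (l p ᵥ* K p) ⬝ᵥ r p := Matrix.dotProduct_mulVec _ _ _
      rw [h1.1, h2.1, dotProduct_smul, smul_dotProduct] at h4
      exact mul_right_cancel₀ h3 h4
    refine ⟨?_, ?_, ?_⟩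
    · simp only [hX, hP]
      rw [Matrix.mul_smul, Matrix.mul_vecMulVec, Matrix.sub_mulVec, h1.1, Matrix.smul_mulVec,
        Matrix.one_mulVec, sub_self]
      ext; simp
    · simp only [hX, hP]
      rw [Matrix.smul_mul, Matrix.vecMulVec_mul, Matrix.vecMul_sub, h2.1, Matrix.vecMul_smul,
        Matrix.vecMul_one, hμμ, sub_self]
      ext; simp
    · simp only [hP]
      rw [Matrix.smul_mul, Matrix.mul_smul, Matrix.vecMulVec_mul_vecMulVec]
      rw [Matrix.vecMulVec_smul, smul_smul, smul_smul, inv_mul_cancel_right₀ h3]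
  -- removing the projection leaves a decaying semigroup, and decay is stable
  have hdec : Tendsto (fun n : ℕ => exp ((n : ℝ) • (X p₀ - P p₀))) atTop (𝓝 0) := by
    obtain ⟨h1, h2, h3⟩ := halg.self_of_nhds
    have e : ∀ t : ℝ, exp (t • (X p₀ - P p₀)) = exp (t • X p₀) - P p₀ + Real.exp (-t) • P p₀ :=
      fun t => matrix_exp_smul_sub_eq h1 h2 h3 t
    simp only [e]
    have h4 : Tendsto (fun t : ℝ => exp (t • X p₀)) atTop (𝓝 (P p₀)) := by
      rw [hP0]; simp only [hX]; rw [hμ0]; exact h.tendsto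
    have h5 := (h4.sub_const (P p₀)).add (Real.tendsto_exp_neg_atTop_nhds_zero.smul_const (P p₀))
    simp only [sub_self, zero_smul, add_zero] at h5
    exact h5.comp tendsto_natCast_atTop_atTop
  refine ⟨μ, P, hP0, hPc.self_of_nhds, ?_⟩
  filter_upwards [matrix_eventually_tendsto_exp (X := fun p => X p - P p)
    (hXc.sub hPc.self_of_nhds) hdec, hPc, halg.eventually_nhds] with p hp hPp halgp
  have hP' : Tendsto (fun q : ℝ × ℂ => P q.2) (atTop ×ˢ 𝓝 p) (𝓝 (P p)) :=
    hPp.tendsto.comp tendsto_snd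
  have hlim := hP'.add (hp.mul (hP'.const_sub 1))
  rw [zero_mul, add_zero] at hlim
  refine hlim.congr' ?_
  filter_upwards [(eventually_true (atTop : Filter ℝ)).prod_mk halgp] with q hq
  exact (matrix_exp_smul_eq_add hq.2.1 hq.2.2.1 hq.2.2.2 q.1).symm

end Perturbation

end SST

namespace SST

/-! ### Uniform estimates for smooth functions of several variables -/

section Calculus

open scoped ContDiff

variable {E A Z F : Type*} [NormedAddCommGroup E] [NormedSpace ℝ E] [NormedAddCommGroup A]
  [NormedSpace ℝ A] [NormedAddCommGroup Z] [NormedSpace ℝ Z] [NormedAddCommGroup F]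
  [NormedSpace ℝ F]

lemma hasDerivAt_snd {f : E × ℝ → F} (hf : Differentiable ℝ f) (x : E) (v : ℝ) :
    HasDerivAt (fun v => f (x, v)) (fderiv ℝ f (x, v) (0, 1)) v := by
  have h1 : HasDerivAt (fun v : ℝ => (x, v)) ((0 : E), (1 : ℝ)) v :=
    (hasDerivAt_const v x).prodMk (hasDerivAt_id v)
  exact (hf (x, v)).hasFDerivAt.comp_hasDerivAt v h1

lemma contDiff_iteratedDeriv_snd {f : E × ℝ → ℝ} (hf : ContDiff ℝ ∞ f) (k : ℕ) :
    ContDiff ℝ ∞ (fun q : E × ℝ => iteratedDeriv k (fun v => f (q.1, v)) q.2) := by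
  induction k with
  | zero => simpa using hf
  | succ k ih =>
    have e : (fun q : E × ℝ => iteratedDeriv (k + 1) (fun v => f (q.1, v)) q.2) = fun q =>
        fderiv ℝ (fun q : E × ℝ => iteratedDeriv k (fun v => f (q.1, v)) q.2) q (0, 1) := by
      ext q
      rw [iteratedDeriv_succ]
      exact (hasDerivAt_snd (ih.differentiable (by simp)) q.1 q.2).deriv
    rw [e]
    exact (ih.fderiv_right (m := ∞) le_rfl).clm_apply contDiff_const

/-- Differentiation in the first variable commutes with iterated differentiation in the second. -/
lemma fderiv_iteratedDeriv_snd {f : E × ℝ → ℝ} (hf : ContDiff ℝ ∞ f) (k : ℕ) (δ : E) (q : E × ℝ) :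
    fderiv ℝ (fun q : E × ℝ => iteratedDeriv k (fun v => f (q.1, v)) q.2) q (δ, 0) =
      iteratedDeriv k (fun v => fderiv ℝ f (q.1, v) (δ, 0)) q.2 := by
  induction k generalizing q with
  | zero => simp
  | succ k ih =>
    set G := fun q : E × ℝ => iteratedDeriv k (fun v => f (q.1, v)) q.2 with hG
    have hGc : ContDiff ℝ ∞ G := contDiff_iteratedDeriv_snd hf k
    have hG' : Differentiable ℝ (fderiv ℝ G) :=
      (hGc.fderiv_right (m := ∞) le_rfl).differentiable (by simp)
    have e : (fun q : E × ℝ => iteratedDeriv (k + 1) (fun v => f (q.1, v)) q.2) = fun q =>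
        fderiv ℝ G q (0, 1) := by
      ext q
      rw [iteratedDeriv_succ]
      exact (hasDerivAt_snd (hGc.differentiable (by simp)) q.1 q.2).deriv
    have hsymm : IsSymmSndFDerivAt ℝ G q :=
      hGc.contDiffAt.isSymmSndFDerivAt (by simpa using WithTop.coe_le_coe.2 (le_top : (2 : ℕ∞) ≤ ⊤))
    rw [e, fderiv_clm_apply (hG' q) (differentiableAt_const _), iteratedDeriv_succ]
    have e2 : iteratedDeriv k (fun v => fderiv ℝ f (q.1, v) (δ, 0)) =
        fun v => fderiv ℝ G (q.1, v) (δ, 0) := by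
      ext v; exact (ih (q.1, v)).symm
    rw [e2]
    have h3 := (hasDerivAt_snd (f := fun q => fderiv ℝ G q (δ, 0))
      (hG'.clm_apply (differentiable_const _)) q.1 q.2).deriv
    rw [h3, fderiv_clm_apply (hG' _) (differentiableAt_const _)]
    simpa using hsymm (δ, 0) (0, 1)

/-- A `C¹` function is Lipschitz in one variable, uniformly for the other in a compact set. -/
lemma exists_lipschitz_snd {f : A × Z → F} (hf : ContDiff ℝ 1 f) {KA : Set A} {KZ : Set Z}
    (hKA : IsCompact KA) (hKZ : IsCompact KZ) (hconv : Convex ℝ KZ) :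
    ∃ C : ℝ, 0 ≤ C ∧ ∀ a ∈ KA, ∀ z ∈ KZ, ∀ w ∈ KZ, ‖f (a, w) - f (a, z)‖ ≤ C * ‖w - z‖ := by
  have hc : Continuous (fun q : A × Z => fderiv ℝ f q ∘L .inr ℝ A Z) :=
    (hf.continuous_fderiv one_ne_zero).clm_comp continuous_const
  obtain ⟨C, hC⟩ := (hKA.prod hKZ).exists_bound_of_continuousOn hc.continuousOn
  refine ⟨max C 0, le_max_right _ _, fun a ha z hz w hw => ?_⟩
  refine hconv.norm_image_sub_le_of_norm_hasFDerivWithin_le (f := fun z => f (a, z))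
    (f' := fun z => fderiv ℝ f (a, z) ∘L .inr ℝ A Z) (fun x hx => ?_)
    (fun x hx => (hC (a, x) ⟨ha, hx⟩).trans (le_max_left _ _)) hz hw
  exact ((hf.differentiable one_ne_zero (a, x)).hasFDerivAt.comp x
    (hasFDerivAt_prodMk_right a x)).hasFDerivWithinAt

/-- First-order Taylor estimate in one variable, uniform in the other. -/
lemma exists_taylor_snd {f : A × Z → ℝ} (hf : ContDiff ℝ 2 f) {KA : Set A} {KZ : Set Z}
    (hKA : IsCompact KA) (hKZ : IsCompact KZ) (hconv : Convex ℝ KZ) :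
    ∃ C : ℝ, 0 ≤ C ∧ ∀ a ∈ KA, ∀ z ∈ KZ, ∀ w ∈ KZ,
      |f (a, w) - f (a, z) - fderiv ℝ f (a, z) (0, w - z)| ≤ C * ‖w - z‖ ^ 2 := by
  have hg : ContDiff ℝ 1 (fun q : A × Z => fderiv ℝ f q ∘L .inr ℝ A Z) :=
    (hf.fderiv_right (m := 1) (by norm_num)).clm_comp contDiff_const
  obtain ⟨C, hC0, hC⟩ := exists_lipschitz_snd hg hKA hKZ hconv
  refine ⟨C, hC0, fun a ha z hz w hw => ?_⟩
  have hseg : segment ℝ z w ⊆ KZ := hconv.segment_subset hz hw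
  have h := (convex_segment z w).norm_image_sub_le_of_norm_hasFDerivWithin_le'
    (f := fun z => f (a, z)) (f' := fun z => fderiv ℝ f (a, z) ∘L .inr ℝ A Z)
    (φ := fderiv ℝ f (a, z) ∘L .inr ℝ A Z) (C := C * ‖w - z‖) (fun x hx => ?_)
    (fun x hx => ?_) (left_mem_segment ℝ z w) (right_mem_segment ℝ z w)
  · simpa [pow_two, mul_assoc] using h
  · exact ((hf.differentiable two_ne_zero (a, x)).hasFDerivAt.comp x
      (hasFDerivAt_prodMk_right a x)).hasFDerivWithinAt
  · refine (hC a ha z hz x (hseg hx)).trans (mul_le_mul_of_nonneg_left ?_ hC0)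
    obtain ⟨s, t, hs, ht, hst, rfl⟩ := hx
    have : s • z + t • w - z = t • (w - z) := by
      rw [show s = 1 - t by linarith, sub_smul, smul_sub, one_smul]; abel
    rw [this, norm_smul, Real.norm_of_nonneg ht]
    exact mul_le_of_le_one_left (norm_nonneg _) (by linarith)

/-- A function vanishing at `y = 0` has increments in `z` of order `y ‖w - z‖`. -/
lemma exists_lipschitz_of_zero {f : (A × Z) × ℝ → ℝ} (hf : ContDiff ℝ 2 f)
    (h0 : ∀ a z, f ((a, z), 0) = 0) {KA : Set A} {KZ : Set Z}
    (hKA : IsCompact KA) (hKZ : IsCompact KZ) (hconv : Convex ℝ KZ) (R : ℝ) :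
    ∃ C : ℝ, 0 ≤ C ∧ ∀ a ∈ KA, ∀ z ∈ KZ, ∀ w ∈ KZ, ∀ y ∈ Set.Icc 0 R,
      |f ((a, w), y) - f ((a, z), y)| ≤ C * y * ‖w - z‖ := by
  have hg : ContDiff ℝ 1 (fun q : (A × ℝ) × Z => fderiv ℝ f ((q.1.1, q.2), q.1.2) (0, 1)) := by
    have h1 := (hf.fderiv_right (m := 1) (by norm_num)).clm_apply
      (contDiff_const (c := ((0 : A × Z), (1 : ℝ))))
    exact h1.comp (g := fun q => fderiv ℝ f q (0, 1))
      (f := fun q : (A × ℝ) × Z => ((q.1.1, q.2), q.1.2)) (by fun_prop)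
  obtain ⟨C, hC0, hC⟩ := exists_lipschitz_snd hg (hKA.prod (isCompact_Icc (a := 0) (b := R))) hKZ hconv
  refine ⟨C, hC0, fun a ha z hz w hw y hy => ?_⟩
  have h := (convex_Icc (0 : ℝ) R).norm_image_sub_le_of_norm_hasDerivWithin_le
    (f := fun y => f ((a, w), y) - f ((a, z), y))
    (f' := fun y => fderiv ℝ f ((a, w), y) (0, 1) - fderiv ℝ f ((a, z), y) (0, 1))
    (C := C * ‖w - z‖) (fun x hx => ?_) (fun x hx => ?_)
    (Set.left_mem_Icc.2 (hy.1.trans hy.2)) hy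
  · simp only [h0, sub_zero, Real.norm_eq_abs, abs_of_nonneg hy.1] at h
    linarith
  · exact ((hasDerivAt_snd (hf.differentiable two_ne_zero) _ _).sub
      (hasDerivAt_snd (hf.differentiable two_ne_zero) _ _)).hasDerivWithinAt
  · exact hC (a, x) ⟨ha, hx⟩ z hz w hw

/-- The defect of additivity of a two-point function that vanishes on the diagonal. -/
lemma exists_defect_le {f : Z × Z → ℝ} (hf : ContDiff ℝ 2 f) (h0 : ∀ z, f (z, z) = 0) {K : Set Z}
    (hK : IsCompact K) (hconv : Convex ℝ K) :
    ∃ C : ℝ, 0 ≤ C ∧ ∀ z ∈ K, ∀ w ∈ K, ∀ w' ∈ K,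
      |f (z, w') - f (z, w) - f (w, w')| ≤ C * ‖w - z‖ * ‖w' - w‖ := by
  have hg : ContDiff ℝ 1 (fun q : Z × Z => fderiv ℝ f (q.2, q.1) ∘L .inr ℝ Z Z) := by
    have h1 : ContDiff ℝ 1 (fun q : Z × Z => fderiv ℝ f q ∘L .inr ℝ Z Z) :=
      (hf.fderiv_right (m := 1) (by norm_num)).clm_comp contDiff_const
    exact h1.comp (f := fun q : Z × Z => (q.2, q.1)) (by fun_prop)
  obtain ⟨C, hC0, hC⟩ := exists_lipschitz_snd hg hK hK hconv
  refine ⟨C, hC0, fun z hz w hw w' hw' => ?_⟩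
  have hd : ∀ z x, HasFDerivAt (fun x => f (z, x)) (fderiv ℝ f (z, x) ∘L .inr ℝ Z Z) x := fun z x =>
    (hf.differentiable two_ne_zero (z, x)).hasFDerivAt.comp x (hasFDerivAt_prodMk_right z x)
  have h := hconv.norm_image_sub_le_of_norm_hasFDerivWithin_le
    (f := fun x => f (z, x) - f (w, x))
    (f' := fun x => fderiv ℝ f (z, x) ∘L .inr ℝ Z Z - fderiv ℝ f (w, x) ∘L .inr ℝ Z Z)
    (C := C * ‖w - z‖) (fun x hx => ((hd z x).sub (hd w x)).hasFDerivWithinAt) (fun x hx => ?_) hw hw'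
  · rw [Real.norm_eq_abs] at h
    simp only [h0, sub_zero] at h
    convert h using 2
    ring
  · rw [norm_sub_rev]
    exact hC x hx z hz w hw

/-! ### Sums over partitions -/

lemma sum_range_mul_eq (f : ℕ → ℝ) (N m : ℕ) :
    ∑ j ∈ Finset.range (N * m), f j = ∑ j ∈ Finset.range N, ∑ i ∈ Finset.range m, f (j * m + i) := by
  induction N with
  | zero => simp
  | succ N ih => rw [Nat.succ_mul, Finset.sum_range_add, ih, Finset.sum_range_succ]

/-- A sewing lemma: if the defect of additivity of `Ξ` is of second order, the sums of `Ξ` over the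
equidistant partitions of `[0, 1]` converge. -/
lemma exists_tendsto_partition_sum {Ξ : ℝ → ℝ → ℝ} {C : ℝ} (hC : 0 ≤ C)
    (h : ∀ s u t, 0 ≤ s → s ≤ u → u ≤ t → t ≤ 1 →
      |Ξ s t - Ξ s u - Ξ u t| ≤ C * (u - s) * (t - u)) :
    ∃ l, Tendsto (fun N : ℕ => ∑ j ∈ Finset.range N, Ξ (j / N) ((j + 1) / N)) atTop (𝓝 l) := by
  set a : ℕ → ℝ := fun N => ∑ j ∈ Finset.range N, Ξ (j / N) ((j + 1) / N) with ha
  have hdiag : ∀ s, 0 ≤ s → s ≤ 1 → Ξ s s = 0 := by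
    intro s h0 h1
    have := h s s s h0 le_rfl le_rfl h1
    simp at this
    exact this
  -- splitting one interval into `m` pieces of length `d`
  have hsplit : ∀ (s d : ℝ) (m : ℕ), 0 ≤ s → 0 ≤ d → s + m * d ≤ 1 →
      |Ξ s (s + m * d) - ∑ i ∈ Finset.range m, Ξ (s + i * d) (s + (i + 1) * d)|
        ≤ C * (m * d) ^ 2 := by
    intro s d m hs hd
    induction m with
    | zero => intro h1; simp at h1 ⊢; simp [hdiag s hs h1]
    | succ m ih =>
      intro h1
      push_cast at h1 ⊢
      have h2 : s + m * d ≤ 1 := by linarith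
      have h3 := ih h2
      have h4 := h s (s + m * d) (s + (m + 1) * d) hs (by nlinarith [mul_nonneg (Nat.cast_nonneg (α := ℝ) m) hd]) (by linarith) h1
      rw [Finset.sum_range_succ]
      have e : Ξ s (s + (m + 1) * d) - (∑ i ∈ Finset.range m, Ξ (s + i * d) (s + (i + 1) * d) +
          Ξ (s + m * d) (s + (m + 1) * d)) =
          (Ξ s (s + m * d) - ∑ i ∈ Finset.range m, Ξ (s + i * d) (s + (i + 1) * d)) +
          (Ξ s (s + (m + 1) * d) - Ξ s (s + m * d) - Ξ (s + m * d) (s + (m + 1) * d)) := by ring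
      rw [e]
      refine (abs_add_le _ _).trans ((add_le_add h3 h4).trans ?_)
      have hm : (0 : ℝ) ≤ m := Nat.cast_nonneg m
      have : 0 ≤ C * d ^ 2 := by positivity
      nlinarith [mul_nonneg hm this]
  -- two partitions are compared through their common refinement
  have hcomp : ∀ N m : ℕ, 0 < N → 0 < m → |a N - a (N * m)| ≤ C / N := by
    intro N m hN hm
    have hN' : (0 : ℝ) < N := by exact_mod_cast hN
    have hm' : (0 : ℝ) < m := by exact_mod_cast hm
    simp only [ha]
    rw [sum_range_mul_eq, ← Finset.sum_sub_distrib]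
    calc _ ≤ ∑ j ∈ Finset.range N, |Ξ (j / N) ((j + 1) / N) - ∑ i ∈ Finset.range m,
          Ξ (((j * m + i : ℕ) : ℝ) / (N * m : ℕ)) ((((j * m + i : ℕ) : ℝ) + 1) / (N * m : ℕ))| :=
          Finset.abs_sum_le_sum_abs _ _
      _ ≤ ∑ j ∈ Finset.range N, C * (1 / N) ^ 2 := by
          refine Finset.sum_le_sum fun j hj => ?_
          have hj' : (j : ℝ) + 1 ≤ N := by exact_mod_cast Finset.mem_range.1 hj
          have h1 := hsplit (j / N) (1 / (N * m)) m (by positivity) (by positivity) (by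
            have : (j : ℝ) / N + m * (1 / (N * m)) = (j + 1) / N := by field_simp
            rw [this, div_le_one hN']; exact hj')
          have e1 : (j : ℝ) / N + m * (1 / (N * m)) = (j + 1) / N := by field_simp
          have e2 : (m : ℝ) * (1 / (N * m)) = 1 / N := by field_simp
          rw [e1, e2] at h1
          have e3 : ∀ i : ℕ, ((j * m + i : ℕ) : ℝ) / (N * m : ℕ) = j / N + i * (1 / (N * m)) := by
            intro i; push_cast; field_simp
          have e4 : ∀ i : ℕ, (((j * m + i : ℕ) : ℝ) + 1) / (N * m : ℕ) =
              j / N + (i + 1) * (1 / (N * m)) := by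
            intro i; push_cast; field_simp; ring
          simp only [e3, e4]
          exact h1
      _ = C / N := by
          rw [Finset.sum_const, Finset.card_range, nsmul_eq_mul]; field_simp
  have hcauchy : CauchySeq a := by
    rw [Metric.cauchySeq_iff']
    intro δ hδ
    obtain ⟨N₀, hN₀⟩ := exists_nat_gt (2 * C / δ)
    refine ⟨N₀ + 1, fun n hn => ?_⟩
    have hn0 : 0 < n := by omega
    have h1 := hcomp n (N₀ + 1) hn0 (by omega)
    have h2 := hcomp (N₀ + 1) n (by omega) hn0
    rw [mul_comm] at h2
    have hN : (0 : ℝ) < ((N₀ + 1 : ℕ) : ℝ) := by positivity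
    have h3 : C / n ≤ C / ((N₀ + 1 : ℕ) : ℝ) :=
      div_le_div_of_nonneg_left hC hN (by exact_mod_cast hn)
    have h4 : 2 * (C / ((N₀ + 1 : ℕ) : ℝ)) < δ := by
      rw [← mul_div_assoc, div_lt_iff₀ hN]
      rw [div_lt_iff₀ hδ] at hN₀
      push_cast
      nlinarith
    rw [Real.dist_eq]
    have h5 := abs_sub_le (a n) (a (n * (N₀ + 1))) (a (N₀ + 1))
    rw [abs_sub_comm (a (n * (N₀ + 1)))] at h5
    linarith
  exact cauchySeq_tendsto_of_complete hcauchy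

/-! ### Taylor remainders -/

/-- The remainder at `0` of the Taylor polynomial of degree `2n - 1` at `1/2`. -/
noncomputable def taylorRem (n : ℕ) (f : ℝ → ℝ) : ℝ :=
  f 0 - ∑ k ∈ Finset.range (2 * n), (-1 / 2 : ℝ) ^ k / k.factorial * iteratedDeriv k f (1 / 2)

lemma taylorRem_add {n : ℕ} {f g : ℝ → ℝ} (hf : ContDiff ℝ ∞ f) (hg : ContDiff ℝ ∞ g) :
    taylorRem n (fun p => f p + g p) = taylorRem n f + taylorRem n g := by
  have : ∀ k, iteratedDeriv k (fun p => f p + g p) (1 / 2) =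
      iteratedDeriv k f (1 / 2) + iteratedDeriv k g (1 / 2) := fun k =>
    iteratedDeriv_fun_add (hf.contDiffAt.of_le (by exact_mod_cast le_top))
      (hg.contDiffAt.of_le (by exact_mod_cast le_top))
  simp only [taylorRem, this, mul_add, Finset.sum_add_distrib]
  ring

lemma taylorRem_const_mul {n : ℕ} (c : ℝ) (f : ℝ → ℝ) :
    taylorRem n (fun p => c * f p) = c * taylorRem n f := by
  have : ∀ k, iteratedDeriv k (fun p => c * f p) (1 / 2) = c * iteratedDeriv k f (1 / 2) := fun k =>
    iteratedDeriv_const_mul_field c f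
  simp only [taylorRem, this, mul_sub, Finset.mul_sum]
  congr 1
  exact Finset.sum_congr rfl fun k _ => by ring

lemma taylorRem_sum {n : ℕ} {ι : Type*} (s : Finset ι) {f : ι → ℝ → ℝ}
    (hf : ∀ i, ContDiff ℝ ∞ (f i)) :
    taylorRem n (fun p => ∑ i ∈ s, f i p) = ∑ i ∈ s, taylorRem n (f i) := by
  classical
  induction s using Finset.induction_on with
  | empty => simpa using taylorRem_const_mul (n := n) 0 (fun _ => 0)
  | insert i s his ih =>
    simp only [Finset.sum_insert his]
    rw [taylorRem_add (hf i) (ContDiff.sum fun i _ => hf i), ih]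

lemma abs_taylorRem_le {n : ℕ} (hn : 1 ≤ n) {f : ℝ → ℝ} (hf : ContDiff ℝ ∞ f) {C : ℝ}
    (hC : ∀ p ∈ Set.Icc (0 : ℝ) (1 / 2), |iteratedDeriv (2 * n) f p| ≤ C) :
    |taylorRem n f| ≤ C := by
  obtain ⟨m, hm⟩ : ∃ m, 2 * n = m + 1 := ⟨2 * n - 1, by omega⟩
  have hne : (1 / 2 : ℝ) ≠ 0 := by norm_num
  obtain ⟨x', hx', h⟩ := taylor_mean_remainder_lagrange_iteratedDeriv (n := m) hne
    (f := f) (hf.contDiffOn.of_le (by exact_mod_cast le_top))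
  have e : taylorRem n f = f 0 - taylorWithinEval f m (Set.uIcc (1 / 2) 0) (1 / 2) 0 := by
    rw [taylorRem, hm, taylor_within_apply]
    congr 1
    refine Finset.sum_congr rfl fun k _ => ?_
    rw [iteratedDerivWithin_eq_iteratedDeriv (uniqueDiffOn_uIcc hne)
      (hf.contDiffAt.of_le (by exact_mod_cast le_top)) Set.left_mem_uIcc, smul_eq_mul]
    ring
  rw [e, h]
  have hx : x' ∈ Set.Icc (0 : ℝ) (1 / 2) := by
    rw [Set.uIoo_comm, Set.uIoo_of_lt (by norm_num)] at hx'
    exact Set.Ioo_subset_Icc_self hx'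
  have h1 := hC x' hx
  rw [hm] at h1
  have hfac : (1 : ℝ) ≤ (m + 1).factorial := by exact_mod_cast Nat.one_le_iff_ne_zero.2 (Nat.factorial_ne_zero _)
  have hC0 : 0 ≤ C := (abs_nonneg _).trans h1
  rw [abs_div, abs_mul, abs_of_pos (lt_of_lt_of_le one_pos hfac), abs_pow]
  have h2 : |(0 : ℝ) - 1 / 2| ^ (m + 1) ≤ 1 := pow_le_one₀ (abs_nonneg _) (by
    rw [zero_sub, abs_neg, abs_of_pos] <;> norm_num)
  refine (div_le_self (by positivity) hfac).trans ?_
  calc _ ≤ C * 1 := mul_le_mul h1 h2 (by positivity) hC0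
    _ = C := mul_one C

/-- For an odd function the even derivative gains one order: it vanishes at the centre. -/
lemma abs_taylorRem_le_of_odd {n : ℕ} (hn : 1 ≤ n) {f : ℝ → ℝ} (hf : ContDiff ℝ ∞ f)
    (hodd : ∀ p, f (-p) = -f p) {C : ℝ}
    (hC : ∀ p ∈ Set.Icc (0 : ℝ) (1 / 2), |iteratedDeriv (2 * n + 1) f p| ≤ C) :
    |taylorRem n f| ≤ C := by
  have h0 : iteratedDeriv (2 * n) f 0 = 0 := by
    have h1 : iteratedDeriv (2 * n) (fun p => f (-p)) 0 = iteratedDeriv (2 * n) f 0 := by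
      rw [iteratedDeriv_comp_neg]; simp
    have h2 : iteratedDeriv (2 * n) (fun p => f (-p)) 0 = -iteratedDeriv (2 * n) f 0 := by
      have : (fun p => f (-p)) = fun p => -f p := funext hodd
      rw [this, iteratedDeriv_fun_neg]
    linarith
  have hC0 : 0 ≤ C := (abs_nonneg _).trans (hC 0 (by norm_num))
  refine abs_taylorRem_le hn hf fun p hp => ?_
  have hd : ∀ x, HasDerivAt (iteratedDeriv (2 * n) f) (iteratedDeriv (2 * n + 1) f x) x := fun x => by
    rw [iteratedDeriv_succ]
    exact ((hf.differentiable_iteratedDeriv (2 * n)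
      (WithTop.coe_lt_coe.2 (ENat.natCast_lt_top _))) x).hasDerivAt
  have h := (convex_Icc (0 : ℝ) (1 / 2)).norm_image_sub_le_of_norm_hasDerivWithin_le
    (fun x _ => (hd x).hasDerivWithinAt) hC (Set.left_mem_Icc.2 (by norm_num)) hp
  rw [h0, sub_zero, sub_zero, Real.norm_eq_abs, Real.norm_of_nonneg hp.1] at h
  nlinarith [hp.2]

/-- The Taylor remainder in the second variable depends smoothly on the first. -/
lemma contDiff_taylorRem {f : E × ℝ → ℝ} (hf : ContDiff ℝ ∞ f) (n : ℕ) :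
    ContDiff ℝ ∞ (fun x => taylorRem n fun p => f (x, p)) := by
  refine ContDiff.sub (hf.comp (by fun_prop)) (ContDiff.sum fun k _ => contDiff_const.mul ?_)
  exact (contDiff_iteratedDeriv_snd hf k).comp (f := fun x : E => (x, (1 / 2 : ℝ))) (by fun_prop)

/-- The Taylor remainder in the second variable commutes with differentiation in the first. -/
lemma fderiv_taylorRem {f : E × ℝ → ℝ} (hf : ContDiff ℝ ∞ f) (n : ℕ) (x δ : E) :
    fderiv ℝ (fun x => taylorRem n fun p => f (x, p)) x δ =
      taylorRem n fun p => fderiv ℝ f (x, p) (δ, 0) := by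
  have hd : ∀ (g : E × ℝ → ℝ), ContDiff ℝ ∞ g → ∀ v : ℝ,
      HasFDerivAt (fun x => g (x, v)) (fderiv ℝ g (x, v) ∘L .inl ℝ E ℝ) x := fun g hg v =>
    ((hg.differentiable (by simp)) (x, v)).hasFDerivAt.comp x (hasFDerivAt_prodMk_left x v)
  have h := (hd f hf 0).sub (HasFDerivAt.fun_sum (u := Finset.range (2 * n)) fun k _ =>
    (hd _ (contDiff_iteratedDeriv_snd hf k) (1 / 2)).const_mul ((-1 / 2 : ℝ) ^ k / k.factorial))
  have h' := h.fderiv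
  have e : fderiv ℝ (fun x => taylorRem n fun p => f (x, p)) x = _ := h'
  rw [e]
  simp [taylorRem, fderiv_iteratedDeriv_snd hf]

lemma iteratedDeriv_id_mul {f : ℝ → ℝ} (hf : ContDiff ℝ ∞ f) (k : ℕ) (p : ℝ) :
    iteratedDeriv (k + 1) (fun p => p * f p) p =
      p * iteratedDeriv (k + 1) f p + (k + 1) * iteratedDeriv k f p := by
  have hd : ∀ k x, HasDerivAt (iteratedDeriv k f) (iteratedDeriv (k + 1) f x) x := fun k x => by
    rw [iteratedDeriv_succ]
    exact ((hf.differentiable_iteratedDeriv k (WithTop.coe_lt_coe.2 (ENat.natCast_lt_top _))) x).hasDerivAt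
  induction k generalizing p with
  | zero =>
    rw [zero_add, iteratedDeriv_one]
    have h1 : HasDerivAt f (iteratedDeriv 1 f p) p := by simpa using hd 0 p
    have := ((hasDerivAt_id p).mul h1).deriv
    simp only [id] at this
    rw [show (fun p => p * f p) = (fun p => p) * f from rfl]
    rw [show ((fun p : ℝ => p) * f) = id * f from rfl, this]
    simp
    ring
  | succ k ih =>
    rw [iteratedDeriv_succ, show iteratedDeriv (k + 1) (fun p => p * f p) = _ from funext ih]
    have := (((hasDerivAt_id p).mul (hd (k + 1) p)).add ((hd k p).const_mul ((k : ℝ) + 1))).deriv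
    simp only [id] at this
    refine Eq.trans ?_ (this.trans ?_)
    · rfl
    · push_cast; ring

end Calculus

end SST

namespace SST

/-! ### The tilted generator and its Perron vectors -/

/-- The values of the energies and of the nonequilibrium function, as a point of a normed space. -/
abbrev Coord (S : Type*) := (S → ℝ) × (S → S → ℝ)

namespace ModelClass

open scoped ContDiff

variable {S : Type*} (M : ModelClass S)

/-- The energy-dependent factor of the equilibrium rate between states of energies `h` and `h'`. -/
noncomputable def ruleFactor (h h' : ℝ) : ℝ :=
  match M.rule with
  | .exponential => Real.exp (M.β * h)
  | .symmetric => Real.exp (M.β / 2 * (h - h'))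

/-- The symmetric part of `ruleFactor`. -/
noncomputable def symFactor (h h' : ℝ) : ℝ :=
  match M.rule with
  | .exponential => Real.exp (M.β / 2 * (h + h'))
  | .symmetric => 1

lemma ruleFactor_eq (h h' : ℝ) :
    M.ruleFactor h h' = M.symFactor h h' * Real.exp (M.β / 2 * (h - h')) := by
  unfold ruleFactor symFactor
  cases M.rule
  · simp only; rw [← Real.exp_add]; ring_nf
  · simp only [one_mul]

lemma symFactor_comm (h h' : ℝ) : M.symFactor h h' = M.symFactor h' h := by
  unfold symFactor
  cases M.rule
  · simp only [add_comm]
  · rfl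

lemma symFactor_pos (h h' : ℝ) : 0 < M.symFactor h h' := by
  unfold symFactor
  cases M.rule
  · exact Real.exp_pos _
  · exact one_pos

lemma ruleFactor_pos (h h' : ℝ) : 0 < M.ruleFactor h h' := by
  rw [ruleFactor_eq]; exact mul_pos (M.symFactor_pos _ _) (Real.exp_pos _)

lemma contDiff_symFactor : ContDiff ℝ ∞ (fun h : ℝ × ℝ => M.symFactor h.1 h.2) := by
  unfold symFactor
  cases M.rule <;> simp only <;> fun_prop

lemma contDiff_ruleFactor : ContDiff ℝ ∞ (fun h : ℝ × ℝ => M.ruleFactor h.1 h.2) := by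
  unfold ruleFactor
  cases M.rule <;> simp only <;> fun_prop

variable [Fintype S] [DecidableEq S]

/-- The escape rate from `x` as a function of the coordinates. -/
noncomputable def escape (ε : ℝ) (z : Coord S) (x : S) : ℝ :=
  ∑ y ∈ Finset.univ.erase x, M.c x y * M.ruleFactor (z.1 x) (z.1 y) * Real.exp (ε * z.2 x y)

/-- The generator tilted by the nonequilibrium part of the entropy production, conjugated by
`exp (β H / 2)`. The tilt `v` is centred so that `v ↦ -v` is transposition. -/
noncomputable def hat (ε : ℝ) (z : Coord S) (v : ℝ) : Matrix S S ℝ :=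
  Matrix.of fun y x => if x = y then -M.escape ε z x else
    M.c x y * M.symFactor (z.1 x) (z.1 y) *
      Real.exp (ε * (z.2 x y + z.2 y x) / 2 + v * (z.2 x y - z.2 y x))

lemma hat_neg (ε : ℝ) (z : Coord S) (v : ℝ) : M.hat ε z (-v) = (M.hat ε z v)ᵀ := by
  ext y x
  by_cases h : x = y
  · subst h; simp [hat]
  · simp only [hat, Matrix.of_apply, Matrix.transpose_apply, h, Ne.symm h, if_false]
    rw [M.c_symm x y h, M.symFactor_comm]
    congr 2
    ring

lemma hat_isMetzler (ε : ℝ) (z : Coord S) (v : ℝ) : IsMetzler (M.hat ε z v) := by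
  have hpos : ∀ x y, x ≠ y → 0 ≤ M.hat ε z v y x := by
    intro x y h
    simp only [hat, Matrix.of_apply, h, if_false]
    exact mul_nonneg (mul_nonneg (M.c_nonneg x y h) (M.symFactor_pos _ _).le) (Real.exp_pos _).le
  refine ⟨fun y x h => hpos x y h.symm, fun x y =>
    Relation.ReflTransGen.mono (fun a b h => ⟨h.1, ?_⟩) _ _ (M.c_connected x y)⟩
  refine lt_of_le_of_ne (hpos a b h.1) (Ne.symm ?_)
  simp only [hat, Matrix.of_apply, h.1, if_false]
  exact mul_ne_zero (mul_ne_zero h.2 (M.symFactor_pos _ _).ne') (Real.exp_pos _).ne'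

lemma contDiff_hat (y x : S) :
    ContDiff ℝ ∞ (fun q : (ℝ × Coord S) × ℝ => M.hat q.1.1 q.1.2 q.2 y x) := by
  by_cases h : x = y
  · simp only [hat, Matrix.of_apply, h, if_true, escape]
    refine (ContDiff.sum fun w _ => ((contDiff_const.mul ?_).mul ?_)).neg
    · exact M.contDiff_ruleFactor.comp
        (f := fun q : (ℝ × Coord S) × ℝ => (q.1.2.1 y, q.1.2.1 w)) (by fun_prop)
    · fun_prop
  · simp only [hat, Matrix.of_apply, h, if_false]
    refine (contDiff_const.mul ?_).mul ?_
    · exact M.contDiff_symFactor.comp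
        (f := fun q : (ℝ × Coord S) × ℝ => (q.1.2.1 x, q.1.2.1 y)) (by fun_prop)
    · fun_prop

variable [Nonempty S]

/-- The Perron eigenvalue of `hat`. -/
noncomputable def mu (ε : ℝ) (z : Coord S) (v : ℝ) : ℝ :=
  (M.hat_isMetzler ε z v).exists_isPerron.choose

lemma exists_isPerron_mu (ε : ℝ) (z : Coord S) (v : ℝ) :
    ∃ l r, IsPerron (M.hat ε z v) (M.mu ε z v) l r :=
  (M.hat_isMetzler ε z v).exists_isPerron.choose_spec

/-- The left Perron vector of `hat`, normalized to total mass one. -/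
noncomputable def chi (ε : ℝ) (z : Coord S) (v : ℝ) : S → ℝ :=
  (∑ x, (M.exists_isPerron_mu ε z v).choose x)⁻¹ • (M.exists_isPerron_mu ε z v).choose

omit [DecidableEq S] in
lemma sum_pos_of_pos {w : S → ℝ} (hw : ∀ x, 0 < w x) : 0 < ∑ x, w x :=
  Finset.sum_pos (fun x _ => hw x) Finset.univ_nonempty

lemma chi_pos (ε : ℝ) (z : Coord S) (v : ℝ) (x : S) : 0 < M.chi ε z v x := by
  obtain ⟨r, h⟩ := (M.exists_isPerron_mu ε z v).choose_spec
  exact mul_pos (inv_pos.2 (sum_pos_of_pos h.left_pos)) (h.left_pos x)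

lemma chi_sum (ε : ℝ) (z : Coord S) (v : ℝ) : ∑ x, M.chi ε z v x = 1 := by
  obtain ⟨r, h⟩ := (M.exists_isPerron_mu ε z v).choose_spec
  have := sum_pos_of_pos h.left_pos
  simp only [chi, Pi.smul_apply, smul_eq_mul, ← Finset.mul_sum]
  exact inv_mul_cancel₀ this.ne'

lemma chi_eq (ε : ℝ) (z : Coord S) (v : ℝ) :
    M.chi ε z v ᵥ* M.hat ε z v = M.mu ε z v • M.chi ε z v := by
  obtain ⟨r, h⟩ := (M.exists_isPerron_mu ε z v).choose_spec
  rw [chi, Matrix.smul_vecMul, h.left_eq, smul_comm]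

lemma eq_chi_of_pos {ε : ℝ} {z : Coord S} {v μ : ℝ} {l : S → ℝ} (hl : ∀ x, 0 < l x)
    (he : l ᵥ* M.hat ε z v = μ • l) : M.chi ε z v = (∑ x, l x)⁻¹ • l := by
  obtain ⟨l₀, r, h⟩ := M.exists_isPerron_mu ε z v
  have h1 := (h.eq_smul_of_pos hl he).2
  have h2 := (h.eq_smul_of_pos (M.chi_pos ε z v) (M.chi_eq ε z v)).2
  have h3 := M.chi_sum ε z v
  set a := l ⬝ᵥ r
  set b := M.chi ε z v ⬝ᵥ r
  have hs := sum_pos_of_pos hl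
  have hl0 := sum_pos_of_pos h.left_pos
  have h4 : ∑ x, l x = a * ∑ x, l₀ x := by
    conv_lhs => rw [h1]
    simp [Finset.mul_sum]
  have h5 : b * ∑ x, l₀ x = 1 := by
    rw [h2] at h3
    simpa [Finset.mul_sum] using h3
  rw [h4] at hs ⊢
  have ha : a ≠ 0 := by rintro h; simp [h] at hs
  rw [h2]
  conv_rhs => rw [h1]
  rw [smul_smul]
  congr 1
  field_simp
  linarith

lemma contDiff_chi : ContDiff ℝ ∞ (fun q : (ℝ × Coord S) × ℝ => M.chi q.1.1 q.1.2 q.2) := by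
  rw [contDiff_iff_contDiffAt]
  intro q₀
  obtain ⟨l, r, h⟩ := M.exists_isPerron_mu q₀.1.1 q₀.1.2 q₀.2
  obtain ⟨μ, w, -, hw, -, hw0, hev⟩ := exists_smooth_eigenvector (n := ∞) (by simp)
    (K := fun q : (ℝ × Coord S) × ℝ => (M.hat q.1.1 q.1.2 q.2)ᵀ) (x₀ := q₀)
    (fun y x => (M.contDiff_hat x y).contDiffAt) h.toIsDominant.transpose.right_eq
    h.toIsDominant.transpose.left_eq h.toIsDominant.transpose.dot
    (fun w h1 h2 => h.toIsDominant.transpose.simple h1 h2)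
  have hpos : ∀ᶠ q in 𝓝 q₀, ∀ x, 0 < w q x := by
    rw [eventually_all]
    intro x
    exact (continuousAt_pi.1 hw.continuousAt x).eventually (lt_mem_nhds (by
      show 0 < w q₀ x; rw [hw0]; exact h.left_pos x))
  have hwx : ∀ x, ContDiffAt ℝ ∞ (fun q => w q x) q₀ := fun x => contDiffAt_pi.1 hw x
  have hsum : ∑ x, w q₀ x ≠ 0 := by rw [hw0]; exact (sum_pos_of_pos h.left_pos).ne'
  refine ContDiffAt.congr_of_eventuallyEq
    (((ContDiffAt.sum fun x _ => hwx x).inv hsum).smul hw) ?_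
  filter_upwards [hpos, hev] with q h1 h2
  refine M.eq_chi_of_pos h1 (μ := μ q) ?_
  rw [← Matrix.mulVec_transpose, h2.1]

/-- The left Perron vector of `hat`, normalized so that `phi v` and `phi (-v)`, which is the right
Perron vector, have scalar product one. -/
noncomputable def phi (ε : ℝ) (z : Coord S) (v : ℝ) (x : S) : ℝ :=
  M.chi ε z v x / √(M.chi ε z v ⬝ᵥ M.chi ε z (-v))

lemma chi_dot_pos (ε : ℝ) (z : Coord S) (v v' : ℝ) : 0 < M.chi ε z v ⬝ᵥ M.chi ε z v' :=
  sum_pos_of_pos fun x => mul_pos (M.chi_pos ε z v x) (M.chi_pos ε z v' x)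

lemma phi_pos (ε : ℝ) (z : Coord S) (v : ℝ) (x : S) : 0 < M.phi ε z v x :=
  div_pos (M.chi_pos ε z v x) (Real.sqrt_pos.2 (M.chi_dot_pos ε z v (-v)))

lemma phi_dot (ε : ℝ) (z : Coord S) (v : ℝ) : ∑ x, M.phi ε z v x * M.phi ε z (-v) x = 1 := by
  have h := M.chi_dot_pos ε z v (-v)
  have h2 : M.chi ε z (-v) ⬝ᵥ M.chi ε z v = M.chi ε z v ⬝ᵥ M.chi ε z (-v) := dotProduct_comm _ _
  simp only [phi, neg_neg, h2, div_mul_div_comm, Real.mul_self_sqrt h.le, ← Finset.sum_div]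
  exact div_self h.ne'

lemma contDiff_phi (x : S) :
    ContDiff ℝ ∞ (fun q : (ℝ × Coord S) × ℝ => M.phi q.1.1 q.1.2 q.2 x) := by
  have h1 : ∀ x, ContDiff ℝ ∞ (fun q : (ℝ × Coord S) × ℝ => M.chi q.1.1 q.1.2 q.2 x) := fun x =>
    contDiff_pi.1 M.contDiff_chi x
  have h2 : ∀ x, ContDiff ℝ ∞ (fun q : (ℝ × Coord S) × ℝ => M.chi q.1.1 q.1.2 (-q.2) x) := fun x =>
    (h1 x).comp (f := fun q : (ℝ × Coord S) × ℝ => (q.1, -q.2)) (by fun_prop)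
  refine (h1 x).div (ContDiff.sqrt (ContDiff.sum fun x _ => (h1 x).mul (h2 x)) fun q => ?_) fun q => ?_
  · exact (M.chi_dot_pos _ _ _ _).ne'
  · exact (Real.sqrt_pos.2 (M.chi_dot_pos _ _ _ _)).ne'

theorem isPerron_phi (ε : ℝ) (z : Coord S) (v : ℝ) :
    IsPerron (M.hat ε z v) (M.mu ε z v) (M.phi ε z v) (M.phi ε z (-v)) := by
  obtain ⟨l, r, h⟩ := M.exists_isPerron_mu ε z v
  have hφ : ∀ v, M.phi ε z v = (√(M.chi ε z v ⬝ᵥ M.chi ε z (-v)))⁻¹ • M.chi ε z v := by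
    intro v; ext x; simp [phi, div_eq_inv_mul]
  have hleft : ∀ v, M.phi ε z v ᵥ* M.hat ε z v = M.mu ε z v • M.phi ε z v := by
    intro v
    rw [hφ, Matrix.smul_vecMul, M.chi_eq, smul_comm]
  obtain ⟨-, e1⟩ := h.eq_smul_of_pos (M.phi_pos ε z v) (hleft v)
  have hT : IsPerron (M.hat ε z (-v)) (M.mu ε z v) r l := by
    rw [hat_neg]
    exact ⟨h.toIsDominant.transpose, h.right_pos, h.left_pos⟩
  obtain ⟨hμ, e2⟩ := hT.eq_smul_of_pos (M.phi_pos ε z (-v)) (hleft (-v))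
  set a := M.phi ε z v ⬝ᵥ r
  set b := M.phi ε z (-v) ⬝ᵥ l
  have hab : a * b = 1 := by
    have := M.phi_dot ε z v
    rw [e1, e2] at this
    have h2 : ∑ x, (a • l) x * (b • r) x = a * b * (l ⬝ᵥ r) := by
      simp only [dotProduct, Finset.mul_sum, Pi.smul_apply, smul_eq_mul]
      exact Finset.sum_congr rfl fun x _ => by ring
    rw [h2, h.dot, mul_one] at this
    exact this
  refine ⟨⟨hleft v, ?_, M.phi_dot ε z v, ?_⟩, M.phi_pos ε z v, M.phi_pos ε z (-v)⟩
  · rw [e2, Matrix.mulVec_smul, h.right_eq, smul_comm]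
  · have : Matrix.vecMulVec (M.phi ε z (-v)) (M.phi ε z v) = Matrix.vecMulVec r l := by
      rw [e1, e2, Matrix.smul_vecMulVec, Matrix.vecMulVec_smul, smul_smul, mul_comm b, hab, one_smul]
    rw [this]
    exact h.tendsto

end ModelClass

end SST

namespace SST

namespace ModelClass

open scoped ContDiff

variable {S : Type*} (M : ModelClass S) [Fintype S] [DecidableEq S] [Nonempty S]

/-! ### Overlaps of Perron vectors -/

/-- The overlap of the Perron vectors at consecutive parameters, weighted by the work done in the
step from `z` to `w`. -/
noncomputable def overlap (ε : ℝ) (z w : Coord S) (p : ℝ) : ℝ :=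
  ∑ x, M.phi ε w (ε * p) x * Real.exp (p * M.β * (w.1 x - z.1 x)) * M.phi ε z (-(ε * p)) x

/-- The contribution of the step from `z` to `w` to the difference between the cumulant generating
functions of the protocol and of its reversal. -/
noncomputable def stepFun (ε : ℝ) (z w : Coord S) (p : ℝ) : ℝ :=
  Real.log (M.overlap ε z w p) - Real.log (M.overlap ε z w (-p))

/-- The contribution of the initial and final steady states at `z`, up to a term that does not
depend on `p`. -/
noncomputable def bdry (ε : ℝ) (z : Coord S) (p : ℝ) : ℝ :=
  Real.log (∑ x, M.phi ε z (ε * p) x * M.phi ε z (-(ε / 2)) x) -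
    Real.log (∑ x, M.phi ε z (-(ε * p)) x * M.phi ε z (ε / 2) x)

lemma overlap_pos (ε : ℝ) (z w : Coord S) (p : ℝ) : 0 < M.overlap ε z w p :=
  sum_pos_of_pos fun _ => mul_pos (mul_pos (M.phi_pos _ _ _ _) (Real.exp_pos _)) (M.phi_pos _ _ _ _)

lemma overlap_self (ε : ℝ) (z : Coord S) (p : ℝ) : M.overlap ε z z p = 1 := by
  simp [overlap, M.phi_dot]

lemma overlap_neg (ε : ℝ) (z w : Coord S) (p : ℝ) : M.overlap ε z w (-p) = M.overlap ε w z p := by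
  unfold overlap
  refine Finset.sum_congr rfl fun x _ => ?_
  have : -p * M.β * (w.1 x - z.1 x) = p * M.β * (z.1 x - w.1 x) := by ring
  rw [this, mul_neg, neg_neg]
  ring

lemma stepFun_self (ε : ℝ) (z : Coord S) (p : ℝ) : M.stepFun ε z z p = 0 := by
  simp [stepFun, overlap_self]

lemma stepFun_zero (ε : ℝ) (z w : Coord S) : M.stepFun ε z w 0 = 0 := by
  simp [stepFun]

lemma contDiff_stepFun (ε : ℝ) :
    ContDiff ℝ ∞ (fun q : (Coord S × Coord S) × ℝ => M.stepFun ε q.1.1 q.1.2 q.2) := by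
  have h : ContDiff ℝ ∞ (fun q : (Coord S × Coord S) × ℝ => M.overlap ε q.1.1 q.1.2 q.2) := by
    refine ContDiff.sum fun x _ => ((?_ : ContDiff ℝ ∞ _).mul (by fun_prop)).mul ?_
    · exact (M.contDiff_phi x).comp
        (f := fun q : (Coord S × Coord S) × ℝ => ((ε, q.1.2), ε * q.2)) (by fun_prop)
    · exact (M.contDiff_phi x).comp
        (f := fun q : (Coord S × Coord S) × ℝ => ((ε, q.1.1), -(ε * q.2))) (by fun_prop)
  refine (h.log fun q => (M.overlap_pos _ _ _ _).ne').sub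
    ((h.comp (f := fun q : (Coord S × Coord S) × ℝ => (q.1, -q.2)) (by fun_prop)).log
      fun q => (M.overlap_pos _ _ _ _).ne')

lemma contDiff_stepFun_right (ε : ℝ) (z w : Coord S) : ContDiff ℝ ∞ (M.stepFun ε z w) :=
  (M.contDiff_stepFun ε).comp (f := fun p : ℝ => ((z, w), p)) (by fun_prop)

/-! ### The boundary terms -/

/-- `bdry` with the two combinations `ε p` and `ε / 2` as independent variables. -/
noncomputable def bdryAux (ε : ℝ) (z : Coord S) (s v : ℝ) : ℝ :=
  Real.log (∑ x, M.phi ε z v x * M.phi ε z (-s) x) -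
    Real.log (∑ x, M.phi ε z (-v) x * M.phi ε z s x)

lemma contDiff_bdryAux : ContDiff ℝ ∞
    (fun q : ((ℝ × Coord S) × ℝ) × ℝ => M.bdryAux q.1.1.1 q.1.1.2 q.1.2 q.2) := by
  have h : ContDiff ℝ ∞ (fun q : ((ℝ × Coord S) × ℝ) × ℝ =>
      ∑ x, M.phi q.1.1.1 q.1.1.2 q.2 x * M.phi q.1.1.1 q.1.1.2 (-q.1.2) x) := by
    refine ContDiff.sum fun x _ => ContDiff.mul ?_ ?_
    · exact (M.contDiff_phi x).comp
        (f := fun q : ((ℝ × Coord S) × ℝ) × ℝ => (q.1.1, q.2)) (by fun_prop)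
    · exact (M.contDiff_phi x).comp
        (f := fun q : ((ℝ × Coord S) × ℝ) × ℝ => (q.1.1, -q.1.2)) (by fun_prop)
  have hne : ∀ ε z v s, ∑ x, M.phi ε z v x * M.phi ε z s x ≠ 0 := fun ε z v s =>
    (sum_pos_of_pos fun x => mul_pos (M.phi_pos _ _ _ _) (M.phi_pos _ _ _ _)).ne'
  refine (h.log fun q => hne _ _ _ _).sub (ContDiff.log ?_ fun q => hne _ _ _ _)
  have := h.comp (f := fun q : ((ℝ × Coord S) × ℝ) × ℝ => ((q.1.1, -q.1.2), -q.2)) (by fun_prop)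
  simpa [Function.comp_def] using this

lemma bdryAux_neg (ε : ℝ) (z : Coord S) (s v : ℝ) :
    M.bdryAux ε z (-s) (-v) = -M.bdryAux ε z s v := by
  simp [bdryAux]

lemma contDiff_bdryAux_right (ε : ℝ) (z : Coord S) (s : ℝ) : ContDiff ℝ ∞ (M.bdryAux ε z s) :=
  M.contDiff_bdryAux.comp (f := fun v : ℝ => (((ε, z), s), v)) (by fun_prop)

lemma contDiff_bdry (ε : ℝ) (z : Coord S) : ContDiff ℝ ∞ (M.bdry ε z) :=
  (M.contDiff_bdryAux_right ε z (ε / 2)).comp (f := fun p : ℝ => ε * p) (by fun_prop)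

/-- The boundary terms at `z` and `w` differ, in the Taylor remainder, by `O(ε ^ (2n+1) ‖z - w‖)`:
one power of `ε` is gained because `bdryAux` is odd in its last two arguments. -/
lemma exists_bdry_bound {n : ℕ} (hn : 1 ≤ n) (E₀ R : ℝ) :
    ∃ C : ℝ, 0 ≤ C ∧ ∀ ε ∈ Set.Icc 0 E₀, ∀ z ∈ Metric.closedBall (0 : Coord S) R,
      ∀ w ∈ Metric.closedBall (0 : Coord S) R,
      |taylorRem n (fun p => M.bdry ε w p - M.bdry ε z p)| ≤ C * ε ^ (2 * n) * (ε * ‖w - z‖) := by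
  set B : ((ℝ × Coord S) × ℝ) × ℝ → ℝ := fun q =>
    iteratedDeriv (2 * n) (fun v => M.bdryAux q.1.1.1 q.1.1.2 q.1.2 v) q.2 with hB
  have hBc : ContDiff ℝ ∞ B := contDiff_iteratedDeriv_snd M.contDiff_bdryAux (2 * n)
  set f : ((ℝ × ℝ) × Coord S) × ℝ → ℝ := fun q =>
    B (((q.1.1.1, q.1.2), q.2 / 2), q.2 * q.1.1.2) with hf
  have hfc : ContDiff ℝ ∞ f := hBc.comp (f := fun q : ((ℝ × ℝ) × Coord S) × ℝ =>
    (((q.1.1.1, q.1.2), q.2 / 2), q.2 * q.1.1.2)) (by fun_prop)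
  -- at `ε = 0` the even derivative of an odd function is evaluated at zero
  have hf0 : ∀ a z, f ((a, z), 0) = 0 := by
    intro a z
    have hodd : ∀ v, M.bdryAux a.1 z 0 (-v) = -M.bdryAux a.1 z 0 v := fun v => by
      simpa using M.bdryAux_neg a.1 z 0 v
    have h1 := iteratedDeriv_comp_neg (2 * n) (M.bdryAux a.1 z 0) 0
    rw [show (fun v => M.bdryAux a.1 z 0 (-v)) = fun v => -M.bdryAux a.1 z 0 v from funext hodd,
      iteratedDeriv_fun_neg] at h1
    simp only [neg_zero, even_two, Even.mul_right, Even.neg_pow, one_pow, one_smul] at h1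
    simp only [hf, hB, zero_div, zero_mul]
    have h2 : iteratedDeriv (2 * n) (fun v => M.bdryAux a.1 z 0 v) 0 =
      iteratedDeriv (2 * n) (M.bdryAux a.1 z 0) 0 := rfl
    linarith
  obtain ⟨C, hC0, hC⟩ := exists_lipschitz_of_zero
    (hfc.of_le (WithTop.coe_le_coe.2 (le_top : (2 : ℕ∞) ≤ ⊤))) hf0
    ((isCompact_Icc (a := (0 : ℝ)) (b := E₀)).prod (isCompact_Icc (a := (0 : ℝ)) (b := 1 / 2)))
    (isCompact_closedBall (0 : Coord S) R) (convex_closedBall _ _) E₀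
  refine ⟨C, hC0, fun ε hε z hz w hw => ?_⟩
  have hsmooth : ContDiff ℝ ∞ (fun p => M.bdry ε w p - M.bdry ε z p) :=
    (M.contDiff_bdry ε w).sub (M.contDiff_bdry ε z)
  refine abs_taylorRem_le hn hsmooth fun p hp => ?_
  have hd : ∀ z, iteratedDeriv (2 * n) (M.bdry ε z) p = ε ^ (2 * n) * f (((ε, p), z), ε) := by
    intro z
    have := iteratedDeriv_comp_const_mul
      ((M.contDiff_bdryAux_right ε z (ε / 2)).of_le
        (WithTop.coe_le_coe.2 (le_top : ((2 * n : ℕ) : ℕ∞) ≤ ⊤))) ε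
    exact congrFun this p
  have hsub : iteratedDeriv (2 * n) (fun p => M.bdry ε w p - M.bdry ε z p) p =
      iteratedDeriv (2 * n) (M.bdry ε w) p - iteratedDeriv (2 * n) (M.bdry ε z) p :=
    iteratedDeriv_fun_sub
      ((M.contDiff_bdry ε w).contDiffAt.of_le
        (WithTop.coe_le_coe.2 (le_top : ((2 * n : ℕ) : ℕ∞) ≤ ⊤)))
      ((M.contDiff_bdry ε z).contDiffAt.of_le
        (WithTop.coe_le_coe.2 (le_top : ((2 * n : ℕ) : ℕ∞) ≤ ⊤)))
  rw [hsub, hd, hd, ← mul_sub, abs_mul, abs_of_nonneg (pow_nonneg hε.1 _)]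
  calc _ ≤ ε ^ (2 * n) * (C * ε * ‖w - z‖) :=
        mul_le_mul_of_nonneg_left (hC (ε, p) ⟨hε, hp⟩ z hz w hw ε hε) (pow_nonneg hε.1 _)
    _ = _ := by ring

/-! ### The contribution of one step -/

/-- The derivative of the left Perron vector in the direction `δ`, paired with the right Perron
vector. -/
noncomputable def berry (ε : ℝ) (z δ : Coord S) (v : ℝ) : ℝ :=
  ∑ x, fderiv ℝ (fun q : (ℝ × Coord S) × ℝ => M.phi q.1.1 q.1.2 q.2 x) ((ε, z), v) ((0, δ), 0) *
    M.phi ε z (-v) x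

lemma contDiff_berry : ContDiff ℝ ∞
    (fun q : ((ℝ × Coord S) × Coord S) × ℝ => M.berry q.1.1.1 q.1.1.2 q.1.2 q.2) := by
  refine ContDiff.sum fun x _ => ContDiff.mul ?_ ?_
  · have h1 : ContDiff ℝ ∞ (fun q : ((ℝ × Coord S) × Coord S) × ℝ =>
        fderiv ℝ (fun q : (ℝ × Coord S) × ℝ => M.phi q.1.1 q.1.2 q.2 x) (q.1.1, q.2)) :=
      ((M.contDiff_phi x).fderiv_right (m := ∞) le_rfl).comp
        (f := fun q : ((ℝ × Coord S) × Coord S) × ℝ => (q.1.1, q.2)) (by fun_prop)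
    exact h1.clm_apply (by fun_prop)
  · exact (M.contDiff_phi x).comp
      (f := fun q : ((ℝ × Coord S) × Coord S) × ℝ => (q.1.1, -q.2)) (by fun_prop)

/-- The odd part of `berry`. -/
noncomputable def berryOdd (ε : ℝ) (z δ : Coord S) (v : ℝ) : ℝ :=
  M.berry ε z δ v - M.berry ε z δ (-v)

lemma contDiff_berryOdd : ContDiff ℝ ∞
    (fun q : ((ℝ × Coord S) × Coord S) × ℝ => M.berryOdd q.1.1.1 q.1.1.2 q.1.2 q.2) :=
  M.contDiff_berry.sub (M.contDiff_berry.comp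
    (f := fun q : ((ℝ × Coord S) × Coord S) × ℝ => (q.1, -q.2)) (by fun_prop))

lemma contDiff_berryOdd_right (ε : ℝ) (z δ : Coord S) : ContDiff ℝ ∞ (M.berryOdd ε z δ) :=
  M.contDiff_berryOdd.comp (f := fun v : ℝ => (((ε, z), δ), v)) (by fun_prop)

/-- The probability weight of the state `x` in the tilted steady state. -/
noncomputable def tilted (ε : ℝ) (z : Coord S) (x : S) (v : ℝ) : ℝ :=
  M.phi ε z v x * M.phi ε z (-v) x

lemma contDiff_tilted (x : S) : ContDiff ℝ ∞
    (fun q : (ℝ × Coord S) × ℝ => M.tilted q.1.1 q.1.2 x q.2) :=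
  (M.contDiff_phi x).mul ((M.contDiff_phi x).comp
    (f := fun q : (ℝ × Coord S) × ℝ => (q.1, -q.2)) (by fun_prop))

lemma contDiff_tilted_right (ε : ℝ) (z : Coord S) (x : S) : ContDiff ℝ ∞ (M.tilted ε z x) :=
  (M.contDiff_tilted x).comp (f := fun v : ℝ => ((ε, z), v)) (by fun_prop)

lemma tilted_neg (ε : ℝ) (z : Coord S) (x : S) (v : ℝ) : M.tilted ε z x (-v) = M.tilted ε z x v := by
  rw [tilted, tilted, neg_neg, mul_comm]

/-- The first-order variation of `stepFun` on the diagonal. -/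
lemma fderiv_stepFun (ε : ℝ) (z δ : Coord S) (p : ℝ) :
    fderiv ℝ (fun q : (Coord S × Coord S) × ℝ => M.stepFun ε q.1.1 q.1.2 q.2) ((z, z), p)
      ((0, δ), 0) =
    M.berryOdd ε z δ (ε * p) + ∑ x, 2 * M.β * δ.1 x * (p * M.tilted ε z x (ε * p)) := by
  have hline : HasDerivAt (fun t : ℝ => (((z, z + t • δ), p) : (Coord S × Coord S) × ℝ))
      ((0, δ), 0) 0 := by
    refine ((hasDerivAt_const _ _).prodMk ?_).prodMk (hasDerivAt_const _ _)
    simpa using ((hasDerivAt_id (0 : ℝ)).smul_const δ).const_add z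
  have h1 : HasDerivAt (fun t : ℝ => M.stepFun ε z (z + t • δ) p) (fderiv ℝ
      (fun q : (Coord S × Coord S) × ℝ => M.stepFun ε q.1.1 q.1.2 q.2) ((z, z), p) ((0, δ), 0)) 0 :=
    HasFDerivAt.comp_hasDerivAt (x := (0 : ℝ))
      (l := fun q : (Coord S × Coord S) × ℝ => M.stepFun ε q.1.1 q.1.2 q.2)
      (f := fun t : ℝ => (((z, z + t • δ), p) : (Coord S × Coord S) × ℝ))
      (by simpa using ((M.contDiff_stepFun ε).differentiable (by simp) ((z, z), p)).hasFDerivAt) hline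
  have hX : ∀ p : ℝ, HasDerivAt (fun t : ℝ => M.overlap ε z (z + t • δ) p)
      (M.berry ε z δ (ε * p) + ∑ x, M.β * δ.1 x * (p * M.tilted ε z x (ε * p))) 0 := by
    intro p
    have hφ : ∀ x, HasDerivAt (fun t : ℝ => M.phi ε (z + t • δ) (ε * p) x)
        (fderiv ℝ (fun q : (ℝ × Coord S) × ℝ => M.phi q.1.1 q.1.2 q.2 x) ((ε, z), ε * p)
          ((0, δ), 0)) 0 := by
      intro x
      have hl : HasDerivAt (fun t : ℝ => (((ε, z + t • δ), ε * p) : (ℝ × Coord S) × ℝ))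
          ((0, δ), 0) 0 := by
        refine ((hasDerivAt_const _ _).prodMk ?_).prodMk (hasDerivAt_const _ _)
        simpa using ((hasDerivAt_id (0 : ℝ)).smul_const δ).const_add z
      exact HasFDerivAt.comp_hasDerivAt (x := (0 : ℝ))
        (l := fun q : (ℝ × Coord S) × ℝ => M.phi q.1.1 q.1.2 q.2 x)
        (f := fun t : ℝ => (((ε, z + t • δ), ε * p) : (ℝ × Coord S) × ℝ))
        (by simpa using ((M.contDiff_phi x).differentiable (by simp) ((ε, z), ε * p)).hasFDerivAt) hl
    have he : ∀ x, HasDerivAt (fun t : ℝ => Real.exp (p * M.β * ((z + t • δ).1 x - z.1 x)))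
        (p * M.β * δ.1 x) 0 := by
      intro x
      have : HasDerivAt (fun t : ℝ => p * M.β * ((z + t • δ).1 x - z.1 x)) (p * M.β * δ.1 x) 0 := by
        have e : (fun t : ℝ => p * M.β * ((z + t • δ).1 x - z.1 x)) =
            fun t => t * (p * M.β * δ.1 x) := by
          ext t; simp; ring
        rw [e]
        simpa using (hasDerivAt_id (0 : ℝ)).mul_const (p * M.β * δ.1 x)
      simpa using this.exp
    have := HasDerivAt.fun_sum (u := Finset.univ) fun x _ =>
      ((hφ x).mul (he x)).mul_const (M.phi ε z (-(ε * p)) x)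
    refine this.congr_deriv ?_
    simp only [berry, tilted, ← Finset.sum_add_distrib]
    refine Finset.sum_congr rfl fun x _ => ?_
    simp
    ring
  have h2 : HasDerivAt (fun t : ℝ => M.stepFun ε z (z + t • δ) p)
      (M.berryOdd ε z δ (ε * p) + ∑ x, 2 * M.β * δ.1 x * (p * M.tilted ε z x (ε * p))) 0 := by
    have hp := (hX p).log (by simp [overlap_self])
    have hm := (hX (-p)).log (by simp [overlap_self])
    refine (hp.sub hm).congr_deriv ?_
    simp only [zero_smul, add_zero, overlap_self, div_one, mul_neg, tilted_neg, berryOdd,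
      ← sub_add_eq_add_sub]
    rw [show ∑ x, 2 * M.β * δ.1 x * (p * M.tilted ε z x (ε * p)) =
      ∑ x, M.β * δ.1 x * (p * M.tilted ε z x (ε * p)) -
        ∑ x, M.β * δ.1 x * (-p * M.tilted ε z x (ε * p)) by
      rw [← Finset.sum_sub_distrib]; exact Finset.sum_congr rfl fun x _ => by ring]
    simp only [neg_mul, mul_neg]
    ring
  exact h1.unique h2

/-- The variation of the Taylor remainder: the oddness in `p` yields `ε ^ (2n+1)`, except for the
work term, which carries one factor `p` without `ε`. -/
lemma exists_variation_bound {n : ℕ} (hn : 1 ≤ n) (E₀ R : ℝ) :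
    ∃ C : ℝ, 0 ≤ C ∧ ∀ ε ∈ Set.Icc 0 E₀, ∀ z ∈ Metric.closedBall (0 : Coord S) R,
      ∀ δ ∈ Metric.closedBall (0 : Coord S) (2 * R),
      |taylorRem n (fun p => M.berryOdd ε z δ (ε * p) +
        ∑ x, 2 * M.β * δ.1 x * (p * M.tilted ε z x (ε * p)))|
        ≤ C * ε ^ (2 * n) * (‖δ.1‖ + ε * ‖δ.2‖) := by
  -- derivatives of the odd part
  set A : ((ℝ × Coord S) × ℝ) × Coord S → ℝ := fun q =>
    iteratedDeriv (2 * n + 1) (fun v => M.berryOdd q.1.1.1 q.1.1.2 q.2 v) q.1.2 with hA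
  have hAc : ContDiff ℝ ∞ A :=
    (contDiff_iteratedDeriv_snd M.contDiff_berryOdd (2 * n + 1)).comp
      (f := fun q : ((ℝ × Coord S) × ℝ) × Coord S => ((q.1.1, q.2), q.1.2)) (by fun_prop)
  obtain ⟨C₁, hC₁0, hC₁⟩ := exists_lipschitz_snd
    (hAc.of_le (WithTop.coe_le_coe.2 (le_top : (1 : ℕ∞) ≤ ⊤)))
    (((isCompact_Icc (a := (0 : ℝ)) (b := E₀)).prod (isCompact_closedBall (0 : Coord S) R)).prod
      (isCompact_Icc (a := (0 : ℝ)) (b := E₀)))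
    (isCompact_closedBall (0 : Coord S) (2 * R)) (convex_closedBall _ _)
  -- derivatives of the weights
  have hT : ∀ k : ℕ, ∃ C : ℝ, 0 ≤ C ∧ ∀ x, ∀ ε ∈ Set.Icc 0 E₀, ∀ z ∈ Metric.closedBall (0 : Coord S) R,
      ∀ v ∈ Set.Icc 0 E₀, |iteratedDeriv k (M.tilted ε z x) v| ≤ C := by
    intro k
    have hx : ∀ x, ∃ C : ℝ, ∀ q ∈ ((Set.Icc 0 E₀) ×ˢ Metric.closedBall (0 : Coord S) R) ×ˢ
        Set.Icc 0 E₀, ‖iteratedDeriv k (M.tilted q.1.1 q.1.2 x) q.2‖ ≤ C := fun x =>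
      ((isCompact_Icc.prod (isCompact_closedBall (0 : Coord S) R)).prod
        isCompact_Icc).exists_bound_of_continuousOn
        (contDiff_iteratedDeriv_snd (M.contDiff_tilted x) k).continuous.continuousOn
    choose C hC using hx
    refine ⟨∑ x, |C x|, Finset.sum_nonneg fun _ _ => abs_nonneg _, fun x ε hε z hz v hv => ?_⟩
    refine ((hC x ((ε, z), v) ⟨⟨hε, hz⟩, hv⟩).trans (le_abs_self _)).trans ?_
    exact Finset.single_le_sum (f := fun x => |C x|) (fun _ _ => abs_nonneg _) (Finset.mem_univ x)
  obtain ⟨C₂, hC₂0, hC₂⟩ := hT (2 * n + 1)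
  obtain ⟨C₃, hC₃0, hC₃⟩ := hT (2 * n)
  set D := |E₀| * C₂ + (2 * n + 1) * C₃ with hD
  have hD0 : 0 ≤ D := by positivity
  set N : ℝ := ((Fintype.card S : ℕ) : ℝ) with hN
  refine ⟨C₁ * (|E₀| + 1) + N * (2 * M.β * D), by have := M.β_pos; positivity,
    fun ε hε z hz δ hδ => ?_⟩
  have hεE : ε ≤ |E₀| := hε.2.trans (le_abs_self _)
  have hmem : ∀ p ∈ Set.Icc (0 : ℝ) (1 / 2), ε * p ∈ Set.Icc 0 E₀ := fun p hp =>
    ⟨mul_nonneg hε.1 hp.1, (mul_le_of_le_one_right hε.1 (by linarith [hp.2])).trans hε.2⟩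
  have hs1 : ContDiff ℝ ∞ (fun p => M.berryOdd ε z δ (ε * p)) :=
    (M.contDiff_berryOdd_right ε z δ).comp (by fun_prop)
  have hsx : ∀ x, ContDiff ℝ ∞ (fun p => M.tilted ε z x (ε * p)) := fun x =>
    (M.contDiff_tilted_right ε z x).comp (by fun_prop)
  have hs2 : ∀ x, ContDiff ℝ ∞ (fun p => p * M.tilted ε z x (ε * p)) := fun x =>
    contDiff_id.mul (hsx x)
  have hs3 : ∀ x, ContDiff ℝ ∞ (fun p => 2 * M.β * δ.1 x * (p * M.tilted ε z x (ε * p))) := fun x =>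
    contDiff_const.mul (hs2 x)
  rw [taylorRem_add hs1 (ContDiff.sum fun x _ => hs3 x), taylorRem_sum _ hs3]
  have hb1 : |taylorRem n (fun p => M.berryOdd ε z δ (ε * p))| ≤ ε ^ (2 * n + 1) * (C₁ * ‖δ‖) := by
    refine abs_taylorRem_le_of_odd hn hs1 (fun p => by simp [berryOdd]) fun p hp => ?_
    have h1 := congrFun (iteratedDeriv_comp_const_mul ((M.contDiff_berryOdd_right ε z δ).of_le
      (WithTop.coe_le_coe.2 (le_top : ((2 * n + 1 : ℕ) : ℕ∞) ≤ ⊤))) ε) p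
    rw [h1, abs_mul, abs_of_nonneg (pow_nonneg hε.1 _)]
    refine mul_le_mul_of_nonneg_left ?_ (pow_nonneg hε.1 _)
    have h0 : A (((ε, z), ε * p), 0) = 0 := by
      have : (fun v => M.berryOdd ε z 0 v) = fun _ => 0 := by
        have hb : ∀ v, M.berry ε z 0 v = 0 := fun v => Finset.sum_eq_zero fun x _ => by
          rw [show (((0 : ℝ), (0 : Coord S)), (0 : ℝ)) = 0 from rfl, map_zero, zero_mul]
        ext v; rw [berryOdd, hb, hb, sub_zero]
      simp only [hA, this, iteratedDeriv_const]
      simp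
    have h2 := hC₁ ((ε, z), ε * p) ⟨⟨hε, hz⟩, hmem p hp⟩ 0
      (by simp; exact (norm_nonneg _).trans (by simpa using hz)) δ hδ
    rw [h0, sub_zero, sub_zero, Real.norm_eq_abs] at h2
    exact h2
  have hb2 : ∀ x, |taylorRem n (fun p => p * M.tilted ε z x (ε * p))| ≤ ε ^ (2 * n) * D := by
    intro x
    refine abs_taylorRem_le_of_odd hn (hs2 x)
      (fun p => by rw [mul_neg, tilted_neg]; ring) fun p hp => ?_
    have h1 := fun k : ℕ => congrFun (iteratedDeriv_comp_const_mul
      ((M.contDiff_tilted_right ε z x).of_le (WithTop.coe_le_coe.2 (le_top : (k : ℕ∞) ≤ ⊤))) ε) p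
    rw [iteratedDeriv_id_mul (hsx x), h1, h1]
    have h2 := hC₂ x ε hε z hz (ε * p) (hmem p hp)
    have h3 := hC₃ x ε hε z hz (ε * p) (hmem p hp)
    have hp1 : |p| ≤ 1 := by rw [abs_of_nonneg hp.1]; linarith [hp.2]
    refine (abs_add_le _ _).trans ?_
    rw [abs_mul, abs_mul, abs_mul, abs_mul, abs_of_nonneg (pow_nonneg hε.1 _),
      abs_of_nonneg (pow_nonneg hε.1 _)]
    have hcast : |(((2 * n : ℕ) : ℝ) + 1)| = 2 * n + 1 := by
      rw [abs_of_nonneg (by positivity)]; push_cast; ring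
    rw [hcast, pow_succ]
    calc _ ≤ 1 * (ε ^ (2 * n) * |E₀| * C₂) + (2 * n + 1) * (ε ^ (2 * n) * C₃) := by
          have := pow_nonneg hε.1 (2 * n)
          have := hε.1
          gcongr
      _ = _ := by rw [hD]; ring
  have hδ1 : ∀ x, |δ.1 x| ≤ ‖δ.1‖ := fun x => norm_le_pi_norm δ.1 x
  have hδn : ‖δ‖ ≤ ‖δ.1‖ + ‖δ.2‖ := by
    rw [Prod.norm_def]
    exact max_le (by linarith [norm_nonneg δ.2]) (by linarith [norm_nonneg δ.1])
  have hpow := pow_nonneg hε.1 (2 * n)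
  have hβ := M.β_pos
  have hε0 := hε.1
  calc _ ≤ ε ^ (2 * n + 1) * (C₁ * ‖δ‖) + ∑ x : S, 2 * M.β * ‖δ.1‖ * (ε ^ (2 * n) * D) := by
        refine (abs_add_le _ _).trans (add_le_add hb1 ((Finset.abs_sum_le_sum_abs _ _).trans
          (Finset.sum_le_sum fun x _ => ?_)))
        rw [taylorRem_const_mul, abs_mul, abs_mul, abs_of_pos (by positivity)]
        have := hδ1 x
        have := hb2 x
        gcongr
    _ ≤ ε ^ (2 * n + 1) * (C₁ * (‖δ.1‖ + ‖δ.2‖)) + ∑ x : S, 2 * M.β * ‖δ.1‖ * (ε ^ (2 * n) * D) := by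
        gcongr
    _ = ε ^ (2 * n) * (C₁ * (ε * ‖δ.1‖ + ε * ‖δ.2‖) + N * (2 * M.β * D) * ‖δ.1‖) := by
        rw [Finset.sum_const, Finset.card_univ, nsmul_eq_mul, hN, pow_succ]; ring
    _ ≤ ε ^ (2 * n) * ((C₁ * (|E₀| + 1) + N * (2 * M.β * D)) * (‖δ.1‖ + ε * ‖δ.2‖)) := by
        refine mul_le_mul_of_nonneg_left ?_ hpow
        have h1 : C₁ * (ε * ‖δ.1‖ + ε * ‖δ.2‖) ≤ C₁ * (|E₀| + 1) * (‖δ.1‖ + ε * ‖δ.2‖) := by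
          rw [mul_assoc]
          refine mul_le_mul_of_nonneg_left ?_ hC₁0
          have h4 : ε * ‖δ.1‖ ≤ |E₀| * ‖δ.1‖ := mul_le_mul_of_nonneg_right hεE (norm_nonneg _)
          have h5 : 0 ≤ ‖δ.1‖ := norm_nonneg _
          have h6 : 0 ≤ ε * ‖δ.2‖ := mul_nonneg hε.1 (norm_nonneg _)
          nlinarith [mul_nonneg (abs_nonneg E₀) h6]
        have h2 : N * (2 * M.β * D) * ‖δ.1‖ ≤ N * (2 * M.β * D) * (‖δ.1‖ + ε * ‖δ.2‖) := by
          have : 0 ≤ ε * ‖δ.2‖ := mul_nonneg hε.1 (norm_nonneg _)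
          gcongr
          linarith
        linarith
    _ = _ := by ring

/-- The Taylor remainder of `stepFun`, as a function of the two endpoints of the step. -/
noncomputable def stepRem (n : ℕ) (ε : ℝ) (z w : Coord S) : ℝ := taylorRem n (M.stepFun ε z w)

lemma contDiff_stepRem (n : ℕ) (ε : ℝ) :
    ContDiff ℝ ∞ (fun q : Coord S × Coord S => M.stepRem n ε q.1 q.2) :=
  contDiff_taylorRem (M.contDiff_stepFun ε) n

lemma stepRem_self (n : ℕ) (ε : ℝ) (z : Coord S) : M.stepRem n ε z z = 0 := by
  have : M.stepFun ε z z = fun _ => 0 * 0 := by ext p; simp [stepFun_self]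
  rw [stepRem, this, taylorRem_const_mul, zero_mul]

/-- The bound on one step, up to a term of second order in the step. -/
lemma exists_stepRem_bound {n : ℕ} (hn : 1 ≤ n) (E₀ R : ℝ) :
    ∃ C : ℝ, 0 ≤ C ∧ ∀ ε ∈ Set.Icc 0 E₀, ∃ C' : ℝ, 0 ≤ C' ∧
      ∀ z ∈ Metric.closedBall (0 : Coord S) R, ∀ w ∈ Metric.closedBall (0 : Coord S) R,
      |M.stepRem n ε z w| ≤ C * ε ^ (2 * n) * (‖w.1 - z.1‖ + ε * ‖w.2 - z.2‖) + C' * ‖w - z‖ ^ 2 := by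
  obtain ⟨C, hC0, hC⟩ := M.exists_variation_bound hn E₀ R
  refine ⟨C, hC0, fun ε hε => ?_⟩
  obtain ⟨C', hC'0, hC'⟩ := exists_taylor_snd
    ((M.contDiff_stepRem n ε).of_le (WithTop.coe_le_coe.2 (le_top : (2 : ℕ∞) ≤ ⊤)))
    (isCompact_closedBall (0 : Coord S) R) (isCompact_closedBall (0 : Coord S) R)
    (convex_closedBall _ _)
  refine ⟨C', hC'0, fun z hz w hw => ?_⟩
  have h1 := hC' z hz z hz w hw
  have h2 : fderiv ℝ (fun q : Coord S × Coord S => M.stepRem n ε q.1 q.2) (z, z) (0, w - z) = _ :=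
    fderiv_taylorRem (M.contDiff_stepFun ε) n (z, z) (0, w - z)
  simp only [fderiv_stepFun] at h2
  have hδ : w - z ∈ Metric.closedBall (0 : Coord S) (2 * R) := by
    simp only [mem_closedBall_zero_iff] at hz hw ⊢
    exact (norm_sub_le _ _).trans (by linarith)
  have h3 := hC ε hε z hz (w - z) hδ
  rw [← h2] at h3
  rw [stepRem_self, sub_zero] at h1
  have h4 := abs_sub_abs_le_abs_sub (M.stepRem n ε z w)
    (fderiv ℝ (fun q : Coord S × Coord S => M.stepRem n ε q.1 q.2) (z, z) (0, w - z))
  simp only [Prod.fst_sub, Prod.snd_sub] at h3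
  linarith

end ModelClass

end SST

namespace SST

open scoped ENNReal

/-! ### Integrals over ordered times -/

/-- The increasing sequences of `n` times in the open interval from `a` to `t`. -/
def orderedTimes (a t : ℝ) (n : ℕ) : Set (Fin n → ℝ) :=
  {s | StrictMono s ∧ ∀ j, s j ∈ Set.Ioo a t}

/-- The integral of `∏ φ j (s j)` over `a < s 0 < ⋯ < s (n - 1) < t`. -/
noncomputable def simplexIntegral (a : ℝ) (n : ℕ) (φ : Fin n → ℝ → ℝ≥0∞) (t : ℝ) : ℝ≥0∞ :=
  ∫⁻ s in orderedTimes a t n, ∏ j, φ j (s j)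

lemma measurableSet_orderedTimes (a t : ℝ) (n : ℕ) :
    MeasurableSet (orderedTimes a t n) := by
  have h : orderedTimes a t n =
      (⋂ i, ⋂ j, ⋂ _ : i < j, {s | s i < s j}) ∩ ⋂ j, {s | a < s j ∧ s j < t} := by
    ext s
    simp only [orderedTimes, StrictMono, Set.mem_ofPred_eq, Set.mem_inter_iff, Set.mem_iInter, Set.mem_Ioo]
  rw [h]
  refine MeasurableSet.inter ?_ ?_
  · exact MeasurableSet.iInter fun i => MeasurableSet.iInter fun j => MeasurableSet.iInter fun _ =>
      measurableSet_lt (measurable_pi_apply i) (measurable_pi_apply j)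
  · exact MeasurableSet.iInter fun j =>
      (measurableSet_lt measurable_const (measurable_pi_apply j)).inter
        (measurableSet_lt (measurable_pi_apply j) measurable_const)

lemma simplexIntegral_zero (a : ℝ) (φ : Fin 0 → ℝ → ℝ≥0∞) (t : ℝ) :
    simplexIntegral a 0 φ t = 1 := by
  have h : orderedTimes a t 0 = Set.univ := by
    ext s
    simp only [orderedTimes, Set.mem_ofPred_eq, Set.mem_univ, iff_true]
    exact ⟨fun i => i.elim0, fun i => i.elim0⟩
  rw [simplexIntegral, h, Measure.restrict_univ, volume_pi, Measure.pi_of_empty]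
  simp

lemma snoc_mem_orderedTimes {a t u : ℝ} {n : ℕ} {s : Fin n → ℝ} :
    Fin.snoc (α := fun _ => ℝ) s u ∈ orderedTimes a t (n + 1) ↔
      u ∈ Set.Ioo a t ∧ s ∈ orderedTimes a u n := by
  constructor
  · rintro ⟨h1, h2⟩
    have hu : u ∈ Set.Ioo a t := by simpa using h2 (Fin.last n)
    refine ⟨hu, fun i j hij => ?_, fun j => ⟨?_, ?_⟩⟩
    · simpa using h1 (Fin.castSucc_lt_castSucc_iff.2 hij)
    · simpa using (h2 j.castSucc).1
    · simpa using h1 (Fin.castSucc_lt_last j)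
  · rintro ⟨hu, h1, h2⟩
    refine ⟨fun i j hij => ?_, fun j => ?_⟩
    · induction j using Fin.lastCases with
      | last =>
        induction i using Fin.lastCases with
        | last => exact absurd hij (lt_irrefl _)
        | cast i => simpa using (h2 i).2
      | cast j =>
        induction i using Fin.lastCases with
        | last => exact absurd hij (not_lt.2 (Fin.le_last _))
        | cast i => simpa using h1 (Fin.castSucc_lt_castSucc_iff.1 hij)
    · induction j using Fin.lastCases with
      | last => simpa using hu
      | cast j => simpa using ⟨(h2 j).1, (h2 j).2.trans hu.2⟩

/-- The last time can be integrated last. -/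
lemma simplexIntegral_succ (a : ℝ) (n : ℕ) (φ : Fin (n + 1) → ℝ → ℝ≥0∞)
    (hφ : ∀ j, Measurable (φ j)) (t : ℝ) :
    simplexIntegral a (n + 1) φ t =
      ∫⁻ u in Set.Ioo a t, φ (Fin.last n) u * simplexIntegral a n (fun j => φ j.castSucc) u := by
  have hmp := (volume_preserving_piFinSuccAbove (fun _ : Fin (n + 1) => ℝ) (Fin.last n)).symm
  have hm : Measurable fun s : Fin (n + 1) → ℝ => ∏ j, φ j (s j) :=
    Finset.measurable_prod _ fun j _ => (hφ j).comp (measurable_pi_apply j)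
  have hm' : Measurable fun s : Fin n → ℝ => ∏ j : Fin n, φ j.castSucc (s j) :=
    Finset.measurable_prod _ fun j _ => (hφ _).comp (measurable_pi_apply j)
  have hG : Measurable ((orderedTimes a t (n + 1)).indicator
      fun s => ∏ j, φ j (s j)) := hm.indicator (measurableSet_orderedTimes a t (n + 1))
  have happ : ∀ q : ℝ × (Fin n → ℝ),
      (MeasurableEquiv.piFinSuccAbove (fun _ : Fin (n + 1) => ℝ) (Fin.last n)).symm q =
        Fin.snoc (α := fun _ => ℝ) q.2 q.1 := by
    intro q
    simp [MeasurableEquiv.piFinSuccAbove_symm_apply, Fin.insertNthEquiv, Fin.insertNth_last']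
  have hmq : Measurable fun q : ℝ × (Fin n → ℝ) =>
      (MeasurableEquiv.piFinSuccAbove (fun _ : Fin (n + 1) => ℝ) (Fin.last n)).symm q :=
    MeasurableEquiv.measurable _
  rw [simplexIntegral, ← lintegral_indicator (measurableSet_orderedTimes a t (n + 1)),
    ← hmp.lintegral_comp hG, Measure.volume_eq_prod, lintegral_prod
      (fun q => (orderedTimes a t (n + 1)).indicator
        (fun s => ∏ j, φ j (s j)) ((MeasurableEquiv.piFinSuccAbove (fun _ : Fin (n + 1) => ℝ) (Fin.last n)).symm q))
      (hG.comp hmq).aemeasurable,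
    ← lintegral_indicator measurableSet_Ioo]
  refine lintegral_congr fun u => ?_
  by_cases hu : u ∈ Set.Ioo a t
  · rw [Set.indicator_of_mem hu, simplexIntegral,
      ← lintegral_indicator (measurableSet_orderedTimes a u n),
      ← lintegral_const_mul _ (hm'.indicator (measurableSet_orderedTimes a u n))]
    refine lintegral_congr fun s => ?_
    rw [happ]
    by_cases hs : s ∈ orderedTimes a u n
    · rw [Set.indicator_of_mem hs,
        Set.indicator_of_mem (snoc_mem_orderedTimes.2 ⟨hu, hs⟩)]
      rw [Fin.prod_univ_castSucc, mul_comm]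
      simp
    · rw [Set.indicator_of_notMem hs,
        Set.indicator_of_notMem
          (fun h => hs (snoc_mem_orderedTimes.1 h).2), mul_zero]
  · rw [Set.indicator_of_notMem hu]
    refine (lintegral_congr fun s => ?_).trans lintegral_zero
    rw [happ, Set.indicator_of_notMem
          (fun h => hu (snoc_mem_orderedTimes.1 h).1)]

lemma simplexIntegral_mono (a : ℝ) (n : ℕ) (φ : Fin n → ℝ → ℝ≥0∞) :
    Monotone (simplexIntegral a n φ) := fun _ _ h =>
  lintegral_mono_set fun _ hs => ⟨hs.1, fun j => ⟨(hs.2 j).1, (hs.2 j).2.trans_le h⟩⟩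

/-! ### The Dyson series -/

section Dyson

variable {S : Type*} [Fintype S]

/-- The total weight of the paths with `n` jumps on `[a, t]` that end in a given state, if the
initial state `x` has the weight `q x` and a jump from `x` to `y` at time `s` has the
weight `K s x y`. -/
noncomputable def dyson (K : ℝ → S → S → ℝ≥0∞) (q : S → ℝ≥0∞) (a : ℝ) : ℕ → ℝ → S → ℝ≥0∞
  | 0, _, y => q y
  | n + 1, t, y => ∫⁻ s in Set.Ioo a t, ∑ x, K s x y * dyson K q a n s x

lemma measurable_dyson (K : ℝ → S → S → ℝ≥0∞) (q : S → ℝ≥0∞) (a : ℝ) (n : ℕ) (y : S) :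
    Measurable fun t => dyson K q a n t y := by
  cases n with
  | zero => exact measurable_const
  | succ n =>
    have : Monotone fun t => dyson K q a (n + 1) t y := fun s t h =>
      lintegral_mono_set (Set.Ioo_subset_Ioo_right h)
    exact this.measurable

lemma dyson_eq_sum {K : ℝ → S → S → ℝ≥0∞} (hK : ∀ x y, Measurable fun t => K t x y)
    (q : S → ℝ≥0∞) (a : ℝ) [DecidableEq S] (n : ℕ) (t : ℝ) (y : S) :
    dyson K q a n t y = ∑ x : Fin (n + 1) → S, if x (Fin.last n) = y then
      q (x 0) * simplexIntegral a n (fun j s => K s (x j.castSucc) (x j.succ)) t else 0 := by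
  induction n generalizing t y with
  | zero =>
    simp only [dyson, simplexIntegral_zero, mul_one]
    rw [← (Equiv.funUnique (Fin 1) S).symm.sum_comp]
    simp [Fin.last_zero]
  | succ n ih =>
    rw [dyson, ← (Fin.snocEquiv fun _ : Fin (n + 2) => S).sum_comp, Fintype.sum_prod_type]
    simp only [Fin.snocEquiv_apply, Fin.snoc_last]
    rw [Finset.sum_eq_single y (fun z _ hz => by simp [hz]) (by simp)]
    simp only [if_true, ih]
    have hterm : ∀ x' : Fin (n + 1) → S,
        q ((Fin.snoc (α := fun _ => S) x' y : Fin (n + 2) → S) 0) *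
          simplexIntegral a (n + 1) (fun j s =>
            K s ((Fin.snoc (α := fun _ => S) x' y : Fin (n + 2) → S) j.castSucc)
              ((Fin.snoc (α := fun _ => S) x' y : Fin (n + 2) → S) j.succ)) t =
        ∫⁻ s in Set.Ioo a t, K s (x' (Fin.last n)) y *
          (q (x' 0) * simplexIntegral a n (fun j s => K s (x' j.castSucc) (x' j.succ)) s) := by
      intro x'
      have h0 : (Fin.snoc (α := fun _ => S) x' y : Fin (n + 2) → S) 0 = x' 0 := by
        rw [← Fin.castSucc_zero, Fin.snoc_castSucc]
      have hcs : ∀ j : Fin n, (Fin.snoc (α := fun _ => S) x' y : Fin (n + 2) → S)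
          j.castSucc.succ = x' j.succ := by
        intro j; rw [← Fin.castSucc_succ, Fin.snoc_castSucc]
      rw [simplexIntegral_succ _ _ _ (fun j => hK _ _), h0,
        ← lintegral_const_mul]
      · refine lintegral_congr fun s => ?_
        simp only [Fin.snoc_castSucc, Fin.succ_last, Fin.snoc_last, hcs]
        ring
      · exact (hK _ _).mul (simplexIntegral_mono _ _ _).measurable
    simp only [hterm]
    rw [← lintegral_finsetSum]
    · refine lintegral_congr fun s => ?_
      simp only [Finset.mul_sum]
      rw [Finset.sum_comm]
      refine Finset.sum_congr rfl fun x' _ => ?_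
      rw [Finset.sum_eq_single (x' (Fin.last n)) (fun z _ hz => by simp [Ne.symm hz]) (by simp)]
      simp
    · exact fun x' _ => (hK _ _).mul
        (measurable_const.mul (simplexIntegral_mono _ _ _).measurable)

/-- `U` solves the forward equation with jump weights `K` on `[a, b]` in integrated form, starting
from `q`. -/
structure IsSolution (K : ℝ → S → S → ℝ≥0∞) (q : S → ℝ≥0∞) (a b : ℝ) (U : ℝ → S → ℝ≥0∞) :
    Prop where
  meas : ∀ x, Measurable fun t => U t x
  bound : ∃ C : ℝ≥0, ∀ t ∈ Set.Icc a b, ∀ x, U t x ≤ C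
  eq : ∀ t ∈ Set.Icc a b, ∀ y, U t y = q y + ∫⁻ s in Set.Ioo a t, ∑ x, K s x y * U s x

lemma IsSolution.left {K : ℝ → S → S → ℝ≥0∞} {q : S → ℝ≥0∞} {a b : ℝ} {U : ℝ → S → ℝ≥0∞}
    (h : IsSolution K q a b U) (hab : a ≤ b) (y : S) : U a y = q y := by
  rw [h.eq a ⟨le_rfl, hab⟩]; simp

lemma IsSolution.trans {K : ℝ → S → S → ℝ≥0∞} {q : S → ℝ≥0∞} {a b c : ℝ}
    {U U' : ℝ → S → ℝ≥0∞} (h : IsSolution K q a b U) (h' : IsSolution K (U b) b c U')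
    (hab : a ≤ b) :
    IsSolution K q a c (fun t => if t ≤ b then U t else U' t) := by
  refine ⟨fun x => ?_, ?_, fun t ht y => ?_⟩
  · have : (fun t => (if t ≤ b then U t else U' t) x) = fun t => if t ≤ b then U t x else U' t x := by
      ext t; split_ifs <;> rfl
    rw [this]
    exact Measurable.ite measurableSet_Iic (h.meas x) (h'.meas x)
  · obtain ⟨C, hC⟩ := h.bound
    obtain ⟨C', hC'⟩ := h'.bound
    refine ⟨max C C', fun t ht x => ?_⟩
    split_ifs with htb
    · exact (hC t ⟨ht.1, htb⟩ x).trans (by exact_mod_cast le_max_left _ _)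
    · exact (hC' t ⟨(not_le.1 htb).le, ht.2⟩ x).trans (by exact_mod_cast le_max_right _ _)
  · have hle : ∀ r ≤ b, ∫⁻ s in Set.Ioo a r, ∑ x, K s x y * (if s ≤ b then U s else U' s) x =
        ∫⁻ s in Set.Ioo a r, ∑ x, K s x y * U s x := fun r hr =>
      setLIntegral_congr_fun measurableSet_Ioo fun s hs => by
        simp only [if_pos (hs.2.le.trans hr)]
    split_ifs with htb
    · rw [hle t htb, h.eq t ⟨ht.1, htb⟩]
    · have htb' := not_le.1 htb
      rw [h'.eq t ⟨htb'.le, ht.2⟩, h.eq b ⟨hab, le_rfl⟩, add_assoc, ← hle b le_rfl]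
      congr 1
      have h3 : ∫⁻ s in Set.Ioo b t, ∑ x, K s x y * U' s x =
          ∫⁻ s in Set.Ioo b t, ∑ x, K s x y * (if s ≤ b then U s else U' s) x :=
        setLIntegral_congr_fun measurableSet_Ioo fun s hs => by
          simp only [if_neg (not_le.2 hs.1)]
      have h4 : ∀ u v : ℝ, ∀ f : ℝ → ℝ≥0∞,
          ∫⁻ s in Set.Ioo u v, f s = ∫⁻ s in Set.Ioc u v, f s := fun u v f =>
        setLIntegral_congr Ioo_ae_eq_Ioc
      rw [h3, h4, h4, h4, ← lintegral_union measurableSet_Ioc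
        (Set.disjoint_left.2 fun s hs hs' => not_lt.2 hs.2 hs'.1),
        Set.Ioc_union_Ioc_eq_Ioc hab htb'.le]

lemma sum_dyson_succ {K : ℝ → S → S → ℝ≥0∞} (hK : ∀ x y, Measurable fun t => K t x y)
    (q : S → ℝ≥0∞) (a : ℝ) (m : ℕ) (t : ℝ) (y : S) :
    ∑ n ∈ Finset.range (m + 1), dyson K q a n t y =
      q y + ∫⁻ s in Set.Ioo a t, ∑ x, K s x y * ∑ n ∈ Finset.range m, dyson K q a n s x := by
  rw [Finset.sum_range_succ', add_comm]
  congr 1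
  simp only [dyson]
  rw [← lintegral_finsetSum]
  · refine lintegral_congr fun s => ?_
    rw [Finset.sum_comm]
    simp only [Finset.mul_sum]
  · exact fun n _ => Finset.measurable_sum _ fun x _ => (hK _ _).mul (measurable_dyson _ _ _ _ _)

lemma lintegral_Ioo_pow {a t C : ℝ} (hC : 0 ≤ C) (hat : a ≤ t) (m : ℕ) :
    ∫⁻ s in Set.Ioo a t, ENNReal.ofReal (C * (s - a) ^ m / m.factorial) =
      ENNReal.ofReal (C * (t - a) ^ (m + 1) / (m + 1).factorial) := by
  rw [setLIntegral_congr Ioo_ae_eq_Ioc, ← ofReal_integral_eq_lintegral_ofReal,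
    ← intervalIntegral.integral_of_le hat]
  · congr 1
    rw [intervalIntegral.integral_div, intervalIntegral.integral_const_mul,
      intervalIntegral.integral_comp_sub_right (fun s => s ^ m), integral_pow, sub_self,
      zero_pow (Nat.succ_ne_zero m), sub_zero, Nat.factorial_succ]
    push_cast
    have : (m.factorial : ℝ) ≠ 0 := by positivity
    have : (m : ℝ) + 1 ≠ 0 := by positivity
    field_simp
  · exact (Continuous.integrableOn_Icc (by fun_prop)).mono_set Set.Ioc_subset_Icc_self
  · filter_upwards [ae_restrict_mem measurableSet_Ioc] with s hs
    have : 0 ≤ s - a := sub_nonneg.2 hs.1.le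
    positivity

/-- The bounded solution of the forward equation is the sum of the Dyson series. -/
theorem IsSolution.tsum_dyson {K : ℝ → S → S → ℝ≥0∞} (hK : ∀ x y, Measurable fun t => K t x y)
    {q : S → ℝ≥0∞} {a b : ℝ} {U : ℝ → S → ℝ≥0∞} (h : IsSolution K q a b U) (B : ℝ≥0)
    (hB : ∀ t ∈ Set.Icc a b, ∀ x y, K t x y ≤ B) {t : ℝ} (ht : t ∈ Set.Icc a b) (y : S) :
    ∑' n, dyson K q a n t y = U t y := by
  obtain ⟨C, hC⟩ := h.bound
  have hsub : ∀ t ∈ Set.Icc a b, ∀ s ∈ Set.Ioo a t, s ∈ Set.Icc a b := fun t ht s hs =>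
    ⟨hs.1.le, hs.2.le.trans ht.2⟩
  have hm : ∀ m x, Measurable fun s => ∑ n ∈ Finset.range m, dyson K q a n s x := fun m x =>
    Finset.measurable_sum _ fun n _ => measurable_dyson _ _ _ _ _
  -- the partial sums are below the solution
  have hle : ∀ m : ℕ, ∀ t ∈ Set.Icc a b, ∀ y, ∑ n ∈ Finset.range m, dyson K q a n t y ≤ U t y := by
    intro m
    induction m with
    | zero => intro t _ y; simp
    | succ m ih =>
      intro t ht y
      rw [sum_dyson_succ hK, h.eq t ht]
      refine add_le_add_right (setLIntegral_mono' measurableSet_Ioo fun s hs => ?_) _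
      exact Finset.sum_le_sum fun x _ => mul_le_mul_right (ih s (hsub t ht s hs) x) _
  -- and miss it by the remainder of an exponential series
  set D : ℝ≥0 := Fintype.card S * B with hD
  have hge : ∀ m : ℕ, ∀ t ∈ Set.Icc a b, ∀ y, U t y ≤ ∑ n ∈ Finset.range m, dyson K q a n t y +
      ENNReal.ofReal ((C * D ^ m) * (t - a) ^ m / m.factorial) := by
    intro m
    induction m with
    | zero => intro t ht y; simpa using hC t ht y
    | succ m ih =>
      intro t ht y
      have hstep : ∀ s ∈ Set.Ioo a t, ∑ x, K s x y * U s x ≤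
          ∑ x, K s x y * ∑ n ∈ Finset.range m, dyson K q a n s x +
            ENNReal.ofReal ((C * D ^ (m + 1)) * (s - a) ^ m / m.factorial) := by
        intro s hs
        have hs' := hsub t ht s hs
        have e1 : ENNReal.ofReal ((C * D ^ (m + 1)) * (s - a) ^ m / m.factorial) =
            ∑ _x : S, (B : ℝ≥0∞) * ENNReal.ofReal ((C * D ^ m) * (s - a) ^ m / m.factorial) := by
          rw [Finset.sum_const, Finset.card_univ, nsmul_eq_mul, ← mul_assoc]
          have : (Fintype.card S : ℝ≥0∞) * B = ENNReal.ofReal D := by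
            rw [hD, ENNReal.ofReal_coe_nnreal]; push_cast; rfl
          rw [this, ← ENNReal.ofReal_mul D.coe_nonneg]
          congr 1
          ring
        rw [e1, ← Finset.sum_add_distrib]
        refine Finset.sum_le_sum fun x _ => ?_
        calc K s x y * U s x ≤ K s x y * (∑ n ∈ Finset.range m, dyson K q a n s x +
              ENNReal.ofReal ((C * D ^ m) * (s - a) ^ m / m.factorial)) :=
              mul_le_mul_right (ih s hs' x) _
          _ ≤ _ := by
              rw [mul_add]
              exact add_le_add_right (mul_le_mul_left (hB s hs' x y) _) _
      calc U t y = q y + ∫⁻ s in Set.Ioo a t, ∑ x, K s x y * U s x := h.eq t ht y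
        _ ≤ q y + ∫⁻ s in Set.Ioo a t, (∑ x, K s x y * ∑ n ∈ Finset.range m, dyson K q a n s x +
            ENNReal.ofReal ((C * D ^ (m + 1)) * (s - a) ^ m / m.factorial)) :=
            add_le_add_right (setLIntegral_mono' measurableSet_Ioo hstep) _
        _ = _ := by
            have hm' : Measurable fun s =>
                ∑ x, K s x y * ∑ n ∈ Finset.range m, dyson K q a n s x :=
              Finset.measurable_sum _ fun x _ => (hK _ _).mul (hm _ _)
            rw [lintegral_add_left hm',
              lintegral_Ioo_pow (by positivity) ht.1, sum_dyson_succ hK, add_assoc]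
  refine le_antisymm (ENNReal.tsum_le_of_sum_range_le fun m => hle m t ht y) ?_
  have hlim : Tendsto (fun m : ℕ => ∑' n, dyson K q a n t y +
      ENNReal.ofReal ((C * D ^ m) * (t - a) ^ m / m.factorial)) atTop
      (𝓝 (∑' n, dyson K q a n t y + 0)) := by
    refine Tendsto.add tendsto_const_nhds ?_
    have h1 := (FloorSemiring.tendsto_pow_div_factorial_atTop (D * (t - a) : ℝ)).const_mul (C : ℝ)
    rw [mul_zero] at h1
    have h2 := ENNReal.tendsto_ofReal h1
    rw [ENNReal.ofReal_zero] at h2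
    refine h2.congr fun m => ?_
    congr 1
    rw [mul_pow]; ring
  rw [add_zero] at hlim
  refine ge_of_tendsto' hlim fun m => (hge m t ht y).trans ?_
  gcongr
  exact ENNReal.sum_le_tsum _

end Dyson
end SST

namespace SST

open scoped ENNReal

/-! ### Integrals over paths -/

section PathIntegral

variable {S : Type*}

lemma measurable_sigma_iff {ι α : Type*} {E : ι → Type*} [∀ i, MeasurableSpace (E i)]
    [MeasurableSpace α] {f : (Σ i, E i) → α} :
    Measurable f ↔ ∀ i, Measurable fun q : E i => f ⟨i, q⟩ := by
  constructor
  · exact fun h i => h.comp (fun s hs => MeasurableSpace.measurableSet_iInf.1 hs i)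
  · exact fun h s hs => MeasurableSpace.measurableSet_iInf.2 fun i => h i hs

lemma measurable_sigma_mk {ι : Type*} {E : ι → Type*} [∀ i, MeasurableSpace (E i)] (i : ι) :
    Measurable (Sigma.mk i : E i → Σ i, E i) :=
  measurable_sigma_iff.1 (measurable_id : Measurable (id : (Σ i, E i) → _)) i

/-- The weights `K` without those of the transitions from a state to itself. -/
def offDiag [DecidableEq S] (K : ℝ → S → S → ℝ≥0∞) : ℝ → S → S → ℝ≥0∞ :=
  fun t x y => if x = y then 0 else K t x y

variable [Fintype S] [DecidableEq S] [MeasurableSpace S] [DiscreteMeasurableSpace S]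

omit [DecidableEq S] in
lemma measurable_path {α : Type*} [MeasurableSpace α] {F : Path S → α}
    (h : ∀ n (x : Fin (n + 1) → S), Measurable fun t : Fin n → ℝ => F ⟨n, (x, t)⟩) :
    Measurable F :=
  measurable_sigma_iff.2 fun n => measurable_from_prod_countable_right fun x => h n x

/-- The integral of a multiplicative function over all paths is given by the Dyson series. -/
theorem lintegral_base_eq {K : ℝ → S → S → ℝ≥0∞} (hK : ∀ x y, Measurable fun t => K t x y)
    (q f : S → ℝ≥0∞) (a b : ℝ) {F : Path S → ℝ≥0∞}
    (hF : ∀ n (x : Fin (n + 1) → S) (t : Fin n → ℝ), (∀ j : Fin n, x j.castSucc ≠ x j.succ) →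
      F ⟨n, (x, t)⟩ =
        q (x 0) * (∏ j : Fin n, K (t j) (x j.castSucc) (x j.succ)) * f (x (Fin.last n)))
    (hFm : Measurable F) :
    ∫⁻ p, F p ∂Path.base a b = ∑ y, f y * ∑' n, dyson (offDiag K) q a n b y := by
  have hK' : ∀ x y, Measurable fun t => offDiag K t x y := by
    intro x y
    unfold offDiag
    split_ifs
    · exact measurable_const
    · exact hK x y
  rw [Path.base, lintegral_sum_measure]
  simp only [← ENNReal.tsum_mul_left]
  rw [← (Summable.tsum_finsetSum fun _ _ => ENNReal.summable)]
  refine tsum_congr fun n => ?_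
  rw [lintegral_map hFm (measurable_sigma_mk n)]
  have hset : MeasurableSet {q : (Fin (n + 1) → S) × (Fin n → ℝ) |
      (∀ j : Fin n, q.1 j.castSucc ≠ q.1 j.succ) ∧ StrictMono q.2 ∧ ∀ j, q.2 j ∈ Set.Ioo a b} :=
    (measurable_fst (MeasurableSet.of_discrete
      (s := {x : Fin (n + 1) → S | ∀ j : Fin n, x j.castSucc ≠ x j.succ}))).inter
      (measurable_snd (measurableSet_orderedTimes a b n))
  have hFn : Measurable fun q : (Fin (n + 1) → S) × (Fin n → ℝ) => F ⟨n, q⟩ :=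
    hFm.comp (measurable_sigma_mk n)
  rw [← lintegral_indicator hset, lintegral_prod _ (hFn.indicator hset).aemeasurable,
    lintegral_count, tsum_fintype]
  simp only [dyson_eq_sum hK', Finset.mul_sum]
  rw [Finset.sum_comm]
  refine Finset.sum_congr rfl fun x _ => ?_
  rw [Finset.sum_eq_single (x (Fin.last n)) (fun z _ hz => by simp [hz.symm]) (by simp), if_pos rfl]
  have hm : Measurable fun t : Fin n → ℝ => ∏ j, offDiag K (t j) (x j.castSucc) (x j.succ) :=
    Finset.measurable_prod _ fun j _ => (hK' _ _).comp (measurable_pi_apply j)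
  rw [simplexIntegral, ← lintegral_const_mul _ hm, ← lintegral_const_mul _ (hm.const_mul _),
    ← lintegral_indicator (measurableSet_orderedTimes a b n)]
  refine lintegral_congr fun t => ?_
  by_cases hx : ∀ j : Fin n, x j.castSucc ≠ x j.succ
  · have hprod : ∏ j, offDiag K (t j) (x j.castSucc) (x j.succ) =
        ∏ j, K (t j) (x j.castSucc) (x j.succ) :=
      Finset.prod_congr rfl fun j _ => by simp [offDiag, hx j]
    by_cases ht : t ∈ orderedTimes a b n
    · rw [Set.indicator_of_mem ht, Set.indicator_of_mem, hF n x t hx, hprod]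
      · ring
      · exact ⟨hx, ht⟩
    · rw [Set.indicator_of_notMem ht, Set.indicator_of_notMem fun h => ht h.2]
  · rw [Set.indicator_of_notMem fun h => hx h.1]
    push Not at hx
    obtain ⟨j, hj⟩ := hx
    have : ∏ j, offDiag K (t j) (x j.castSucc) (x j.succ) = 0 :=
      Finset.prod_eq_zero (Finset.mem_univ j) (by simp [offDiag, hj])
    simp [Set.indicator, this]

end PathIntegral

/-! ### The forward equation for constant rates -/

section Piece

open NormedSpace (exp)

variable {S : Type*} [Fintype S] [DecidableEq S]

section

open scoped Matrix.Norms.Operator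

lemma hasDerivAt_matrix_exp_smul (A : Matrix S S ℝ) (t : ℝ) (y x : S) :
    HasDerivAt (fun t : ℝ => exp (t • A) y x) ((A * exp (t • A)) y x) t := by
  have h := hasDerivAt_exp_smul_const' (𝕂 := ℝ) A t
  have h2 := ((Matrix.entryLinearMap ℝ ℝ y x).toContinuousLinearMap).hasFDerivAt.comp_hasDerivAt t h
  exact h2

end

lemma hasDerivAt_matrix_exp_mulVec (A : Matrix S S ℝ) (v : S → ℝ) (s t : ℝ) (y : S) :
    HasDerivAt (fun t : ℝ => (exp ((t - s) • A) *ᵥ v) y) ((A *ᵥ (exp ((t - s) • A) *ᵥ v)) y) t := by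
  rw [Matrix.mulVec_mulVec]
  simp only [Matrix.mulVec, dotProduct]
  refine HasDerivAt.fun_sum fun x _ => HasDerivAt.mul_const ?_ _
  exact (hasDerivAt_matrix_exp_smul A (t - s) y x).comp_sub_const t s

omit [Fintype S] [DecidableEq S] in
lemma IsMetzler.smul {K : Matrix S S ℝ} (hK : IsMetzler K) {t : ℝ} (ht : 0 < t) :
    IsMetzler (t • K) :=
  ⟨fun y x h => mul_nonneg ht.le (hK.nonneg y x h), fun x y =>
    Relation.ReflTransGen.mono (fun _ _ h => ⟨h.1, mul_pos ht h.2⟩) _ _ (hK.connected x y)⟩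

lemma IsMetzler.exp_smul_mulVec_nonneg {K : Matrix S S ℝ} (hK : IsMetzler K) {t : ℝ} (ht : 0 ≤ t)
    {v : S → ℝ} (hv : ∀ x, 0 ≤ v x) (y : S) : 0 ≤ (exp (t • K) *ᵥ v) y := by
  rcases ht.eq_or_lt with rfl | ht
  · simpa using hv y
  · exact Finset.sum_nonneg fun x _ => mul_nonneg ((hK.smul ht).exp_pos y x).le (hv x)

/-- In the interaction picture, in which the diagonal of `A` is removed by the phases
`η x t = c x + (t - s) A x x`, the exponential of `A` solves the forward equation. -/
lemma IsMetzler.isSolution {A : Matrix S S ℝ} (hA : IsMetzler A) {s T : ℝ}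
    {v : S → ℝ} (hv : ∀ x, 0 ≤ v x) (c : S → ℝ) {K : ℝ → S → S → ℝ≥0∞}
    (hK : ∀ t ∈ Set.Ioo s (s + T), ∀ x y, x ≠ y → K t x y = ENNReal.ofReal
      (A y x * Real.exp ((c x + (t - s) * A x x) - (c y + (t - s) * A y y)))) :
    IsSolution (offDiag K) (fun y => ENNReal.ofReal (Real.exp (-c y) * v y)) s (s + T)
      (fun t y => ENNReal.ofReal
        (Real.exp (-(c y + (t - s) * A y y)) * (exp ((t - s) • A) *ᵥ v) y)) := by
  set V : ℝ → S → ℝ := fun t y =>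
    Real.exp (-(c y + (t - s) * A y y)) * (exp ((t - s) • A) *ᵥ v) y with hV
  set k : ℝ → S → S → ℝ := fun t x y => if x = y then 0 else
    A y x * Real.exp ((c x + (t - s) * A x x) - (c y + (t - s) * A y y)) with hk
  have hVd : ∀ t y, HasDerivAt (fun t => V t y) (∑ x, k t x y * V t x) t := by
    intro t y
    have h1 : HasDerivAt (fun t : ℝ => Real.exp (-(c y + (t - s) * A y y)))
        (Real.exp (-(c y + (t - s) * A y y)) * (-(1 * A y y))) t :=
      ((((hasDerivAt_id t).sub_const s).mul_const (A y y)).const_add (c y)).fun_neg.exp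
    have h2 := h1.mul (hasDerivAt_matrix_exp_mulVec A v s t y)
    refine h2.congr_deriv ?_
    set w := exp ((t - s) • A) *ᵥ v with hw
    have h3 : ∀ x, k t x y * V t x = Real.exp (-(c y + (t - s) * A y y)) *
        (if x = y then 0 else A y x * w x) := by
      intro x
      simp only [hk, hV]
      split_ifs with h
      · simp
      · have : Real.exp (c x + (t - s) * A x x - (c y + (t - s) * A y y)) *
            Real.exp (-(c x + (t - s) * A x x)) = Real.exp (-(c y + (t - s) * A y y)) := by
          rw [← Real.exp_add]; congr 1; ring
        rw [← this]; ring
    simp only [h3]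
    rw [← Finset.mul_sum, Matrix.mulVec, dotProduct,
      ← Finset.add_sum_erase _ _ (Finset.mem_univ y),
      ← Finset.add_sum_erase (a := y) Finset.univ (fun x => if x = y then 0 else A y x * w x)
        (Finset.mem_univ y)]
    rw [Finset.sum_congr rfl (g := fun x => if x = y then 0 else A y x * w x) fun x hx => by
      rw [if_neg (Finset.ne_of_mem_erase hx)]]
    simp only [if_true]
    ring
  have hVc : ∀ y, Continuous fun t => V t y := fun y =>
    continuous_iff_continuousAt.2 fun t => (hVd t y).continuousAt
  have hkc : ∀ x y, Continuous fun t => k t x y := by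
    intro x y
    simp only [hk]
    split_ifs
    · exact continuous_const
    · fun_prop
  have hV0 : ∀ t, s ≤ t → ∀ y, 0 ≤ V t y := fun t ht y =>
    mul_nonneg (Real.exp_pos _).le (hA.exp_smul_mulVec_nonneg (sub_nonneg.2 ht) hv y)
  have hk0 : ∀ t x y, 0 ≤ k t x y := by
    intro t x y
    simp only [hk]
    split_ifs with h
    · exact le_rfl
    · exact mul_nonneg (hA.nonneg y x (Ne.symm h)) (Real.exp_pos _).le
  refine ⟨fun x => ENNReal.measurable_ofReal.comp (hVc x).measurable, ?_, fun t ht y => ?_⟩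
  · have hx : ∀ x, ∃ C : ℝ, ∀ t ∈ Set.Icc s (s + T), ‖V t x‖ ≤ C := fun x =>
      isCompact_Icc.exists_bound_of_continuousOn (hVc x).continuousOn
    choose C hC using hx
    refine ⟨(∑ x, |C x|).toNNReal, fun t ht x => ENNReal.ofReal_le_ofReal ?_⟩
    refine (le_abs_self _).trans ((hC x t ht).trans ((le_abs_self _).trans ?_))
    exact Finset.single_le_sum (f := fun x => |C x|) (fun _ _ => abs_nonneg _) (Finset.mem_univ x)
  · have hint : ∫ r in s..t, ∑ x, k r x y * V r x = V t y - V s y :=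
      intervalIntegral.integral_eq_sub_of_hasDerivAt (fun r _ => hVd r y)
        (Continuous.intervalIntegrable
          (continuous_finsetSum _ fun x _ => (hkc x y).mul (hVc x)) _ _)
    have hVs : V s y = Real.exp (-c y) * v y := by simp [hV]
    have hnn : ∀ r, s ≤ r → 0 ≤ ∑ x, k r x y * V r x := fun r hr =>
      Finset.sum_nonneg fun x _ => mul_nonneg (hk0 _ _ _) (hV0 r hr x)
    have hK2 : ∫⁻ r in Set.Ioo s t, ∑ x, offDiag K r x y * ENNReal.ofReal (V r x) =
        ∫⁻ r in Set.Ioo s t, ENNReal.ofReal (∑ x, k r x y * V r x) := by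
      refine setLIntegral_congr_fun measurableSet_Ioo fun r hr => ?_
      rw [ENNReal.ofReal_sum_of_nonneg fun x _ => mul_nonneg (hk0 _ _ _) (hV0 r hr.1.le x)]
      refine Finset.sum_congr rfl fun x _ => ?_
      rw [ENNReal.ofReal_mul (hk0 _ _ _)]
      congr 1
      simp only [offDiag, hk]
      split_ifs with h
      · simp
      · exact hK r ⟨hr.1, hr.2.trans_le ht.2⟩ x y h
    change ENNReal.ofReal (V t y) = ENNReal.ofReal (Real.exp (-c y) * v y) +
      ∫⁻ r in Set.Ioo s t, ∑ x, offDiag K r x y * ENNReal.ofReal (V r x)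
    rw [hK2, setLIntegral_congr Ioo_ae_eq_Ioc, ← ofReal_integral_eq_lintegral_ofReal,
      ← intervalIntegral.integral_of_le ht.1, hint, hVs,
      ← ENNReal.ofReal_add (mul_nonneg (Real.exp_pos _).le (hv y))]
    · congr 1; ring
    · rw [← hVs, ← hint]
      exact intervalIntegral.integral_nonneg ht.1 fun r hr => hnn r hr.1
    · exact (Continuous.integrableOn_Icc
        (continuous_finsetSum _ fun x _ => (hkc x y).mul (hVc x))).mono_set Set.Ioc_subset_Icc_self
    · filter_upwards [ae_restrict_mem measurableSet_Ioc] with r hr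
      exact hnn r hr.1.le

end Piece

end SST

namespace SST

/-! ### Telescoping sums along a path -/

lemma Path.sum_times {S : Type*} (G : S → ℝ → ℝ) (a b : ℝ) (p : Path S) :
    ∑ j : Fin (p.1 + 1), (G (p.2.1 j) (p.times a b j.succ) - G (p.2.1 j) (p.times a b j.castSucc)) =
      G p.final b - G p.initial a +
        ∑ j : Fin p.1, (G (p.2.1 j.castSucc) (p.2.2 j) - G (p.2.1 j.succ) (p.2.2 j)) := by
  obtain ⟨n, x, t⟩ := p
  simp only [Finset.sum_sub_distrib, Path.final, Path.initial, Path.times]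
  rw [Fin.sum_univ_castSucc (fun j : Fin (n + 1) => G (x j)
      (Fin.snoc (α := fun _ => ℝ) (Fin.cons (α := fun _ => ℝ) a t : Fin (n + 1) → ℝ) b j.succ)),
    Fin.sum_univ_succ (fun j : Fin (n + 1) => G (x j)
      (Fin.snoc (α := fun _ => ℝ) (Fin.cons (α := fun _ => ℝ) a t : Fin (n + 1) → ℝ) b j.castSucc))]
  simp only [Fin.succ_last, Fin.snoc_last, Fin.snoc_castSucc, Fin.cons_zero, Fin.cons_succ,
    Fin.succ_castSucc]
  ring

namespace Model

variable {S : Type*} {M : ModelClass S} {d m : ℕ} (X : Model M d m)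

/-! ### Models in coordinates -/

open Classical in
/-- The values of the energies and of the nonequilibrium function for given parameters. The latter
are set to zero on the pairs that are not connected, where they do not enter the rates. -/
noncomputable def coord (α : Param d m) : Coord S :=
  (X.H α.ν, fun x y => if x ≠ y ∧ M.c x y ≠ 0 then X.ξ α.κ x y else 0)

lemma rate_eq (α : Param d m) {x y : S} (h : x ≠ y) :
    X.rate α x y = M.c x y * M.ruleFactor ((X.coord α).1 x) ((X.coord α).1 y) *
      Real.exp (α.ε * (X.coord α).2 x y) := by
  have h1 : X.eqRate α.ν x y = M.c x y * M.ruleFactor ((X.coord α).1 x) ((X.coord α).1 y) := by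
    unfold eqRate ModelClass.ruleFactor coord
    cases M.rule <;> rfl
  rw [rate, h1, mul_comm]
  by_cases hc : M.c x y = 0
  · simp [hc]
  · simp [coord, h, hc]

lemma psi_eq (α : Param d m) {x y : S} (h : x ≠ y) (hc : M.c x y ≠ 0) :
    X.ψ α x y = α.ε * ((X.coord α).2 x y - (X.coord α).2 y x) := by
  have hc' : M.c y x ≠ 0 := by rwa [← M.c_symm x y h]
  have h1 : X.rate α x y / X.rate α y x = Real.exp (M.β * (X.H α.ν x - X.H α.ν y) +
      α.ε * ((X.coord α).2 x y - (X.coord α).2 y x)) := by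
    rw [X.rate_eq α h, X.rate_eq α h.symm, M.ruleFactor_eq, M.ruleFactor_eq, M.c_symm x y h,
      M.symFactor_comm ((X.coord α).1 x)]
    have hs := (M.symFactor_pos ((X.coord α).1 y) ((X.coord α).1 x)).ne'
    have e1 := (Real.exp_pos (M.β / 2 * ((X.coord α).1 y - (X.coord α).1 x))).ne'
    have e2 := (Real.exp_pos (α.ε * (X.coord α).2 y x)).ne'
    rw [div_eq_iff (by positivity)]
    have e3 : Real.exp (M.β / 2 * ((X.coord α).1 x - (X.coord α).1 y)) *
        Real.exp (α.ε * (X.coord α).2 x y) =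
        Real.exp (M.β * (X.H α.ν x - X.H α.ν y) +
          α.ε * ((X.coord α).2 x y - (X.coord α).2 y x)) *
        (Real.exp (M.β / 2 * ((X.coord α).1 y - (X.coord α).1 x)) *
          Real.exp (α.ε * (X.coord α).2 y x)) := by
      rw [← Real.exp_add, ← Real.exp_add, ← Real.exp_add]
      congr 1
      simp only [coord]
      ring
    calc _ = M.c y x * M.symFactor ((X.coord α).1 y) ((X.coord α).1 x) *
          (Real.exp (M.β / 2 * ((X.coord α).1 x - (X.coord α).1 y)) *
            Real.exp (α.ε * (X.coord α).2 x y)) := by ring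
      _ = _ := by rw [e3]; ring
  rw [ψ, θ, h1, Real.log_exp]
  ring

variable [Fintype S] [DecidableEq S]

lemma escapeRate_eq (α : Param d m) (x : S) :
    X.escapeRate α x = M.escape α.ε (X.coord α) x :=
  Finset.sum_congr rfl fun _ hy => X.rate_eq α (Finset.ne_of_mem_erase hy).symm

/-- The tilted rates, in terms of the matrix `hat`. -/
lemma rate_mul_exp_psi (α : Param d m) {x y : S} (h : x ≠ y) (u : ℝ) :
    X.rate α x y * Real.exp (u * X.ψ α x y) =
      M.hat α.ε (X.coord α) (α.ε * (u + 1 / 2)) y x *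
        Real.exp (M.β / 2 * (X.H α.ν x - X.H α.ν y)) := by
  rw [X.rate_eq α h, M.ruleFactor_eq]
  simp only [ModelClass.hat, Matrix.of_apply, h, if_false]
  by_cases hc : M.c x y = 0
  · simp [hc]
  rw [X.psi_eq α h hc]
  have e : Real.exp (α.ε * (X.coord α).2 x y) *
      Real.exp (u * (α.ε * ((X.coord α).2 x y - (X.coord α).2 y x))) =
      Real.exp (α.ε * ((X.coord α).2 x y + (X.coord α).2 y x) / 2 +
        α.ε * (u + 1 / 2) * ((X.coord α).2 x y - (X.coord α).2 y x)) := by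
    rw [← Real.exp_add]; congr 1; ring
  rw [← e]
  simp only [coord]
  ring

omit [Fintype S] [DecidableEq S] in
/-- The entropy production is the nonequilibrium part plus the work minus the energy difference. -/
lemma Θ_eq (t₀ t₁ : ℝ) (a : ℝ → Param d m) (p : Path S) :
    X.Θ a p = (M.β * X.W t₀ t₁ a p + X.Ψ a p) -
      M.β * (X.H (a t₁).ν p.final - X.H (a t₀).ν p.initial) := by
  have h := Path.sum_times (fun x t => X.H (a t).ν x) t₀ t₁ p
  rw [W, h]
  simp only [Θ, Ψ, ψ, Finset.sum_sub_distrib, ← Finset.mul_sum]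
  ring

/-! ### Piecewise constant protocols -/

/-- `J` is a step function with values `0, …, N` on consecutive intervals of length `T`, the first
of which starts at `s`. The values at the interior jumps do not matter. -/
structure _root_.SST.IsStep (J : ℝ → ℕ) (s T : ℝ) (N : ℕ) : Prop where
  meas : Measurable J
  le : ∀ t, J t ≤ N
  left : J s = 0
  right : J (s + (N + 1) * T) = N
  mid : ∀ j ≤ N, ∀ t ∈ Set.Ioo (s + j * T) (s + (j + 1) * T), J t = j

lemma _root_.SST.IsStep.measurable_comp {J : ℝ → ℕ} {s T : ℝ} {N : ℕ} (hJ : IsStep J s T N)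
    (g : ℕ → ℝ) : Measurable fun t => g (J t) :=
  (Measurable.of_discrete (f := g)).comp hJ.meas

lemma _root_.SST.IsStep.intervalIntegrable {J : ℝ → ℕ} {s T : ℝ} {N : ℕ} (hJ : IsStep J s T N)
    (g : ℕ → ℝ) (t₀ t₁ : ℝ) : IntervalIntegrable (fun t => g (J t)) volume t₀ t₁ := by
  refine intervalIntegrable_const (c := ∑ j ∈ Finset.range (N + 1), |g j|) |>.mono_fun'
    (hJ.measurable_comp g).aestronglyMeasurable (Eventually.of_forall fun t => ?_)
  exact Finset.single_le_sum (f := fun j => |g j|) (fun _ _ => abs_nonneg _)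
    (Finset.mem_range.2 (Nat.lt_succ_of_le (hJ.le t)))

lemma _root_.SST.IsStep.integral_eq {J : ℝ → ℕ} {s T : ℝ} {N : ℕ} (hJ : IsStep J s T N)
    (g : ℕ → ℝ) {j : ℕ} (hj : j ≤ N) {t : ℝ} (ht : t ∈ Set.Icc (s + j * T) (s + (j + 1) * T)) :
    ∫ r in (s + j * T)..t, g (J r) = (t - (s + j * T)) * g j := by
  rw [intervalIntegral.integral_of_le ht.1, ← setIntegral_congr_set Ioo_ae_eq_Ioc,
    setIntegral_congr_fun (g := fun _ => g j) measurableSet_Ioo fun r hr => by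
      simp only [hJ.mid j hj r ⟨hr.1, hr.2.trans_le ht.2⟩], setIntegral_congr_set Ioo_ae_eq_Ioc,
    ← intervalIntegral.integral_of_le ht.1, intervalIntegral.integral_const, smul_eq_mul]

/-- The vectors obtained by applying alternately the matrices `A j` and the diagonal matrices with
entries `D j`. -/
def _root_.SST.propagate {R : Type*} [NonUnitalNonAssocSemiring R] (A : ℕ → Matrix S S R)
    (D : ℕ → S → R) (v : S → R) : ℕ → S → R
  | 0 => A 0 *ᵥ v
  | j + 1 => A (j + 1) *ᵥ fun x => D j x * propagate A D v j x

open NormedSpace (exp)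

variable (γ : ℕ → Param d m)

/-- The generating function of `β W + Ψ` restricted to the final states, in terms of `p = u + 1/2`:
the state weights after the `j`-th step of the protocol, conjugated by `exp (β H / 2)`. -/
noncomputable def evolve (T : ℝ) (q : S → ℝ) (p : ℝ) : ℕ → S → ℝ :=
  propagate (fun j => exp (T • M.hat (γ j).ε (X.coord (γ j)) ((γ j).ε * p)))
    (fun j x => Real.exp (p * M.β * (X.H (γ (j + 1)).ν x - X.H (γ j).ν x)))
    (fun x => Real.exp (M.β / 2 * X.H (γ 0).ν x) * q x)

lemma evolve_nonneg {T : ℝ} (hT : 0 ≤ T) {q : S → ℝ} (hq : ∀ x, 0 ≤ q x) (p : ℝ) (j : ℕ) (y : S) :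
    0 ≤ X.evolve γ T q p j y := by
  induction j generalizing y with
  | zero =>
    exact (M.hat_isMetzler _ _ _).exp_smul_mulVec_nonneg hT
      (fun x => mul_nonneg (Real.exp_pos _).le (hq x)) y
  | succ j ih =>
    exact (M.hat_isMetzler _ _ _).exp_smul_mulVec_nonneg hT
      (fun x => mul_nonneg (Real.exp_pos _).le (ih x)) y

/-- The phase of the interaction picture, in which the escape rates and the work are removed. -/
noncomputable def phase (J : ℝ → ℕ) (s u : ℝ) (x : S) (t : ℝ) : ℝ :=
  -(∫ r in s..t, X.escapeRate (γ (J r)) x) + (u + 1 / 2) * M.β * X.H (γ (J t)).ν x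

/-- The weight of a jump in the interaction picture. -/
noncomputable def jumpWeight (J : ℝ → ℕ) (s u : ℝ) (t : ℝ) (x y : S) : ℝ :=
  M.hat (γ (J t)).ε (X.coord (γ (J t))) ((γ (J t)).ε * (u + 1 / 2)) y x *
    Real.exp (X.phase γ J s u x t - X.phase γ J s u y t)

variable {γ} {J : ℝ → ℕ} {s T : ℝ} {N : ℕ}

/-- The escape factors and the work telescope along the path to differences of `phase`. -/
lemma weight_mul_exp_W (hJ : IsStep J s T N) (b u : ℝ) (p : Path S) :
    X.weight s b (fun t => γ (J t)) p * Real.exp (u * (M.β * X.W s b (fun t => γ (J t)) p)) =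
      (∏ j : Fin p.1, X.rate (γ (J (p.2.2 j))) (p.2.1 j.castSucc) (p.2.1 j.succ)) *
      Real.exp ((X.phase γ J s u p.final b - M.β / 2 * X.H (γ (J b)).ν p.final) -
        (X.phase γ J s u p.initial s - M.β / 2 * X.H (γ (J s)).ν p.initial) +
        ∑ j : Fin p.1, ((X.phase γ J s u (p.2.1 j.castSucc) (p.2.2 j) -
            M.β / 2 * X.H (γ (J (p.2.2 j))).ν (p.2.1 j.castSucc)) -
          (X.phase γ J s u (p.2.1 j.succ) (p.2.2 j) -
            M.β / 2 * X.H (γ (J (p.2.2 j))).ν (p.2.1 j.succ)))) := by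
  have hint : ∀ (x : S) (t₀ t₁ : ℝ),
      IntervalIntegrable (fun r => X.escapeRate (γ (J r)) x) volume t₀ t₁ := fun x t₀ t₁ =>
    hJ.intervalIntegrable (fun j => X.escapeRate (γ j) x) t₀ t₁
  have h := Path.sum_times
    (fun x t => X.phase γ J s u x t - M.β / 2 * X.H (γ (J t)).ν x) s b p
  rw [← h, weight, mul_assoc, ← Real.exp_sum, ← Real.exp_add, W, Finset.mul_sum, Finset.mul_sum,
    ← Finset.sum_add_distrib]
  congr 2
  refine Finset.sum_congr rfl fun j _ => ?_
  rw [← intervalIntegral.integral_interval_sub_left (hint _ s _) (hint _ s _)]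
  simp only [phase]
  ring

/-- The weight of a path, tilted by `β W + Ψ`, in the interaction picture. -/
lemma weight_mul_exp (hJ : IsStep J s T N) (b u : ℝ) (n : ℕ) (x : Fin (n + 1) → S)
    (t : Fin n → ℝ) (hx : ∀ j : Fin n, x j.castSucc ≠ x j.succ) :
    X.weight s b (fun t => γ (J t)) ⟨n, (x, t)⟩ *
      Real.exp (u * (M.β * X.W s b (fun t => γ (J t)) ⟨n, (x, t)⟩ +
        X.Ψ (fun t => γ (J t)) ⟨n, (x, t)⟩)) =
      Real.exp (-(X.phase γ J s u (x 0) s - M.β / 2 * X.H (γ (J s)).ν (x 0))) *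
        (∏ j : Fin n, X.jumpWeight γ J s u (t j) (x j.castSucc) (x j.succ)) *
        Real.exp (X.phase γ J s u (x (Fin.last n)) b -
          M.β / 2 * X.H (γ (J b)).ν (x (Fin.last n))) := by
  rw [mul_add, Real.exp_add, ← mul_assoc, X.weight_mul_exp_W hJ]
  have h1 : Real.exp (u * X.Ψ (fun t => γ (J t)) ⟨n, (x, t)⟩) =
      ∏ j : Fin n, Real.exp (u * X.ψ (γ (J (t j))) (x j.castSucc) (x j.succ)) := by
    rw [Ψ, Finset.mul_sum, Real.exp_sum]
  rw [h1, Real.exp_add, Real.exp_sum, sub_eq_add_neg (X.phase γ J s u (Path.final _) b - _),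
    Real.exp_add]
  have h2 : (∏ j : Fin n, X.jumpWeight γ J s u (t j) (x j.castSucc) (x j.succ)) =
      (∏ j : Fin n, X.rate (γ (J (t j))) (x j.castSucc) (x j.succ)) *
      (∏ j : Fin n, Real.exp (u * X.ψ (γ (J (t j))) (x j.castSucc) (x j.succ))) *
      ∏ j : Fin n, Real.exp ((X.phase γ J s u (x j.castSucc) (t j) -
            M.β / 2 * X.H (γ (J (t j))).ν (x j.castSucc)) -
          (X.phase γ J s u (x j.succ) (t j) -
            M.β / 2 * X.H (γ (J (t j))).ν (x j.succ))) := by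
    rw [← Finset.prod_mul_distrib, ← Finset.prod_mul_distrib]
    refine Finset.prod_congr rfl fun j _ => ?_
    rw [X.rate_mul_exp_psi _ (hx j), mul_assoc, ← Real.exp_add, jumpWeight]
    congr 2
    ring
  rw [h2]
  simp only [Path.final, Path.initial]
  ring

variable [MeasurableSpace S] [DiscreteMeasurableSpace S]

omit [DecidableEq S] in
lemma _root_.SST.measurable_sum_jumps {g : ℝ → S → S → ℝ} (hg : ∀ x y, Measurable fun t => g t x y) :
    Measurable fun p : Path S =>
      ∑ j : Fin p.1, g (p.2.2 j) (p.2.1 j.castSucc) (p.2.1 j.succ) := by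
  refine measurable_path fun n x => ?_
  change Measurable fun t : Fin n → ℝ => ∑ j : Fin n, g (t j) (x j.castSucc) (x j.succ)
  exact Finset.measurable_sum _ fun j _ => (hg _ _).comp (measurable_pi_apply j)

omit [DecidableEq S] in
lemma _root_.SST.measurable_prod_jumps {g : ℝ → S → S → ℝ}
    (hg : ∀ x y, Measurable fun t => g t x y) :
    Measurable fun p : Path S =>
      ∏ j : Fin p.1, g (p.2.2 j) (p.2.1 j.castSucc) (p.2.1 j.succ) := by
  refine measurable_path fun n x => ?_
  change Measurable fun t : Fin n → ℝ => ∏ j : Fin n, g (t j) (x j.castSucc) (x j.succ)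
  exact Finset.measurable_prod _ fun j _ => (hg _ _).comp (measurable_pi_apply j)

omit [DecidableEq S] in
lemma measurable_final : Measurable (Path.final : Path S → S) :=
  measurable_path fun n x =>
    (measurable_const : Measurable fun _ : Fin n → ℝ => x (Fin.last n))

omit [DecidableEq S] in
lemma measurable_initial : Measurable (Path.initial : Path S → S) :=
  measurable_path fun n x => (measurable_const : Measurable fun _ : Fin n → ℝ => x 0)

omit [DecidableEq S] in
lemma measurable_W (hJ : IsStep J s T N) (t₀ t₁ : ℝ) :
    Measurable (X.W t₀ t₁ fun t => γ (J t)) := by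
  have h : X.W t₀ t₁ (fun t => γ (J t)) = fun p =>
      X.H (γ (J t₁)).ν p.final - X.H (γ (J t₀)).ν p.initial +
        ∑ j : Fin p.1, (X.H (γ (J (p.2.2 j))).ν (p.2.1 j.castSucc) -
          X.H (γ (J (p.2.2 j))).ν (p.2.1 j.succ)) :=
    funext fun p => Path.sum_times (fun x t => X.H (γ (J t)).ν x) t₀ t₁ p
  rw [h]
  refine Measurable.add (Measurable.sub ?_ ?_) ?_
  · exact (Measurable.of_discrete (f := fun x => X.H (γ (J t₁)).ν x)).comp measurable_final
  · exact (Measurable.of_discrete (f := fun x => X.H (γ (J t₀)).ν x)).comp measurable_initial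
  · exact measurable_sum_jumps (g := fun t x y => X.H (γ (J t)).ν x - X.H (γ (J t)).ν y)
      fun x y => hJ.measurable_comp fun i => X.H (γ i).ν x - X.H (γ i).ν y

omit [DecidableEq S] in
lemma measurable_Ψ (hJ : IsStep J s T N) : Measurable (X.Ψ fun t => γ (J t)) :=
  measurable_sum_jumps (g := fun t x y => X.ψ (γ (J t)) x y)
    fun x y => hJ.measurable_comp fun i => X.ψ (γ i) x y

lemma measurable_weight (hJ : IsStep J s T N) (b : ℝ) :
    Measurable (X.weight s b fun t => γ (J t)) := by
  have hprim : ∀ x : S, Measurable fun t => ∫ r in s..t, X.escapeRate (γ (J r)) x := fun x =>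
    (intervalIntegral.continuous_primitive
      (fun t₀ t₁ => hJ.intervalIntegrable (fun j => X.escapeRate (γ j) x) t₀ t₁) s).measurable
  have hph : ∀ x : S, Measurable fun t =>
      X.phase γ J s 0 x t - M.β / 2 * X.H (γ (J t)).ν x := fun x =>
    ((hprim x).neg.add ((hJ.measurable_comp fun j => X.H (γ j).ν x).const_mul _)).sub
      ((hJ.measurable_comp fun j => X.H (γ j).ν x).const_mul _)
  have h := fun p => X.weight_mul_exp_W (γ := γ) hJ b 0 p
  simp only [zero_mul, Real.exp_zero, mul_one] at h
  rw [show X.weight s b (fun t => γ (J t)) = _ from funext h]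
  refine Measurable.mul ?_ (Real.measurable_exp.comp (Measurable.add (Measurable.sub ?_ ?_) ?_))
  · exact measurable_prod_jumps (g := fun t x y => X.rate (γ (J t)) x y)
      fun x y => hJ.measurable_comp fun i => X.rate (γ i) x y
  · exact (Measurable.of_discrete (f := fun x => X.phase γ J s 0 x b -
      M.β / 2 * X.H (γ (J b)).ν x)).comp measurable_final
  · exact (Measurable.of_discrete (f := fun x => X.phase γ J s 0 x s -
      M.β / 2 * X.H (γ (J s)).ν x)).comp measurable_initial
  · exact measurable_sum_jumps (g := fun t x y =>
      (X.phase γ J s 0 x t - M.β / 2 * X.H (γ (J t)).ν x) -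
        (X.phase γ J s 0 y t - M.β / 2 * X.H (γ (J t)).ν y)) fun x y => (hph x).sub (hph y)

/-! ### The Feynman–Kac formula -/

omit [MeasurableSpace S] [DiscreteMeasurableSpace S] in
lemma measurable_phase (hJ : IsStep J s T N) (u : ℝ) (x : S) :
    Measurable (X.phase γ J s u x) :=
  (intervalIntegral.continuous_primitive
    (fun t₀ t₁ => hJ.intervalIntegrable (fun j => X.escapeRate (γ j) x) t₀ t₁) s).measurable.neg.add
    ((hJ.measurable_comp fun j => X.H (γ j).ν x).const_mul _)

omit [MeasurableSpace S] [DiscreteMeasurableSpace S] in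
lemma measurable_jumpWeight (hJ : IsStep J s T N) (u : ℝ) (x y : S) :
    Measurable fun t => X.jumpWeight γ J s u t x y :=
  (hJ.measurable_comp fun j => M.hat (γ j).ε (X.coord (γ j)) ((γ j).ε * (u + 1 / 2)) y x).mul
    (Real.measurable_exp.comp ((X.measurable_phase hJ u x).sub (X.measurable_phase hJ u y)))

omit [MeasurableSpace S] [DiscreteMeasurableSpace S] in
lemma exists_jumpWeight_le (hJ : IsStep J s T N) (b u : ℝ) :
    ∃ B : ℝ≥0, ∀ t ∈ Set.Icc s b, ∀ x y, ENNReal.ofReal (X.jumpWeight γ J s u t x y) ≤ B := by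
  have hprim : ∀ x : S, Continuous fun t => ∫ r in s..t, X.escapeRate (γ (J r)) x := fun x =>
    intervalIntegral.continuous_primitive
      (fun t₀ t₁ => hJ.intervalIntegrable (fun j => X.escapeRate (γ j) x) t₀ t₁) s
  set k : ℕ → S → S → ℝ → ℝ := fun j x y t =>
    M.hat (γ j).ε (X.coord (γ j)) ((γ j).ε * (u + 1 / 2)) y x *
    Real.exp ((-(∫ r in s..t, X.escapeRate (γ (J r)) x) + (u + 1 / 2) * M.β * X.H (γ j).ν x) -
      (-(∫ r in s..t, X.escapeRate (γ (J r)) y) + (u + 1 / 2) * M.β * X.H (γ j).ν y)) with hk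
  have hkc : ∀ j x y, ∃ C : ℝ, ∀ t ∈ Set.Icc s b, ‖k j x y t‖ ≤ C := fun j x y => by
    refine isCompact_Icc.exists_bound_of_continuousOn (Continuous.continuousOn ?_)
    have := hprim x
    have := hprim y
    fun_prop
  choose C hC using hkc
  refine ⟨(∑ j ∈ Finset.range (N + 1), ∑ x, ∑ y, |C j x y|).toNNReal, fun t ht x y =>
    ENNReal.ofReal_le_ofReal ?_⟩
  have h1 : X.jumpWeight γ J s u t x y ≤ |C (J t) x y| :=
    (le_abs_self _).trans ((hC (J t) x y t ht).trans (le_abs_self _))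
  refine h1.trans ?_
  calc |C (J t) x y| ≤ ∑ y, |C (J t) x y| :=
        Finset.single_le_sum (f := fun y => |C (J t) x y|) (fun _ _ => abs_nonneg _)
          (Finset.mem_univ y)
    _ ≤ ∑ x, ∑ y, |C (J t) x y| :=
        Finset.single_le_sum (f := fun x => ∑ y, |C (J t) x y|)
          (fun _ _ => Finset.sum_nonneg fun _ _ => abs_nonneg _) (Finset.mem_univ x)
    _ ≤ _ := Finset.single_le_sum (f := fun j => ∑ x, ∑ y, |C j x y|)
          (fun _ _ => Finset.sum_nonneg fun _ _ => Finset.sum_nonneg fun _ _ => abs_nonneg _)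
          (Finset.mem_range.2 (Nat.lt_succ_of_le (hJ.le t)))

omit [MeasurableSpace S] [DiscreteMeasurableSpace S] in
/-- On each step the forward equation is solved by the exponential of `hat`. -/
lemma exists_isSolution (hJ : IsStep J s T N) (hT : 0 ≤ T) {q : S → ℝ} (hq : ∀ x, 0 ≤ q x) (u : ℝ)
    {j : ℕ} (hj : j ≤ N) :
    ∃ U, IsSolution (offDiag fun t x y => ENNReal.ofReal (X.jumpWeight γ J s u t x y))
      (fun x => ENNReal.ofReal
        (q x * Real.exp (-(X.phase γ J s u x s - M.β / 2 * X.H (γ (J s)).ν x))))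
      s (s + (j + 1) * T) U ∧
      ∀ y, U (s + (j + 1) * T) y = ENNReal.ofReal
        (Real.exp (-(-(∫ r in s..(s + (j + 1) * T), X.escapeRate (γ (J r)) y) +
          (u + 1 / 2) * M.β * X.H (γ j).ν y)) * X.evolve γ T q (u + 1 / 2) j y) := by
  have hdiag : ∀ (j : ℕ) (v : ℝ) (y : S),
      M.hat (γ j).ε (X.coord (γ j)) v y y = -X.escapeRate (γ j) y := by
    intro j v y
    simp [ModelClass.hat, X.escapeRate_eq]
  have hint : ∀ (x : S) (t₀ t₁ : ℝ),
      IntervalIntegrable (fun r => X.escapeRate (γ (J r)) x) volume t₀ t₁ := fun x t₀ t₁ =>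
    hJ.intervalIntegrable (fun j => X.escapeRate (γ j) x) t₀ t₁
  -- the phase is affine on each step
  have hphase : ∀ j ≤ N, ∀ t ∈ Set.Icc (s + j * T) (s + (j + 1) * T), ∀ x,
      -(∫ r in s..t, X.escapeRate (γ (J r)) x) + (u + 1 / 2) * M.β * X.H (γ j).ν x =
      (-(∫ r in s..(s + j * T), X.escapeRate (γ (J r)) x) +
        (u + 1 / 2) * M.β * X.H (γ j).ν x) + (t - (s + j * T)) *
        M.hat (γ j).ε (X.coord (γ j)) ((γ j).ε * (u + 1 / 2)) x x := by
    intro j hj t ht x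
    have h1 := hJ.integral_eq (fun j => X.escapeRate (γ j) x) hj ht
    rw [← intervalIntegral.integral_add_adjacent_intervals (hint x s (s + j * T)) (hint x _ t), h1,
      hdiag]
    ring
  have hmain : ∀ j ≤ N, ∀ v : S → ℝ, (∀ x, 0 ≤ v x) →
      ∃ U, IsSolution (offDiag fun t x y => ENNReal.ofReal (X.jumpWeight γ J s u t x y))
      (fun x => ENNReal.ofReal (Real.exp (-(-(∫ r in s..(s + j * T), X.escapeRate (γ (J r)) x) +
          (u + 1 / 2) * M.β * X.H (γ j).ν x)) * v x)) (s + j * T) (s + (j + 1) * T) U ∧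
      ∀ y, U (s + (j + 1) * T) y = ENNReal.ofReal
        (Real.exp (-(-(∫ r in s..(s + (j + 1) * T), X.escapeRate (γ (J r)) y) +
          (u + 1 / 2) * M.β * X.H (γ j).ν y)) *
          (exp (T • M.hat (γ j).ε (X.coord (γ j)) ((γ j).ε * (u + 1 / 2))) *ᵥ v) y) := by
    intro j hj v hv
    have hend : s + (j + 1) * T = s + j * T + T := by ring
    have h := (M.hat_isMetzler (γ j).ε (X.coord (γ j)) ((γ j).ε * (u + 1 / 2))).isSolution
      (s := s + j * T) (T := T) hv
      (fun x => -(∫ r in s..(s + j * T), X.escapeRate (γ (J r)) x) +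
          (u + 1 / 2) * M.β * X.H (γ j).ν x)
      (K := fun t x y => ENNReal.ofReal (X.jumpWeight γ J s u t x y)) (fun t ht x y _ => by
        rw [← hend] at ht
        simp only [jumpWeight, phase, hJ.mid j hj t ht]
        rw [hphase j hj t ⟨ht.1.le, ht.2.le⟩, hphase j hj t ⟨ht.1.le, ht.2.le⟩])
    rw [← hend] at h
    refine ⟨_, h, fun y => ?_⟩
    have hTe : s + (j + 1) * T - (s + j * T) = T := by ring
    have hle : s + j * T ≤ s + (j + 1) * T := by linarith
    rw [← hphase j hj _ ⟨hle, le_rfl⟩, hTe]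
  induction j with
  | zero =>
    obtain ⟨U, hU, hU'⟩ := hmain 0 hj (fun x => Real.exp (M.β / 2 * X.H (γ 0).ν x) * q x)
      (fun x => mul_nonneg (Real.exp_pos _).le (hq x))
    simp only [Nat.cast_zero, zero_mul, add_zero, intervalIntegral.integral_same] at hU hU'
    refine ⟨U, ?_, by simp only [Nat.cast_zero]; exact hU'⟩
    have hinit : (fun x => ENNReal.ofReal
        (q x * Real.exp (-(X.phase γ J s u x s - M.β / 2 * X.H (γ (J s)).ν x)))) =
        fun x => ENNReal.ofReal (Real.exp (-(-0 + (u + 1 / 2) * M.β * X.H (γ 0).ν x)) *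
          (Real.exp (M.β / 2 * X.H (γ 0).ν x) * q x)) := by
      ext x
      rw [← mul_assoc, ← Real.exp_add, mul_comm]
      congr 3
      simp only [phase, intervalIntegral.integral_same, hJ.left]
      ring
    rw [hinit]
    simpa using hU
  | succ j ih =>
    obtain ⟨U, hU, hUe⟩ := ih (by omega)
    obtain ⟨U', hU', hUe'⟩ := hmain (j + 1) hj
      (fun x => Real.exp ((u + 1 / 2) * M.β * (X.H (γ (j + 1)).ν x - X.H (γ j).ν x)) *
        X.evolve γ T q (u + 1 / 2) j x)
      (fun x => mul_nonneg (Real.exp_pos _).le (X.evolve_nonneg γ hT hq _ _ x))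
    have hj1 : (0 : ℝ) ≤ (j + 1) * T := by positivity
    have hglue : (fun x => ENNReal.ofReal
        (Real.exp (-(-(∫ r in s..(s + (j + 1 : ℕ) * T), X.escapeRate (γ (J r)) x) +
          (u + 1 / 2) * M.β * X.H (γ (j + 1)).ν x)) *
        (Real.exp ((u + 1 / 2) * M.β * (X.H (γ (j + 1)).ν x - X.H (γ j).ν x)) *
          X.evolve γ T q (u + 1 / 2) j x))) = U (s + (j + 1) * T) := by
      ext x
      rw [hUe, ← mul_assoc, ← Real.exp_add]
      push_cast
      congr 3
      ring
    rw [hglue] at hU'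
    push_cast at hU' hUe' ⊢
    refine ⟨_, hU.trans hU' (by linarith), fun y => ?_⟩
    by_cases hT0 : T = 0
    · subst hT0
      have hb := hU'.left (by simp) y
      simp only [mul_zero, add_zero, le_refl, if_true] at hb hUe' ⊢
      rw [← hb, hUe' y]
      rfl
    · have hT' : 0 < T := lt_of_le_of_ne hT (Ne.symm hT0)
      rw [if_neg (by nlinarith), hUe' y]
      rfl

/-- The Feynman–Kac formula for a piecewise constant protocol. -/
theorem lintegral_pathLaw (hJ : IsStep J s T N) (hT : 0 ≤ T) {q f : S → ℝ}
    (hq : ∀ x, 0 ≤ q x) (hf : ∀ x, 0 ≤ f x) (u : ℝ) :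
    ∫⁻ p, ENNReal.ofReal (Real.exp (u * (M.β * X.W s (s + (N + 1) * T) (fun t => γ (J t)) p +
      X.Ψ (fun t => γ (J t)) p)) * f p.final)
      ∂X.pathLaw s (s + (N + 1) * T) (fun t => γ (J t)) q =
    ENNReal.ofReal (∑ y, f y * Real.exp (-(M.β / 2 * X.H (γ N).ν y)) *
      X.evolve γ T q (u + 1 / 2) N y) := by
  set b := s + (N + 1) * T with hb
  have hsb : s ≤ b := by rw [hb]; have : 0 ≤ (N + 1) * T := by positivity
                         linarith
  have hmq : Measurable fun p : Path S => q p.initial :=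
    (Measurable.of_discrete (f := q)).comp measurable_initial
  have hmf : Measurable fun p : Path S => f p.final :=
    (Measurable.of_discrete (f := f)).comp measurable_final
  have hm1 : Measurable fun p : Path S =>
      ENNReal.ofReal (q p.initial * X.weight s b (fun t => γ (J t)) p) :=
    ENNReal.measurable_ofReal.comp (hmq.mul (X.measurable_weight hJ b))
  have hm2 : Measurable fun p : Path S => ENNReal.ofReal
      (Real.exp (u * (M.β * X.W s b (fun t => γ (J t)) p + X.Ψ (fun t => γ (J t)) p)) *
        f p.final) :=
    ENNReal.measurable_ofReal.comp ((Real.measurable_exp.comp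
      ((((X.measurable_W hJ s b).const_mul _).add (X.measurable_Ψ hJ)).const_mul u)).mul hmf)
  rw [pathLaw, lintegral_withDensity_eq_lintegral_mul _ hm1 hm2]
  have hk0 : ∀ t x y, x ≠ y → 0 ≤ X.jumpWeight γ J s u t x y := fun t x y h =>
    mul_nonneg ((M.hat_isMetzler _ _ _).nonneg y x h.symm) (Real.exp_pos _).le
  have hmk : ∀ x y, Measurable fun t => ENNReal.ofReal (X.jumpWeight γ J s u t x y) := fun x y =>
    ENNReal.measurable_ofReal.comp (X.measurable_jumpWeight hJ u x y)
  rw [lintegral_base_eq hmk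
    (fun x => ENNReal.ofReal
      (q x * Real.exp (-(X.phase γ J s u x s - M.β / 2 * X.H (γ (J s)).ν x))))
    (fun y => ENNReal.ofReal
      (f y * Real.exp (X.phase γ J s u y b - M.β / 2 * X.H (γ (J b)).ν y))) s b ?_ (hm1.mul hm2)]
  · obtain ⟨U, hU, hUe⟩ := X.exists_isSolution (γ := γ) hJ hT hq u le_rfl
    obtain ⟨B, hB⟩ := X.exists_jumpWeight_le (γ := γ) hJ b u
    rw [← hb] at hU hUe
    have hB' : ∀ t ∈ Set.Icc s b, ∀ x y,
        offDiag (fun t x y => ENNReal.ofReal (X.jumpWeight γ J s u t x y)) t x y ≤ B := by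
      intro t ht x y
      unfold offDiag
      split_ifs
      · exact zero_le
      · exact hB t ht x y
    have hmk' : ∀ x y, Measurable fun t =>
        offDiag (fun t x y => ENNReal.ofReal (X.jumpWeight γ J s u t x y)) t x y := by
      intro x y
      unfold offDiag
      split_ifs
      · exact measurable_const
      · exact hmk x y
    simp only [hU.tsum_dyson hmk' B hB' ⟨hsb, le_rfl⟩, hUe]
    rw [ENNReal.ofReal_sum_of_nonneg fun y _ => mul_nonneg (mul_nonneg (hf y) (Real.exp_pos _).le)
      (X.evolve_nonneg γ hT hq _ _ y)]
    refine Finset.sum_congr rfl fun y _ => ?_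
    rw [← ENNReal.ofReal_mul (mul_nonneg (hf y) (Real.exp_pos _).le)]
    have he : Real.exp (-(M.β / 2 * X.H (γ N).ν y)) =
        Real.exp (X.phase γ J s u y b - M.β / 2 * X.H (γ (J b)).ν y) *
        Real.exp (-(-(∫ r in s..b, X.escapeRate (γ (J r)) y) +
          (u + 1 / 2) * M.β * X.H (γ N).ν y)) := by
      rw [← Real.exp_add]
      congr 1
      simp only [phase, hb, hJ.right]
      ring
    rw [he]
    congr 1
    ring
  · intro n x t hx
    have h := X.weight_mul_exp (γ := γ) hJ b u n x t hx
    have hP : 0 ≤ ∏ j : Fin n, X.jumpWeight γ J s u (t j) (x j.castSucc) (x j.succ) :=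
      Finset.prod_nonneg fun j _ => hk0 _ _ _ (hx j)
    have hw : 0 ≤ X.weight s b (fun t => γ (J t)) ⟨n, (x, t)⟩ := by
      refine mul_nonneg (Finset.prod_nonneg fun j _ => ?_)
        (Finset.prod_nonneg fun j _ => (Real.exp_pos _).le)
      rw [X.rate_eq _ (hx j)]
      exact mul_nonneg (mul_nonneg (M.c_nonneg _ _ (hx j)) (M.ruleFactor_pos _ _).le)
        (Real.exp_pos _).le
    rw [Pi.mul_apply, ← ENNReal.ofReal_mul (mul_nonneg (hq _) hw),
      ← ENNReal.ofReal_prod_of_nonneg fun j _ => hk0 _ _ _ (hx j),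
      ← ENNReal.ofReal_mul (mul_nonneg (hq _) (Real.exp_pos _).le),
      ← ENNReal.ofReal_mul (mul_nonneg (mul_nonneg (hq _) (Real.exp_pos _).le) hP)]
    congr 1
    calc _ = q (x 0) * (X.weight s b (fun t => γ (J t)) ⟨n, (x, t)⟩ *
          Real.exp (u * (M.β * X.W s b (fun t => γ (J t)) ⟨n, (x, t)⟩ +
          X.Ψ (fun t => γ (J t)) ⟨n, (x, t)⟩))) * f (x (Fin.last n)) := by
          simp only [Path.initial, Path.final]; ring
      _ = _ := by rw [h]; ring

/-- The generating function of `β W + Ψ` on the paths with a given final state. -/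
theorem integral_pathLaw (hJ : IsStep J s T N) (hT : 0 ≤ T) {q f : S → ℝ}
    (hq : ∀ x, 0 ≤ q x) (hf : ∀ x, 0 ≤ f x) (u : ℝ) :
    Integrable (fun p => Real.exp (u * (M.β * X.W s (s + (N + 1) * T) (fun t => γ (J t)) p +
      X.Ψ (fun t => γ (J t)) p)) * f p.final)
      (X.pathLaw s (s + (N + 1) * T) (fun t => γ (J t)) q) ∧
    ∫ p, Real.exp (u * (M.β * X.W s (s + (N + 1) * T) (fun t => γ (J t)) p +
      X.Ψ (fun t => γ (J t)) p)) * f p.final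
      ∂X.pathLaw s (s + (N + 1) * T) (fun t => γ (J t)) q =
    ∑ y, f y * Real.exp (-(M.β / 2 * X.H (γ N).ν y)) * X.evolve γ T q (u + 1 / 2) N y := by
  have h := X.lintegral_pathLaw (γ := γ) hJ hT hq hf u
  have hm : Measurable fun p : Path S =>
      Real.exp (u * (M.β * X.W s (s + (N + 1) * T) (fun t => γ (J t)) p +
        X.Ψ (fun t => γ (J t)) p)) * f p.final :=
    (Real.measurable_exp.comp ((((X.measurable_W hJ _ _).const_mul _).add
      (X.measurable_Ψ hJ)).const_mul u)).mul ((Measurable.of_discrete (f := f)).comp measurable_final)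
  have h0 : ∀ p : Path S, 0 ≤ Real.exp (u * (M.β * X.W s (s + (N + 1) * T) (fun t => γ (J t)) p +
        X.Ψ (fun t => γ (J t)) p)) * f p.final := fun p =>
    mul_nonneg (Real.exp_pos _).le (hf _)
  constructor
  · refine ⟨hm.aestronglyMeasurable, ?_⟩
    rw [hasFiniteIntegral_iff_ofReal (Eventually.of_forall h0), h]
    exact ENNReal.ofReal_lt_top
  · rw [integral_eq_lintegral_of_nonneg_ae (Eventually.of_forall h0) hm.aestronglyMeasurable, h,
      ENNReal.toReal_ofReal]
    exact Finset.sum_nonneg fun y _ => mul_nonneg (mul_nonneg (hf y) (Real.exp_pos _).le)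
      (X.evolve_nonneg γ hT hq _ _ y)

end Model
end SST

namespace SST

/-! ### Convergence of derivatives -/

section ComplexLimit

lemma tendstoLocallyUniformlyOn_of_joint {F : ℝ → ℂ → ℂ} {f : ℂ → ℂ} {U : Set ℂ}
    (h : ∀ p ∈ U, Tendsto (fun q : ℝ × ℂ => F q.1 q.2) (atTop ×ˢ 𝓝 p) (𝓝 (f p))) :
    TendstoLocallyUniformlyOn F f atTop U := by
  rw [Metric.tendstoLocallyUniformlyOn_iff]
  intro ε hε x hx
  have h1 := (h x hx).eventually (Metric.ball_mem_nhds (f x) (ε := ε / 3) (by positivity))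
  obtain ⟨a, ha, b, hb, hab⟩ := Filter.eventually_prod_iff.1 h1
  refine ⟨{y | b y} ∩ U, inter_mem (mem_nhdsWithin_of_mem_nhds hb) self_mem_nhdsWithin, ?_⟩
  filter_upwards [ha] with T hT y hy
  have h2 : dist (f y) (f x) ≤ ε / 3 := by
    have h3 : Tendsto (fun T => F T y) atTop (𝓝 (f y)) :=
      (h y hy.2).comp (tendsto_id.prodMk tendsto_const_nhds)
    refine le_of_tendsto (h3.dist tendsto_const_nhds) ?_
    filter_upwards [ha] with T' hT'
    exact (hab hT' hy.1).le
  have h4 : dist (F T y) (f x) < ε / 3 := hab hT hy.1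
  calc dist (f y) (F T y) ≤ dist (f y) (f x) + dist (F T y) (f x) := dist_triangle_right _ _ _
    _ < ε := by linarith

lemma TendstoLocallyUniformlyOn.iteratedDeriv {F : ℝ → ℂ → ℂ} {f : ℂ → ℂ} {U : Set ℂ}
    (h : TendstoLocallyUniformlyOn F f atTop U) (hF : ∀ᶠ T in atTop, DifferentiableOn ℂ (F T) U)
    (hU : IsOpen U) (k : ℕ) :
    TendstoLocallyUniformlyOn (fun T => iteratedDeriv k (F T)) (iteratedDeriv k f) atTop U ∧
      ∀ᶠ T in atTop, DifferentiableOn ℂ (iteratedDeriv k (F T)) U := by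
  induction k with
  | zero => simpa only [iteratedDeriv_zero] using ⟨h, hF⟩
  | succ k ih =>
    simp only [iteratedDeriv_succ]
    exact ⟨ih.1.deriv ih.2 hU, ih.2.mono fun T hT => hT.deriv hU⟩

/-- The derivatives of a function that is real on the real axis can be computed there. -/
lemma iteratedDeriv_ofReal_eq {F : ℂ → ℂ} {f : ℝ → ℝ} {x₀ : ℝ} (hF : AnalyticAt ℂ F x₀)
    (hf : ∀ᶠ x : ℝ in 𝓝 x₀, F x = f x) (k : ℕ) :
    ∀ᶠ x : ℝ in 𝓝 x₀, iteratedDeriv k F x = (iteratedDeriv k f x : ℝ) := by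
  induction k with
  | zero => simpa only [iteratedDeriv_zero] using hf
  | succ k ih =>
    have hF' : ∀ᶠ x : ℝ in 𝓝 x₀, AnalyticAt ℂ F x :=
      Complex.continuous_ofReal.continuousAt.eventually hF.eventually_analyticAt
    filter_upwards [ih.eventually_nhds, hF'] with x hx hxF
    have hd : HasDerivAt (iteratedDeriv k F) (iteratedDeriv (k + 1) F x) x := by
      rw [iteratedDeriv_succ, iteratedDeriv_eq_iterate]
      exact (hxF.iterated_deriv k).differentiableAt.hasDerivAt
    have h1 : HasDerivAt (iteratedDeriv k f) (iteratedDeriv (k + 1) F x).re x :=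
      hd.real_of_complex.congr_of_eventuallyEq (hx.mono fun y hy => by
      change _ = (iteratedDeriv k F y).re
      rw [hy, Complex.ofReal_re])
    have h2 : HasDerivAt (fun y : ℝ => iteratedDeriv k F y) (iteratedDeriv (k + 1) F x) x :=
      hd.comp_ofReal
    have h3 := h1.ofReal_comp.congr_of_eventuallyEq hx
    rw [h2.unique h3, iteratedDeriv_succ (f := f), h1.deriv]

/-- If the functions `exp (R T)` extend to a complex neighbourhood of `x₀`, where they converge
locally uniformly, then the derivatives of `R T` at `x₀` converge to those of the limit. -/
theorem tendsto_iteratedDeriv_of_joint {ρ : ℝ → ℂ → ℂ} {σ : ℂ → ℂ} {x₀ : ℝ} {R : ℝ → ℝ → ℝ}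
    {R' : ℝ → ℝ}
    (hconv : ∀ᶠ p in 𝓝 (x₀ : ℂ),
      Tendsto (fun q : ℝ × ℂ => ρ q.1 q.2) (atTop ×ˢ 𝓝 p) (𝓝 (σ p)))
    (hdiff : ∀ T p, ρ T p ≠ 0 → DifferentiableAt ℂ (ρ T) p)
    (hreal : ∀ T, 0 < T → ∀ x : ℝ, ρ T x = Real.exp (R T x))
    (hlim : ∀ x, Tendsto (fun T => R T x) atTop (𝓝 (R' x))) (k : ℕ) :
    Tendsto (fun T => iteratedDeriv k (R T) x₀) atTop (𝓝 (iteratedDeriv k R' x₀)) := by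
  have hσ : σ x₀ = Real.exp (R' x₀) := by
    have h1 : Tendsto (fun T => ρ T x₀) atTop (𝓝 (σ x₀)) :=
      hconv.self_of_nhds.comp (tendsto_id.prodMk tendsto_const_nhds)
    have h2 : Tendsto (fun T => ((Real.exp (R T x₀) : ℝ) : ℂ)) atTop (𝓝 (Real.exp (R' x₀) : ℝ)) :=
      (Complex.continuous_ofReal.tendsto _).comp ((Real.continuous_exp.tendsto _).comp (hlim x₀))
    refine tendsto_nhds_unique h1 (h2.congr' ?_)
    filter_upwards [eventually_gt_atTop 0] with T hT
    exact (hreal T hT x₀).symm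
  set c := Real.exp (R' x₀) with hc
  have hc0 : 0 < c := Real.exp_pos _
  -- near `x₀` the values stay in a half-plane on which the logarithm is holomorphic
  have hhalf : ∀ᶠ q : ℝ × ℂ in atTop ×ˢ 𝓝 (x₀ : ℂ), c / 2 < (ρ q.1 q.2).re := by
    have h1 := (Complex.continuous_re.tendsto _).comp hconv.self_of_nhds
    rw [hσ, Complex.ofReal_re] at h1
    exact h1.eventually (lt_mem_nhds (by linarith))
  obtain ⟨a, ha, b, hb, hab⟩ := Filter.eventually_prod_iff.1 hhalf
  obtain ⟨U, hUsub, hU, hxU⟩ := mem_nhds_iff.1 (hconv.and hb)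
  have hre : ∀ p ∈ U, c / 2 ≤ (σ p).re := by
    intro p hp
    have h1 : Tendsto (fun T => (ρ T p).re) atTop (𝓝 (σ p).re) :=
      (Complex.continuous_re.tendsto _).comp
        ((hUsub hp).1.comp (tendsto_id.prodMk tendsto_const_nhds))
    refine ge_of_tendsto h1 ?_
    filter_upwards [ha] with T hT
    exact (hab hT (hUsub hp).2).le
  have hslit : ∀ T, a T → ∀ p ∈ U, ρ T p ∈ Complex.slitPlane := fun T hT p hp =>
    Or.inl (lt_trans (by linarith) (hab hT (hUsub hp).2))
  have hloc : TendstoLocallyUniformlyOn (fun T p => Complex.log (ρ T p))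
      (fun p => Complex.log (σ p)) atTop U :=
    tendstoLocallyUniformlyOn_of_joint fun p hp =>
      (hUsub hp).1.clog (Or.inl (lt_of_lt_of_le (by linarith) (hre p hp)))
  have hdiffU : ∀ T, a T → DifferentiableOn ℂ (fun p => Complex.log (ρ T p)) U := fun T hT p hp =>
    ((hdiff T p (Complex.slitPlane_ne_zero (hslit T hT p hp))).clog
      (hslit T hT p hp)).differentiableWithinAt
  obtain ⟨hk, -⟩ := TendstoLocallyUniformlyOn.iteratedDeriv hloc (ha.mono hdiffU) hU k
  have hlim' : AnalyticAt ℂ (fun p => Complex.log (σ p)) x₀ :=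
    (hloc.differentiableOn (ha.mono hdiffU) hU).analyticAt (hU.mem_nhds hxU)
  have hlog : ∀ T, 0 < T → ∀ x : ℝ, Complex.log (ρ T x) = R T x := by
    intro T hT x
    rw [hreal T hT, ← Complex.ofReal_log (Real.exp_pos _).le, Real.log_exp]
  have hlogσ : ∀ᶠ x : ℝ in 𝓝 x₀, Complex.log (σ x) = R' x := by
    have : ∀ᶠ x : ℝ in 𝓝 x₀, (x : ℂ) ∈ U :=
      Complex.continuous_ofReal.continuousAt.eventually (hU.mem_nhds hxU)
    filter_upwards [this] with x hx
    have h1 : Tendsto (fun T => Complex.log (ρ T x)) atTop (𝓝 (Complex.log (σ x))) :=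
      hloc.tendsto_at hx
    have h2 : Tendsto (fun T => (R T x : ℂ)) atTop (𝓝 (R' x : ℂ)) :=
      (Complex.continuous_ofReal.tendsto _).comp (hlim x)
    refine tendsto_nhds_unique h1 (h2.congr' ?_)
    filter_upwards [eventually_gt_atTop 0] with T hT
    exact (hlog T hT x).symm
  have h1 := (iteratedDeriv_ofReal_eq hlim' hlogσ k).self_of_nhds
  have h2 : Tendsto (fun T => iteratedDeriv k (fun p => Complex.log (ρ T p)) x₀) atTop
      (𝓝 (iteratedDeriv k R' x₀ : ℝ)) := by
    rw [← h1]; exact hk.tendsto_at hxU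
  have h3 := (Complex.continuous_re.tendsto _).comp h2
  rw [Complex.ofReal_re] at h3
  refine h3.congr' ?_
  filter_upwards [ha, eventually_gt_atTop 0] with T hT hT0
  have h4 := (iteratedDeriv_ofReal_eq ((hdiffU T hT).analyticAt (hU.mem_nhds hxU))
    (Eventually.of_forall (hlog T hT0)) k).self_of_nhds
  simp only [Function.comp_apply, h4, Complex.ofReal_re]

end ComplexLimit

/-! ### Propagation through the steps of a protocol -/

section Propagate

open NormedSpace (exp)

variable {S : Type*} [Fintype S]

lemma tendsto_propagate {R ι : Type*} [NonUnitalNonAssocSemiring R] [TopologicalSpace R]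
    [ContinuousAdd R] [ContinuousMul R] {f : Filter ι} {A : ι → ℕ → Matrix S S R}
    {A' : ℕ → Matrix S S R} {D : ι → ℕ → S → R} {D' : ℕ → S → R} {v : S → R} {N : ℕ}
    (hA : ∀ j ≤ N, Tendsto (fun i => A i j) f (𝓝 (A' j)))
    (hD : ∀ j < N, ∀ x, Tendsto (fun i => D i j x) f (𝓝 (D' j x))) (y : S) :
    Tendsto (fun i => propagate (A i) (D i) v N y) f (𝓝 (propagate A' D' v N y)) := by
  have hA' : ∀ j ≤ N, ∀ y x, Tendsto (fun i => A i j y x) f (𝓝 (A' j y x)) := fun j hj y x =>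
    tendsto_pi_nhds.1 (tendsto_pi_nhds.1 (hA j hj) y) x
  induction N generalizing y with
  | zero => exact tendsto_finsetSum _ fun x _ => (hA' 0 le_rfl y x).mul tendsto_const_nhds
  | succ N ih =>
    refine tendsto_finsetSum _ fun x _ => (hA' (N + 1) le_rfl y x).mul ((hD N (by omega) x).mul ?_)
    exact ih (fun j hj => hA j (by omega)) (fun j hj => hD j (by omega))
      x fun j hj => hA' j (by omega)

lemma propagate_smul {R : Type*} [CommSemiring R] (e : ℕ → R) (A : ℕ → Matrix S S R)
    (D : ℕ → S → R) (v : S → R) (N : ℕ) :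
    propagate (fun j => e j • A j) D v N =
      (∏ j ∈ Finset.range (N + 1), e j) • propagate A D v N := by
  induction N with
  | zero => simp [propagate, Matrix.smul_mulVec]
  | succ N ih =>
    rw [Finset.prod_range_succ]
    ext y
    simp only [propagate, ih, Matrix.mulVec, dotProduct, Pi.smul_apply, Matrix.smul_apply,
      smul_eq_mul, Finset.mul_sum]
    exact Finset.sum_congr rfl fun x _ => by ring

lemma propagate_vecMulVec {R : Type*} [CommSemiring R] (l r : ℕ → S → R)
    (D : ℕ → S → R) (v : S → R) (N : ℕ) (y : S) :
    propagate (fun j => Matrix.vecMulVec (r j) (l j)) D v N y =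
      r N y * (∏ j ∈ Finset.range N, ∑ x, l (j + 1) x * (D j x * r j x)) * ∑ x, l 0 x * v x := by
  induction N generalizing y with
  | zero =>
    simp [propagate, Matrix.mulVec, dotProduct, Matrix.vecMulVec_apply, Finset.mul_sum, mul_assoc]
  | succ N ih =>
    rw [propagate, Finset.prod_range_succ]
    simp only [Matrix.mulVec, dotProduct, Matrix.vecMulVec_apply, ih]
    simp only [Finset.mul_sum, Finset.sum_mul]
    rw [Finset.sum_comm]
    refine Finset.sum_congr rfl fun x _ => ?_
    refine Finset.sum_congr rfl fun z _ => ?_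
    ring

lemma propagate_map {R R' : Type*} [NonAssocSemiring R] [NonAssocSemiring R'] (φ : R →+* R')
    (A : ℕ → Matrix S S R) (D : ℕ → S → R) (v : S → R) (N : ℕ) (y : S) :
    propagate (fun j => (A j).map φ) (fun j x => φ (D j x)) (fun x => φ (v x)) N y =
      φ (propagate A D v N y) := by
  induction N generalizing y with
  | zero => simp [propagate, Matrix.mulVec, dotProduct]
  | succ N ih => simp [propagate, Matrix.mulVec, dotProduct, ih]

lemma differentiable_propagate {A : ℂ → ℕ → Matrix S S ℂ} {D : ℂ → ℕ → S → ℂ} {v : S → ℂ}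
    (hA : ∀ j y x, Differentiable ℂ fun p => A p j y x)
    (hD : ∀ j x, Differentiable ℂ fun p => D p j x) (N : ℕ) (y : S) :
    Differentiable ℂ fun p => propagate (A p) (D p) v N y := by
  induction N generalizing y with
  | zero => exact Differentiable.fun_sum fun x _ => (hA _ _ _).mul_const _
  | succ N ih => exact Differentiable.fun_sum fun x _ => (hA _ _ _).mul ((hD _ _).mul (ih x))

variable [DecidableEq S]

section

open scoped Matrix.Norms.Operator

lemma differentiable_matrix_exp {A : ℂ → Matrix S S ℂ}
    (hA : ∀ y x, Differentiable ℂ fun p => A p y x) (y x : S) :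
    Differentiable ℂ fun p => exp (A p) y x := by
  have hA' : Differentiable ℂ A := by
    have h : A = fun p => ∑ y, ∑ x, A p y x • Matrix.single y x (1 : ℂ) := by
      ext1 p
      simp only [Matrix.smul_single, smul_eq_mul, mul_one]
      exact Matrix.matrix_eq_sum_single _
    rw [h]
    exact Differentiable.fun_sum fun y _ => Differentiable.fun_sum fun x _ =>
      (hA y x).smul_const _
  have h1 : Differentiable ℂ fun p => exp (A p) := fun p =>
    (NormedSpace.exp_analytic (𝕂 := ℂ) (A p)).differentiableAt.comp p (hA' p)
  exact ((Matrix.entryLinearMap ℂ ℂ y x).toContinuousLinearMap).differentiable.comp h1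

end

lemma matrix_exp_smul_sub_smul_one {𝕜 : Type*} [RCLike 𝕜] (K : Matrix S S 𝕜) (μ : 𝕜) (t : ℝ) :
    ∃ e : 𝕜, e ≠ 0 ∧ exp (t • (K - μ • 1)) = e • exp (t • K) := by
  refine ⟨exp (-(t • μ)), (NormedSpace.isUnit_exp (-(t • μ))).ne_zero, ?_⟩
  have h1 : t • (K - μ • (1 : Matrix S S 𝕜)) = Matrix.diagonal (fun _ => -(t • μ)) + t • K := by
    ext i j
    by_cases h : i = j
    · subst h; simp [smul_sub]; ring
    · simp [h]
  have h2 : Commute (Matrix.diagonal (fun _ : S => -(t • μ))) (t • K) :=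
    Matrix.scalar_commute _ (fun r => Commute.all _ r) _
  rw [h1, Matrix.exp_add_of_commute _ _ h2, Matrix.exp_diagonal]
  ext i j
  rw [Matrix.diagonal_mul, Matrix.smul_apply, smul_eq_mul]
  congr 1
  exact Pi.coe_exp _ i

end Propagate

end SST

namespace SST

namespace Model

open NormedSpace (exp)

variable {S : Type*} [Fintype S] [DecidableEq S] {M : ModelClass S} {d m : ℕ} (X : Model M d m)

/-! ### The steady state -/

lemma rate_eq_hat (α : Param d m) {x y : S} (h : x ≠ y) :
    X.rate α x y = M.hat α.ε (X.coord α) (α.ε / 2) y x *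
      Real.exp (M.β / 2 * (X.H α.ν x - X.H α.ν y)) := by
  have := X.rate_mul_exp_psi α h 0
  simpa [div_eq_mul_inv] using this

lemma hat_diag (α : Param d m) (v : ℝ) (x : S) :
    M.hat α.ε (X.coord α) v x x = -X.escapeRate α x := by
  simp [ModelClass.hat, X.escapeRate_eq]

lemma rateMatrix_eq (α : Param d m) (y x : S) :
    X.rateMatrix α y x = Real.exp (-(M.β / 2 * X.H α.ν y)) *
      M.hat α.ε (X.coord α) (α.ε / 2) y x * Real.exp (M.β / 2 * X.H α.ν x) := by
  by_cases h : x = y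
  · subst h
    rw [X.hat_diag, mul_right_comm, ← Real.exp_add]
    simp [rateMatrix]
  · rw [rateMatrix, Matrix.of_apply, if_neg h, X.rate_eq_hat α h, mul_sub, sub_eq_add_neg,
      Real.exp_add]
    ring

lemma sum_rateMatrix (α : Param d m) (x : S) : ∑ y, X.rateMatrix α y x = 0 := by
  rw [← Finset.add_sum_erase _ _ (Finset.mem_univ x)]
  have : ∑ y ∈ Finset.univ.erase x, X.rateMatrix α y x = X.escapeRate α x :=
    Finset.sum_congr rfl fun y hy => by
      simp [rateMatrix, (Finset.ne_of_mem_erase hy).symm]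
  rw [this]
  simp [rateMatrix]

/-- Conservation of probability: a left null vector of `hat` at `v = ε / 2`. -/
lemma vecMul_hat (α : Param d m) :
    (fun x => Real.exp (-(M.β / 2 * X.H α.ν x))) ᵥ* M.hat α.ε (X.coord α) (α.ε / 2) = 0 := by
  ext x
  have h := X.sum_rateMatrix α x
  simp only [X.rateMatrix_eq, ← Finset.sum_mul] at h
  exact (mul_eq_zero.1 h).resolve_right (Real.exp_pos _).ne'

variable [Nonempty S]

/-- The factor between `exp (- β H / 2)` and the left Perron vector of `hat` at `v = ε / 2`. -/
noncomputable def norm (α : Param d m) : ℝ :=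
  ∑ x, Real.exp (-(M.β / 2 * X.H α.ν x)) * M.phi α.ε (X.coord α) (-(α.ε / 2)) x

lemma norm_pos (α : Param d m) : 0 < X.norm α :=
  ModelClass.sum_pos_of_pos fun _ => mul_pos (Real.exp_pos _) (M.phi_pos _ _ _ _)

lemma mu_half (α : Param d m) : M.mu α.ε (X.coord α) (α.ε / 2) = 0 :=
  ((M.isPerron_phi α.ε (X.coord α) (α.ε / 2)).eq_smul_of_pos (μ' := 0)
    (l' := fun x => Real.exp (-(M.β / 2 * X.H α.ν x)))
    (fun _ => Real.exp_pos _) (by rw [X.vecMul_hat, zero_smul])).1.symm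

lemma exp_neg_eq (α : Param d m) (x : S) :
    Real.exp (-(M.β / 2 * X.H α.ν x)) = X.norm α * M.phi α.ε (X.coord α) (α.ε / 2) x :=
  congrFun ((M.isPerron_phi α.ε (X.coord α) (α.ε / 2)).eq_smul_of_pos (μ' := 0)
    (l' := fun x => Real.exp (-(M.β / 2 * X.H α.ν x)))
    (fun _ => Real.exp_pos _) (by rw [X.vecMul_hat, zero_smul])).2 x

/-- The stationary distribution is the product of the left and the right Perron vector of `hat` at
`v = ε / 2`, up to normalization. -/
lemma isStationary_iff (α : Param d m) (ρ : S → ℝ) :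
    X.IsStationary α ρ ↔ ρ = fun x => Real.exp (-(M.β / 2 * X.H α.ν x)) *
      M.phi α.ε (X.coord α) (-(α.ε / 2)) x / X.norm α := by
  have hP := M.isPerron_phi α.ε (X.coord α) (α.ε / 2)
  have hs := X.norm_pos α
  have hnull : ∀ ρ : S → ℝ, X.rateMatrix α *ᵥ ρ = 0 ↔
      M.hat α.ε (X.coord α) (α.ε / 2) *ᵥ (fun x => Real.exp (M.β / 2 * X.H α.ν x) * ρ x) = 0 := by
    intro ρ
    have h : ∀ y, (X.rateMatrix α *ᵥ ρ) y = Real.exp (-(M.β / 2 * X.H α.ν y)) *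
        (M.hat α.ε (X.coord α) (α.ε / 2) *ᵥ
          (fun x => Real.exp (M.β / 2 * X.H α.ν x) * ρ x)) y := by
      intro y
      simp only [Matrix.mulVec, dotProduct, X.rateMatrix_eq, Finset.mul_sum]
      exact Finset.sum_congr rfl fun x _ => by ring
    constructor
    · intro h0
      ext y
      have := h y
      rw [h0] at this
      exact (mul_eq_zero.1 this.symm).resolve_left (Real.exp_pos _).ne'
    · intro h0
      ext y
      rw [h y, h0]
      simp
  have hee : ∀ x, Real.exp (M.β / 2 * X.H α.ν x) * Real.exp (-(M.β / 2 * X.H α.ν x)) = 1 :=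
    fun x => by rw [← Real.exp_add, add_neg_cancel, Real.exp_zero]
  constructor
  · rintro ⟨h0, h1, h2⟩
    rw [hnull] at h2
    set w : S → ℝ := fun x => Real.exp (M.β / 2 * X.H α.ν x) * ρ x with hw
    set c := M.phi α.ε (X.coord α) (α.ε / 2) ⬝ᵥ w with hc
    have hw0 : w - c • M.phi α.ε (X.coord α) (-(α.ε / 2)) = 0 := by
      refine hP.toIsDominant.simple ?_ ?_
      · rw [Matrix.mulVec_sub, h2, Matrix.mulVec_smul, hP.right_eq, X.mu_half]
        simp
      · rw [dotProduct_sub, dotProduct_smul, hP.dot, ← hc]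
        simp
    have hw1 : ∀ x, ρ x = c * (Real.exp (-(M.β / 2 * X.H α.ν x)) *
        M.phi α.ε (X.coord α) (-(α.ε / 2)) x) := by
      intro x
      have h3 := congrFun (sub_eq_zero.1 hw0) x
      simp only [hw, Pi.smul_apply, smul_eq_mul] at h3
      calc ρ x = (Real.exp (M.β / 2 * X.H α.ν x) * ρ x) * Real.exp (-(M.β / 2 * X.H α.ν x)) := by
            rw [mul_right_comm, hee, one_mul]
        _ = _ := by rw [h3]; ring
    have hcs : c * X.norm α = 1 := by
      rw [← h1, norm, Finset.mul_sum]
      exact Finset.sum_congr rfl fun x _ => (hw1 x).symm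
    ext x
    rw [hw1, eq_div_iff hs.ne', mul_right_comm, hcs, one_mul]
  · rintro rfl
    refine ⟨fun x => (div_pos (mul_pos (Real.exp_pos _) (M.phi_pos _ _ _ _)) hs).le, ?_, ?_⟩
    · rw [← Finset.sum_div]
      exact div_self hs.ne'
    · rw [hnull]
      have : (fun x => Real.exp (M.β / 2 * X.H α.ν x) * (Real.exp (-(M.β / 2 * X.H α.ν x)) *
          M.phi α.ε (X.coord α) (-(α.ε / 2)) x / X.norm α)) =
          (X.norm α)⁻¹ • M.phi α.ε (X.coord α) (-(α.ε / 2)) := by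
        ext x
        rw [mul_div_assoc, ← mul_assoc, hee, one_mul, Pi.smul_apply, smul_eq_mul, div_eq_inv_mul]
      rw [this, Matrix.mulVec_smul, hP.right_eq, X.mu_half]
      simp

lemma stationary_spec (α : Param d m) : X.IsStationary α (X.stationary α) :=
  Classical.epsilon_spec ((⟨_, (X.isStationary_iff α _).2 rfl⟩ : ∃ ρ, X.IsStationary α ρ))

lemma stationary_eq (α : Param d m) (x : S) :
    X.stationary α x = Real.exp (-(M.β / 2 * X.H α.ν x)) *
      M.phi α.ε (X.coord α) (-(α.ε / 2)) x / X.norm α :=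
  congrFun ((X.isStationary_iff α _).1 (X.stationary_spec α)) x

lemma exp_mul_stationary (α : Param d m) (x : S) :
    Real.exp (M.β / 2 * X.H α.ν x) * X.stationary α x =
      M.phi α.ε (X.coord α) (-(α.ε / 2)) x / X.norm α := by
  rw [X.stationary_eq, mul_div_assoc, ← mul_assoc, ← Real.exp_add, add_neg_cancel, Real.exp_zero,
    one_mul]

/-- The contribution of the steady state at `α` to the logarithms of the generating functions. -/
noncomputable def boundary (α : Param d m) (p : ℝ) : ℝ :=
  M.bdry α.ε (X.coord α) p - 2 * Real.log (X.norm α)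

lemma boundary_eq (α : Param d m) (p : ℝ) :
    X.boundary α p =
      Real.log (∑ x, M.phi α.ε (X.coord α) (α.ε * p) x *
        (Real.exp (M.β / 2 * X.H α.ν x) * X.stationary α x)) -
      Real.log (∑ x, Real.exp (-(M.β / 2 * X.H α.ν x)) *
        M.phi α.ε (X.coord α) (-(α.ε * p)) x) := by
  have hs := X.norm_pos α
  simp only [X.exp_mul_stationary, X.exp_neg_eq, boundary, ModelClass.bdry]
  have h1 : ∑ x, M.phi α.ε (X.coord α) (α.ε * p) x *
      (M.phi α.ε (X.coord α) (-(α.ε / 2)) x / X.norm α) =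
      (∑ x, M.phi α.ε (X.coord α) (α.ε * p) x * M.phi α.ε (X.coord α) (-(α.ε / 2)) x) /
        X.norm α := by
    rw [Finset.sum_div]; exact Finset.sum_congr rfl fun _ _ => by ring
  have h2 : ∑ x, X.norm α * M.phi α.ε (X.coord α) (α.ε / 2) x *
      M.phi α.ε (X.coord α) (-(α.ε * p)) x =
      X.norm α * ∑ x, M.phi α.ε (X.coord α) (-(α.ε * p)) x * M.phi α.ε (X.coord α) (α.ε / 2) x := by
    rw [Finset.mul_sum]; exact Finset.sum_congr rfl fun _ _ => by ring
  have hp : ∀ v w, ∑ x, M.phi α.ε (X.coord α) v x * M.phi α.ε (X.coord α) w x ≠ 0 := fun v w =>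
    (ModelClass.sum_pos_of_pos fun _ => mul_pos (M.phi_pos _ _ _ _) (M.phi_pos _ _ _ _)).ne'
  rw [h1, h2, Real.log_div (hp _ _) hs.ne', Real.log_mul hs.ne' (hp _ _)]
  ring

/-- At `p = 1 / 2` the overlaps telescope: the work factor turns one left Perron vector into the
other. -/
lemma log_overlap_half {α α' : Param d m} (hε : α'.ε = α.ε) :
    Real.log (M.overlap α.ε (X.coord α) (X.coord α') (1 / 2)) =
      Real.log (X.norm α) - Real.log (X.norm α') := by
  have h : M.overlap α.ε (X.coord α) (X.coord α') (1 / 2) = X.norm α / X.norm α' := by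
    rw [eq_div_iff (X.norm_pos α').ne', ModelClass.overlap, Finset.sum_mul]
    change _ = ∑ x, Real.exp (-(M.β / 2 * X.H α.ν x)) * M.phi α.ε (X.coord α) (-(α.ε / 2)) x
    refine Finset.sum_congr rfl fun x _ => ?_
    have h1 := X.exp_neg_eq α' x
    rw [hε] at h1
    have h2 : Real.exp (1 / 2 * M.β * ((X.coord α').1 x - (X.coord α).1 x)) *
        Real.exp (-(M.β / 2 * X.H α'.ν x)) = Real.exp (-(M.β / 2 * X.H α.ν x)) := by
      rw [← Real.exp_add]; congr 1; simp only [coord]; ring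
    rw [← h2, h1, show α.ε * (1 / 2) = α.ε / 2 by ring]
    ring
  rw [h, Real.log_div (X.norm_pos α).ne' (X.norm_pos α').ne']

/-! ### The generating function for slow protocols -/

omit [DecidableEq S] [Nonempty S] in
/-- The ratio of the generating functions of a sequence of steps and of the reversed sequence, over
`ℝ` or `ℂ`: the exponential growth of the factors cancels. -/
lemma _root_.SST.tendsto_ratio {𝕜 ι : Type*} [RCLike 𝕜] [DecidableEq S] {f : Filter ι} {t : ι → ℝ}
    {K : ι → ℕ → Matrix S S 𝕜} {μ : ι → ℕ → 𝕜} {P : ℕ → Matrix S S 𝕜} {N : ℕ}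
    (hK : ∀ j ≤ N, Tendsto (fun i => exp (t i • (K i j - μ i j • 1))) f (𝓝 (P j)))
    {D D' : ι → ℕ → S → 𝕜} {E E' : ℕ → S → 𝕜}
    (hD : ∀ j < N, ∀ x, Tendsto (fun i => D i j x) f (𝓝 (E j x)))
    (hD' : ∀ j < N, ∀ x, Tendsto (fun i => D' i j x) f (𝓝 (E' j x))) (v v' w w' : S → 𝕜)
    (hne : ∑ y, w' y * propagate (fun j => P (N - j)) E' v' N y ≠ 0) :
    Tendsto (fun i => (∑ y, w y * propagate (fun j => exp (t i • K i j)) (D i) v N y) /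
        ∑ y, w' y * propagate (fun j => exp (t i • K i (N - j))) (D' i) v' N y) f
      (𝓝 ((∑ y, w y * propagate P E v N y) /
        ∑ y, w' y * propagate (fun j => P (N - j)) E' v' N y)) := by
  have h1 : Tendsto (fun i => ∑ y, w y *
      propagate (fun j => exp (t i • (K i j - μ i j • 1))) (D i) v N y) f
      (𝓝 (∑ y, w y * propagate P E v N y)) :=
    tendsto_finsetSum _ fun y _ => (tendsto_propagate hK hD y).const_mul _
  have h2 : Tendsto (fun i => ∑ y, w' y *
      propagate (fun j => exp (t i • (K i (N - j) - μ i (N - j) • 1))) (D' i) v' N y) f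
      (𝓝 (∑ y, w' y * propagate (fun j => P (N - j)) E' v' N y)) :=
    tendsto_finsetSum _ fun y _ => (tendsto_propagate
      (fun j _ => hK (N - j) (Nat.sub_le _ _)) hD' y).const_mul _
  refine (h1.div h2 hne).congr fun i => ?_
  choose e he0 he using fun j => matrix_exp_smul_sub_smul_one (K i j) (μ i j) (t i)
  have hprod : ∏ j ∈ Finset.range (N + 1), e (N - j) = ∏ j ∈ Finset.range (N + 1), e j :=
    Finset.prod_range_reflect e (N + 1)
  have hp0 : ∏ j ∈ Finset.range (N + 1), e j ≠ 0 := Finset.prod_ne_zero_iff.2 fun j _ => he0 j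
  have hsum : ∀ (w g : S → 𝕜) (c : 𝕜), ∑ y, w y * (c • g) y = c * ∑ y, w y * g y := by
    intro w g c
    rw [Finset.mul_sum]
    exact Finset.sum_congr rfl fun y _ => mul_left_comm _ _ _
  simp only [Pi.div_apply, he]
  rw [propagate_smul e, propagate_smul (fun j => e (N - j)), hprod, hsum, hsum]
  exact mul_div_mul_left _ _ hp0

/-- The generating function of `β W + Ψ` at `u = p - 1 / 2`, for steps of length `T` with the
parameters `γ 0, …, γ N`, started from the steady state. -/
noncomputable def genFun (γ : ℕ → Param d m) (N : ℕ) (T p : ℝ) : ℝ :=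
  ∑ y, Real.exp (-(M.β / 2 * X.H (γ N).ν y)) * X.evolve γ T (X.stationary (γ 0)) p N y

/-- The matrix `hat` at `v = ε p` for complex `p`. -/
noncomputable def _root_.SST.ModelClass.hatComplex (M : ModelClass S) (ε : ℝ) (z : Coord S)
    (p : ℂ) : Matrix S S ℂ :=
  Matrix.of fun y x => if x = y then ((-M.escape ε z x : ℝ) : ℂ) else
    ((M.c x y * M.symFactor (z.1 x) (z.1 y) : ℝ) : ℂ) *
      Complex.exp (((ε * (z.2 x y + z.2 y x) / 2 : ℝ) : ℂ) +
        (ε : ℂ) * p * ((z.2 x y - z.2 y x : ℝ) : ℂ))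

omit [Nonempty S] in
lemma _root_.SST.ModelClass.hatComplex_ofReal (M : ModelClass S) (ε : ℝ) (z : Coord S) (p : ℝ) :
    M.hatComplex ε z p = (M.hat ε z (ε * p)).map ((↑) : ℝ → ℂ) := by
  ext y x
  by_cases h : x = y
  · simp [ModelClass.hatComplex, ModelClass.hat, h]
  · simp [ModelClass.hatComplex, ModelClass.hat, h]

omit [Nonempty S] in
lemma _root_.SST.ModelClass.differentiable_hatComplex (M : ModelClass S) (ε : ℝ) (z : Coord S)
    (y x : S) : Differentiable ℂ fun p => M.hatComplex ε z p y x := by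
  by_cases h : x = y
  · simp only [ModelClass.hatComplex, h, Matrix.of_apply, if_true]
    fun_prop
  · simp only [ModelClass.hatComplex, h, Matrix.of_apply, if_false]
    fun_prop

/-- The analytic continuation of `genFun`. -/
noncomputable def genFunComplex (γ : ℕ → Param d m) (N : ℕ) (T : ℝ) (p : ℂ) : ℂ :=
  ∑ y, ((Real.exp (-(M.β / 2 * X.H (γ N).ν y)) : ℝ) : ℂ) *
    propagate (fun j => exp (T • M.hatComplex (γ j).ε (X.coord (γ j)) p))
    (fun j x => Complex.exp (p * ((M.β * (X.H (γ (j + 1)).ν x - X.H (γ j).ν x) : ℝ) : ℂ)))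
    (fun x => ((Real.exp (M.β / 2 * X.H (γ 0).ν x) * X.stationary (γ 0) x : ℝ) : ℂ)) N y

omit [Nonempty S] in
lemma genFunComplex_ofReal (γ : ℕ → Param d m) (N : ℕ) (T p : ℝ) :
    X.genFunComplex γ N T p = X.genFun γ N T p := by
  rw [genFun, genFunComplex, Complex.ofReal_sum]
  refine Finset.sum_congr rfl fun y _ => ?_
  rw [Complex.ofReal_mul]
  congr 1
  refine Eq.trans ?_ (propagate_map Complex.ofRealHom _ _ _ _ _)
  congr 1
  · ext j : 1
    rw [M.hatComplex_ofReal]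
    have : T • (M.hat (γ j).ε (X.coord (γ j)) ((γ j).ε * p)).map ((↑) : ℝ → ℂ) =
        (T • M.hat (γ j).ε (X.coord (γ j)) ((γ j).ε * p)).map ((↑) : ℝ → ℂ) := by
      ext; simp
    rw [this, ← matrix_exp_map_ofReal]
    rfl
  · ext j x
    simp [mul_assoc]

omit [Nonempty S] in
lemma differentiable_genFunComplex (γ : ℕ → Param d m) (N : ℕ) (T : ℝ) :
    Differentiable ℂ (X.genFunComplex γ N T) := by
  refine Differentiable.fun_sum fun y _ => Differentiable.const_mul ?_ _
  refine differentiable_propagate (fun j => differentiable_matrix_exp fun y x => ?_)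
    (fun j x => by fun_prop) N y
  exact (M.differentiable_hatComplex _ _ y x).const_smul T

lemma genFun_pos (γ : ℕ → Param d m) (N : ℕ) {T : ℝ} (hT : 0 < T) (p : ℝ) :
    0 < X.genFun γ N T p := by
  have hρ : ∀ α x, 0 < X.stationary α x := fun α x => by
    rw [X.stationary_eq]
    exact div_pos (mul_pos (Real.exp_pos _) (M.phi_pos _ _ _ _)) (X.norm_pos α)
  have hpos : ∀ A : Matrix S S ℝ, (∀ y x, 0 < A y x) → ∀ v : S → ℝ, (∀ x, 0 < v x) →
      ∀ y, 0 < (A *ᵥ v) y := fun A hA v hv y =>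
    ModelClass.sum_pos_of_pos fun x => mul_pos (hA y x) (hv x)
  refine ModelClass.sum_pos_of_pos fun y => mul_pos (Real.exp_pos _) ?_
  induction N generalizing y with
  | zero =>
    change 0 < (exp (T • M.hat _ _ _) *ᵥ fun x => _) y
    exact hpos _ ((M.hat_isMetzler _ _ _).smul hT).exp_pos _
      (fun x => mul_pos (Real.exp_pos _) (hρ _ x)) y
  | succ N ih =>
    change 0 < (exp (T • M.hat _ _ _) *ᵥ fun x => _) y
    exact hpos _ ((M.hat_isMetzler _ _ _).smul hT).exp_pos _
      (fun x => mul_pos (Real.exp_pos _) (ih x)) y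

/-- The limit, for slow steps, of the difference between the cumulant generating functions of the
protocol and of its reversal. -/
noncomputable def limitFun (γ : ℕ → Param d m) (N : ℕ) (p : ℝ) : ℝ :=
  X.boundary (γ 0) p - X.boundary (γ N) p +
    ∑ j ∈ Finset.range N, M.stepFun (γ 0).ε (X.coord (γ j)) (X.coord (γ (j + 1))) p

/-- The generating function with all exponentials replaced by the Perron projections factorizes into
boundary terms and overlaps. -/
lemma limit_ratio_eq {γ : ℕ → Param d m} {ε : ℝ} (N : ℕ) (p : ℝ) :
    0 < (∑ y, Real.exp (-(M.β / 2 * X.H (γ N).ν y)) * propagate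
        (fun j => Matrix.vecMulVec (M.phi ε (X.coord (γ j)) (-(ε * p)))
          (M.phi ε (X.coord (γ j)) (ε * p)))
        (fun j x => Real.exp (p * M.β * (X.H (γ (j + 1)).ν x - X.H (γ j).ν x)))
        (fun x => Real.exp (M.β / 2 * X.H (γ 0).ν x) * X.stationary (γ 0) x) N y) ∧
    Real.log (∑ y, Real.exp (-(M.β / 2 * X.H (γ N).ν y)) * propagate
        (fun j => Matrix.vecMulVec (M.phi ε (X.coord (γ j)) (-(ε * p)))
          (M.phi ε (X.coord (γ j)) (ε * p)))
        (fun j x => Real.exp (p * M.β * (X.H (γ (j + 1)).ν x - X.H (γ j).ν x)))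
        (fun x => Real.exp (M.β / 2 * X.H (γ 0).ν x) * X.stationary (γ 0) x) N y) =
      Real.log (∑ x, Real.exp (-(M.β / 2 * X.H (γ N).ν x)) *
        M.phi ε (X.coord (γ N)) (-(ε * p)) x) +
      ∑ j ∈ Finset.range N, Real.log (M.overlap ε (X.coord (γ j)) (X.coord (γ (j + 1))) p) +
      Real.log (∑ x, M.phi ε (X.coord (γ 0)) (ε * p) x *
        (Real.exp (M.β / 2 * X.H (γ 0).ν x) * X.stationary (γ 0) x)) := by
  have hov : ∀ j, ∑ x, M.phi ε (X.coord (γ (j + 1))) (ε * p) x *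
      (Real.exp (p * M.β * (X.H (γ (j + 1)).ν x - X.H (γ j).ν x)) *
        M.phi ε (X.coord (γ j)) (-(ε * p)) x) =
      M.overlap ε (X.coord (γ j)) (X.coord (γ (j + 1))) p := fun j =>
    Finset.sum_congr rfl fun x _ => (mul_assoc _ _ _).symm
  simp only [propagate_vecMulVec, hov]
  simp only [← mul_assoc, ← Finset.sum_mul]
  have h1 : 0 < ∑ x, Real.exp (-(M.β / 2 * X.H (γ N).ν x)) *
      M.phi ε (X.coord (γ N)) (-(ε * p)) x :=
    ModelClass.sum_pos_of_pos fun x => mul_pos (Real.exp_pos _) (M.phi_pos _ _ _ _)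
  have h2 : ∀ j ∈ Finset.range N, M.overlap ε (X.coord (γ j)) (X.coord (γ (j + 1))) p ≠ 0 :=
    fun j _ => (M.overlap_pos _ _ _ _).ne'
  have h2' : 0 < ∏ j ∈ Finset.range N, M.overlap ε (X.coord (γ j)) (X.coord (γ (j + 1))) p :=
    Finset.prod_pos fun j _ => M.overlap_pos _ _ _ _
  have h3 : 0 < ∑ x, M.phi ε (X.coord (γ 0)) (ε * p) x * Real.exp (M.β / 2 * X.H (γ 0).ν x) *
      X.stationary (γ 0) x :=
    ModelClass.sum_pos_of_pos fun x => mul_pos (mul_pos (M.phi_pos _ _ _ _) (Real.exp_pos _)) (by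
      rw [X.stationary_eq]
      exact div_pos (mul_pos (Real.exp_pos _) (M.phi_pos _ _ _ _)) (X.norm_pos _))
  refine ⟨mul_pos (mul_pos h1 h2') h3, ?_⟩
  rw [Real.log_mul (mul_pos h1 h2').ne' h3.ne', Real.log_mul h1.ne' h2'.ne', Real.log_prod h2]

end Model
end SST

namespace SST

namespace Model

open NormedSpace (exp)

variable {S : Type*} [Fintype S] [DecidableEq S] [Nonempty S] {M : ModelClass S} {d m : ℕ}
  (X : Model M d m)

/-- The difference between the cumulant generating functions of the protocol with the parameters
`γ 0, …, γ N` and of the reversed protocol converges for slow steps. -/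
lemma tendsto_log_genFun {γ : ℕ → Param d m} {ε : ℝ} (hγ : ∀ j, (γ j).ε = ε) (N : ℕ) (p : ℝ) :
    Tendsto (fun T => Real.log (X.genFun γ N T p) -
      Real.log (X.genFun (fun j => γ (N - j)) N T p)) atTop (𝓝 (X.limitFun γ N p)) := by
  obtain ⟨hpos, hlog⟩ := X.limit_ratio_eq (γ := γ) (ε := ε) N p
  obtain ⟨hpos', hlog'⟩ := X.limit_ratio_eq (γ := fun j => γ (N - j)) (ε := ε) N p
  have h := tendsto_ratio (𝕜 := ℝ) (f := atTop) (t := fun T : ℝ => T)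
    (K := fun _ j => M.hat ε (X.coord (γ j)) (ε * p))
    (μ := fun _ j => M.mu ε (X.coord (γ j)) (ε * p)) (N := N)
    (fun j _ => (M.isPerron_phi ε (X.coord (γ j)) (ε * p)).tendsto)
    (D := fun _ j x => Real.exp (p * M.β * (X.H (γ (j + 1)).ν x - X.H (γ j).ν x)))
    (D' := fun _ j x => Real.exp (p * M.β *
      (X.H (γ (N - (j + 1))).ν x - X.H (γ (N - j)).ν x)))
    (fun _ _ _ => tendsto_const_nhds) (fun _ _ _ => tendsto_const_nhds)
    (fun x => Real.exp (M.β / 2 * X.H (γ 0).ν x) * X.stationary (γ 0) x)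
    (fun x => Real.exp (M.β / 2 * X.H (γ (N - 0)).ν x) * X.stationary (γ (N - 0)) x)
    (fun y => Real.exp (-(M.β / 2 * X.H (γ N).ν y)))
    (fun y => Real.exp (-(M.β / 2 * X.H (γ (N - N)).ν y))) hpos'.ne'
  have h2 := h.log (div_pos hpos hpos').ne'
  rw [Real.log_div hpos.ne' hpos'.ne', hlog, hlog'] at h2
  have hrefl : ∑ j ∈ Finset.range N,
      Real.log (M.overlap ε (X.coord (γ (N - j))) (X.coord (γ (N - (j + 1)))) p) =
      ∑ j ∈ Finset.range N, Real.log (M.overlap ε (X.coord (γ j)) (X.coord (γ (j + 1))) (-p)) := by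
    rw [← Finset.sum_range_reflect]
    refine Finset.sum_congr rfl fun j hj => ?_
    have hj := Finset.mem_range.1 hj
    rw [M.overlap_neg, show N - (N - 1 - j) = j + 1 by omega, show N - (N - 1 - j + 1) = j by omega]
  rw [hrefl, Nat.sub_self, Nat.sub_zero] at h2
  refine (h2.congr' ?_).trans (le_of_eq ?_)
  · filter_upwards [eventually_gt_atTop 0] with T hT
    rw [Real.log_div]
    · simp only [genFun, evolve, hγ, Nat.sub_self, Nat.sub_zero]
    · have := X.genFun_pos γ N hT p
      simp only [genFun, evolve, hγ] at this
      exact this.ne'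
    · have := X.genFun_pos (fun j => γ (N - j)) N hT p
      simp only [genFun, evolve, hγ, Nat.sub_self, Nat.sub_zero] at this
      exact this.ne'
  · rw [limitFun, X.boundary_eq, X.boundary_eq]
    simp only [hγ, ModelClass.stepFun, Finset.sum_sub_distrib]
    congr 1
    ring

/-- The derivatives of the difference between the cumulant generating functions converge as well. -/
theorem tendsto_iteratedDeriv_log_genFun {γ : ℕ → Param d m} {ε : ℝ} (hγ : ∀ j, (γ j).ε = ε)
    (N k : ℕ) (p : ℝ) :
    Tendsto (fun T => iteratedDeriv k (fun p => Real.log (X.genFun γ N T p) -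
      Real.log (X.genFun (fun j => γ (N - j)) N T p)) p) atTop
      (𝓝 (iteratedDeriv k (X.limitFun γ N) p)) := by
  have hex : ∀ j, ∃ (μ : ℂ → ℂ) (P : ℂ → Matrix S S ℂ),
      P p = (Matrix.vecMulVec (M.phi ε (X.coord (γ j)) (-(ε * p)))
        (M.phi ε (X.coord (γ j)) (ε * p))).map ((↑) : ℝ → ℂ) ∧ ContinuousAt P p ∧
      ∀ᶠ q in 𝓝 (p : ℂ), Tendsto (fun q : ℝ × ℂ =>
        exp (q.1 • (M.hatComplex ε (X.coord (γ j)) q.2 - μ q.2 • 1))) (atTop ×ˢ 𝓝 q)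
        (𝓝 (P q)) := by
    intro j
    have h := (M.isPerron_phi ε (X.coord (γ j)) (ε * p)).toIsDominant.ofReal
    rw [← M.hatComplex_ofReal] at h
    obtain ⟨μ, P, h1, h2, h3⟩ :=
      exists_holomorphic_dominant (M.differentiable_hatComplex ε (X.coord (γ j))) h
    refine ⟨μ, P, h1.trans ?_, h2, h3⟩
    ext y x
    simp [Matrix.vecMulVec_apply]
  choose μ P hP hPc hPt using hex
  set E : ℂ → ℕ → S → ℂ := fun q j x =>
    Complex.exp (q * ((M.β * (X.H (γ (j + 1)).ν x - X.H (γ j).ν x) : ℝ) : ℂ)) with hE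
  set E' : ℂ → ℕ → S → ℂ := fun q j x =>
    Complex.exp (q * ((M.β * (X.H (γ (N - (j + 1))).ν x - X.H (γ (N - j)).ν x) : ℝ) : ℂ)) with hE'
  have hEc : ∀ j x, Continuous fun q => E q j x := fun j x => by simp only [hE]; fun_prop
  have hEc' : ∀ j x, Continuous fun q => E' q j x := fun j x => by simp only [hE']; fun_prop
  set v : S → ℂ := fun x => ((Real.exp (M.β / 2 * X.H (γ 0).ν x) * X.stationary (γ 0) x : ℝ) : ℂ)
    with hv
  set v' : S → ℂ := fun x =>
    ((Real.exp (M.β / 2 * X.H (γ (N - 0)).ν x) * X.stationary (γ (N - 0)) x : ℝ) : ℂ) with hv'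
  set w : S → ℂ := fun y => ((Real.exp (-(M.β / 2 * X.H (γ N).ν y)) : ℝ) : ℂ) with hw
  set w' : S → ℂ := fun y => ((Real.exp (-(M.β / 2 * X.H (γ (N - N)).ν y)) : ℝ) : ℂ) with hw'
  -- the limit of the denominators does not vanish near `p`
  have hne : ∀ᶠ q in 𝓝 (p : ℂ),
      ∑ y, w' y * propagate (fun j => P (N - j) q) (E' q) v' N y ≠ 0 := by
    have hc : ContinuousAt (fun q => ∑ y, w' y * propagate (fun j => P (N - j) q) (E' q) v' N y)
        (p : ℂ) :=
      tendsto_finsetSum _ fun y _ => (tendsto_propagate (fun j _ => hPc (N - j))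
        (fun j _ x => (hEc' j x).tendsto _) y).const_mul _
    refine hc.eventually_ne ?_
    obtain ⟨hpos', -⟩ := X.limit_ratio_eq (γ := fun j => γ (N - j)) (ε := ε) N p
    have h0 := Complex.ofReal_ne_zero.2 hpos'.ne'
    rw [Complex.ofReal_sum] at h0
    convert h0 using 2 with y _
    rw [Complex.ofReal_mul]
    congr 1
    refine Eq.trans ?_ (propagate_map Complex.ofRealHom _ _ _ _ _)
    congr 1
    · ext j : 1
      exact hP _
    · ext j x
      simp [hE', mul_assoc]
  have hall : ∀ᶠ q in 𝓝 (p : ℂ), ∀ j ∈ Finset.range (N + 1), Tendsto (fun q : ℝ × ℂ =>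
        exp (q.1 • (M.hatComplex ε (X.coord (γ j)) q.2 - μ j q.2 • 1))) (atTop ×ˢ 𝓝 q)
        (𝓝 (P j q)) :=
    (Finset.eventually_all _).2 fun j _ => hPt j
  refine tendsto_iteratedDeriv_of_joint
    (ρ := fun T q => X.genFunComplex γ N T q / X.genFunComplex (fun j => γ (N - j)) N T q)
    (σ := fun q => (∑ y, w y * propagate (fun j => P j q) (E q) v N y) /
      ∑ y, w' y * propagate (fun j => P (N - j) q) (E' q) v' N y) ?_ ?_ ?_
    (X.tendsto_log_genFun hγ N) k
  · filter_upwards [hne, hall] with q hq hq'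
    have h := tendsto_ratio (𝕜 := ℂ) (f := atTop ×ˢ 𝓝 q) (t := fun i : ℝ × ℂ => i.1)
      (K := fun i j => M.hatComplex ε (X.coord (γ j)) i.2) (μ := fun i j => μ j i.2) (N := N)
      (fun j hj => hq' j (Finset.mem_range.2 (Nat.lt_succ_of_le hj)))
      (D := fun i => E i.2) (D' := fun i => E' i.2)
      (fun j _ x => ((hEc j x).tendsto q).comp tendsto_snd)
      (fun j _ x => ((hEc' j x).tendsto q).comp tendsto_snd) v v' w w' hq
    refine h.congr fun i => ?_
    simp only [genFunComplex, hγ]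
    rfl
  · intro T q hq
    refine (X.differentiable_genFunComplex γ N T q).div
      (X.differentiable_genFunComplex _ N T q) fun h0 => hq ?_
    rw [h0, div_zero]
  · intro T hT x
    have h1 := X.genFun_pos γ N hT x
    have h2 := X.genFun_pos (fun j => γ (N - j)) N hT x
    rw [genFunComplex_ofReal, genFunComplex_ofReal, Real.exp_sub, Real.exp_log h1, Real.exp_log h2,
      Complex.ofReal_div]

/-! ### The free energy -/

/-- The free energy is the boundary term at `p = 0`. -/
theorem freeEnergy_eq [MeasurableSpace S] [DiscreteMeasurableSpace S] (α : Param d m) :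
    M.β * X.freeEnergy α = X.boundary α 0 := by
  have hβ := M.β_pos
  set l := M.phi α.ε (X.coord α) 0 with hl
  have hlpos : ∀ x, 0 < l x := M.phi_pos _ _ _
  have hJ : ∀ s T, IsStep (fun _ => 0) s T 0 := fun s T =>
    ⟨measurable_const, fun _ => le_rfl, rfl, rfl, fun j hj t _ => (Nat.le_zero.1 hj).symm⟩
  have hρ := X.stationary_spec α
  have hpath : ∀ (s T : ℝ), 0 ≤ T → ∀ (q f : S → ℝ), (∀ x, 0 ≤ q x) → (∀ x, 0 ≤ f x) →
      ∫ p, Real.exp (-X.Ψ (fun _ => α) p / 2) * f p.final ∂X.pathLaw s (s + T) (fun _ => α) q =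
      ∑ y, f y * Real.exp (-(M.β / 2 * X.H α.ν y)) *
        (exp (T • M.hat α.ε (X.coord α) 0) *ᵥ
          fun x => Real.exp (M.β / 2 * X.H α.ν x) * q x) y := by
    intro s T hT q f hq hf
    have h := (X.integral_pathLaw (γ := fun _ => α) (hJ s T) hT hq hf (-1 / 2)).2
    have hW : ∀ p : Path S, X.W s (s + T) (fun _ => α) p = 0 := fun p => by simp [W]
    simp only [CharP.cast_eq_zero, zero_add, one_mul, hW, mul_zero, evolve, propagate] at h
    have h0 : (-1 / 2 + 1 / 2 : ℝ) = 0 := by norm_num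
    simp only [h0, mul_zero] at h
    rw [← h]
    refine integral_congr_ae (Eventually.of_forall fun p => ?_)
    change Real.exp _ * _ = Real.exp _ * _
    congr 2
    ring
  have hlim : ∀ x, Tendsto (fun τ => Real.exp (-M.β * X.H α.ν x) *
      (X.expFrom α x τ / X.expTo α x τ)) atTop (𝓝 (Real.exp (-X.boundary α 0))) := by
    intro x
    have hs1 : ∀ z, 0 ≤ (Pi.single x 1 : S → ℝ) z := fun z => by
      rw [Pi.single_apply]; split_ifs <;> norm_num
    have hfrom : ∀ τ, 0 ≤ τ → X.expFrom α x τ = ∑ y, Real.exp (-(M.β / 2 * X.H α.ν y)) *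
        (exp ((τ / 2) • M.hat α.ε (X.coord α) 0) *ᵥ
          fun z => Real.exp (M.β / 2 * X.H α.ν z) * (Pi.single x 1 : S → ℝ) z) y := by
      intro τ hτ
      have h := hpath (-τ) (τ / 2) (by positivity) (Pi.single x 1) (fun _ => 1)
        hs1 (fun _ => zero_le_one)
      simp only [mul_one, one_mul] at h
      rw [expFrom, ← h, show -τ + τ / 2 = -τ / 2 by ring]
    have hto : ∀ τ, 0 ≤ τ → X.expTo α x τ = Real.exp (-(M.β / 2 * X.H α.ν x)) *
        (exp ((τ / 2) • M.hat α.ε (X.coord α) 0) *ᵥ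
          fun z => Real.exp (M.β / 2 * X.H α.ν z) * X.stationary α z) x := by
      intro τ hτ
      have h := hpath (τ / 2) (τ / 2) (by positivity) (X.stationary α) (Pi.single x 1)
        hρ.1 hs1
      rw [Finset.sum_eq_single x (fun y _ hy => by simp [hy]) (by simp)] at h
      simp only [Pi.single_eq_same, one_mul] at h
      have hset : MeasurableSet {p : Path S | p.final = x} :=
        measurable_final (MeasurableSet.of_discrete (s := {x}))
      rw [expTo, ← h, show τ / 2 + τ / 2 = τ by ring, ← integral_indicator hset]
      refine integral_congr_ae (Eventually.of_forall fun p => ?_)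
      by_cases hp : p.final = x
      · simp [Set.indicator, hp]
      · simp [Set.indicator, hp]
    have hP := (M.isPerron_phi α.ε (X.coord α) 0).tendsto
    rw [neg_zero, ← hl] at hP
    have hP2 : Tendsto (fun τ : ℝ => exp ((τ / 2) • (M.hat α.ε (X.coord α) 0 -
        M.mu α.ε (X.coord α) 0 • 1))) atTop (𝓝 (Matrix.vecMulVec l l)) :=
      hP.comp (tendsto_id.atTop_div_const two_pos)
    have hent : ∀ y x, Tendsto (fun τ : ℝ => exp ((τ / 2) • (M.hat α.ε (X.coord α) 0 -
        M.mu α.ε (X.coord α) 0 • 1)) y x) atTop (𝓝 (l y * l x)) := fun y x =>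
      tendsto_pi_nhds.1 (tendsto_pi_nhds.1 hP2 y) x
    have hmul : ∀ (v : S → ℝ) y, Tendsto (fun τ : ℝ => (exp ((τ / 2) • (M.hat α.ε (X.coord α) 0 -
        M.mu α.ε (X.coord α) 0 • 1)) *ᵥ v) y) atTop (𝓝 (∑ x, l y * l x * v x)) := fun v y =>
      tendsto_finsetSum _ fun x _ => (hent y x).mul_const _
    set A : ℝ := ∑ z, Real.exp (-(M.β / 2 * X.H α.ν z)) * l z with hA
    set B : ℝ := ∑ z, l z * (Real.exp (M.β / 2 * X.H α.ν z) * X.stationary α z) with hB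
    have hA0 : 0 < A := ModelClass.sum_pos_of_pos fun z => mul_pos (Real.exp_pos _) (hlpos z)
    have hB0 : 0 < B := ModelClass.sum_pos_of_pos fun z => mul_pos (hlpos z) (by
      rw [X.exp_mul_stationary]; exact div_pos (M.phi_pos _ _ _ _) (X.norm_pos α))
    have hAB : Real.exp (-X.boundary α 0) = A / B := by
      rw [X.boundary_eq, mul_zero, neg_zero, ← hl, ← hA, ← hB, neg_sub, Real.exp_sub,
        Real.exp_log hA0, Real.exp_log hB0]
    have hnum := tendsto_finsetSum Finset.univ fun y _ =>
      (hmul (fun z => Real.exp (M.β / 2 * X.H α.ν z) * (Pi.single x 1 : S → ℝ) z) y).const_mul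
        (Real.exp (-(M.β / 2 * X.H α.ν y)))
    have hden := (hmul (fun z => Real.exp (M.β / 2 * X.H α.ν z) * X.stationary α z) x).const_mul
      (Real.exp (-(M.β / 2 * X.H α.ν x)))
    have e1 : ∑ y, Real.exp (-(M.β / 2 * X.H α.ν y)) * ∑ z, l y * l z *
        (Real.exp (M.β / 2 * X.H α.ν z) * (Pi.single x 1 : S → ℝ) z) =
        A * (l x * Real.exp (M.β / 2 * X.H α.ν x)) := by
      rw [hA, Finset.sum_mul]
      refine Finset.sum_congr rfl fun y _ => ?_
      rw [Finset.sum_eq_single x (fun z _ hz => by simp [hz]) (by simp), Pi.single_eq_same]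
      ring
    have e2 : Real.exp (-(M.β / 2 * X.H α.ν x)) * ∑ z, l x * l z *
        (Real.exp (M.β / 2 * X.H α.ν z) * X.stationary α z) =
        B * (l x * Real.exp (-(M.β / 2 * X.H α.ν x))) := by
      rw [hB, Finset.mul_sum, Finset.sum_mul]
      exact Finset.sum_congr rfl fun z _ => by ring
    rw [e1] at hnum
    rw [e2] at hden
    have hden0 : B * (l x * Real.exp (-(M.β / 2 * X.H α.ν x))) ≠ 0 :=
      (mul_pos hB0 (mul_pos (hlpos x) (Real.exp_pos _))).ne'
    have h := (hnum.div hden hden0).const_mul (Real.exp (-M.β * X.H α.ν x))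
    have e3 : Real.exp (-M.β * X.H α.ν x) * (A * (l x * Real.exp (M.β / 2 * X.H α.ν x)) /
        (B * (l x * Real.exp (-(M.β / 2 * X.H α.ν x))))) = A / B := by
      have e4 : Real.exp (-M.β * X.H α.ν x) * Real.exp (M.β / 2 * X.H α.ν x) =
          Real.exp (-(M.β / 2 * X.H α.ν x)) := by rw [← Real.exp_add]; congr 1; ring
      rw [mul_div_assoc', div_eq_div_iff hden0 hB0.ne', ← e4]
      ring
    rw [e3, ← hAB] at h
    refine h.congr' ?_
    filter_upwards [eventually_ge_atTop 0] with τ hτ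
    obtain ⟨e, he0, he⟩ := matrix_exp_smul_sub_smul_one (M.hat α.ε (X.coord α) 0)
      (M.mu α.ε (X.coord α) 0) (τ / 2)
    rw [hfrom τ hτ, hto τ hτ]
    congr 1
    simp only [Pi.div_apply, he, Matrix.smul_mulVec, Pi.smul_apply, smul_eq_mul]
    simp only [mul_left_comm _ e, ← Finset.mul_sum]
    exact mul_div_mul_left _ _ he0
  -- the limits determine the free energy
  have hspec : ∃ F : ℝ, ∀ x : S,
      Tendsto (fun τ => Real.exp (-M.β * X.H α.ν x) * (X.expFrom α x τ / X.expTo α x τ)) atTop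
        (𝓝 (Real.exp (-M.β * F))) := by
    refine ⟨X.boundary α 0 / M.β, fun x => ?_⟩
    have : -M.β * (X.boundary α 0 / M.β) = -X.boundary α 0 := by field_simp
    rw [this]
    exact hlim x
  have h := Classical.epsilon_spec hspec
  obtain ⟨x⟩ := ‹Nonempty S›
  have h2 := Real.exp_injective (tendsto_nhds_unique (h x) (hlim x))
  change -M.β * X.freeEnergy α = _ at h2
  linarith

end Model
end SST

namespace SST

namespace Model

open NormedSpace (exp)

variable {S : Type*} [Fintype S] [DecidableEq S] {M : ModelClass S} {d m : ℕ}
  (X : Model M d m) {γ : ℕ → Param d m} {J : ℝ → ℕ} {s T : ℝ} {N : ℕ}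

/-! ### Cumulants and the mean entropy production -/

/-- Conservation of probability along the protocol. -/
lemma sum_evolve_half (T : ℝ) (q : S → ℝ) (j : ℕ) :
    ∑ y, Real.exp (-(M.β / 2 * X.H (γ j).ν y)) * X.evolve γ T q (1 / 2) j y = ∑ x, q x := by
  have hfix : ∀ (α : Param d m) (v : S → ℝ), ∑ y, Real.exp (-(M.β / 2 * X.H α.ν y)) *
      (exp (T • M.hat α.ε (X.coord α) (α.ε * (1 / 2))) *ᵥ v) y =
      ∑ y, Real.exp (-(M.β / 2 * X.H α.ν y)) * v y := by
    intro α v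
    have h : (fun x => Real.exp (-(M.β / 2 * X.H α.ν x))) ᵥ*
        (T • M.hat α.ε (X.coord α) (α.ε * (1 / 2))) = 0 := by
      rw [Matrix.vecMul_smul, mul_one_div, X.vecMul_hat, smul_zero]
    have h2 := Matrix.dotProduct_mulVec (fun x => Real.exp (-(M.β / 2 * X.H α.ν x)))
      (exp (T • M.hat α.ε (X.coord α) (α.ε * (1 / 2)))) v
    rw [vecMul_exp_of_eq_zero h] at h2
    exact h2
  induction j with
  | zero =>
    rw [evolve, propagate, hfix]
    refine Finset.sum_congr rfl fun x _ => ?_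
    rw [← mul_assoc, ← Real.exp_add, neg_add_cancel, Real.exp_zero, one_mul]
  | succ j ih =>
    rw [← ih, evolve, propagate, hfix]
    refine Finset.sum_congr rfl fun x _ => ?_
    rw [← mul_assoc, ← Real.exp_add]
    congr 2
    ring

variable [MeasurableSpace S] [DiscreteMeasurableSpace S]

lemma pathLaw_univ (hJ : IsStep J s T N) (hT : 0 ≤ T) {q : S → ℝ} (hq : ∀ x, 0 ≤ q x) :
    X.pathLaw s (s + (N + 1) * T) (fun t => γ (J t)) q Set.univ = ENNReal.ofReal (∑ x, q x) := by
  have h := X.lintegral_pathLaw (γ := γ) hJ hT hq (f := fun _ => 1) (fun _ => zero_le_one) 0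
  simp only [zero_mul, Real.exp_zero, mul_one, ENNReal.ofReal_one, lintegral_one, zero_add,
    one_mul] at h
  rw [h, X.sum_evolve_half]

lemma pathLaw_initial (hJ : IsStep J s T N) (hT : 0 ≤ T) {q : S → ℝ} (hq : ∀ x, 0 ≤ q x) (x : S) :
    X.pathLaw s (s + (N + 1) * T) (fun t => γ (J t)) q {p | p.initial = x} =
      ENNReal.ofReal (q x) := by
  have hq' : ∀ y, 0 ≤ (Pi.single x (q x) : S → ℝ) y := fun y => by
    rw [Pi.single_apply]; split_ifs <;> simp [hq]
  have h := X.pathLaw_univ (γ := γ) hJ hT hq'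
  rw [Finset.sum_pi_single' x (q x) Finset.univ, if_pos (Finset.mem_univ x)] at h
  have hset : MeasurableSet {p : Path S | p.initial = x} :=
    measurable_initial (MeasurableSet.of_discrete (s := {x}))
  rw [← h, pathLaw, pathLaw, withDensity_apply _ hset, withDensity_apply _ MeasurableSet.univ,
    Measure.restrict_univ, ← lintegral_indicator hset]
  refine lintegral_congr fun p => ?_
  by_cases hp : p.initial = x
  · rw [Set.indicator_of_mem (by exact hp), hp, Pi.single_eq_same]
  · rw [Set.indicator_of_notMem (by exact hp), Pi.single_eq_of_ne hp, zero_mul, ENNReal.ofReal_zero]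

lemma pathLaw_final (hJ : IsStep J s T N) (hT : 0 ≤ T) {q : S → ℝ} (hq : ∀ x, 0 ≤ q x) (y : S) :
    X.pathLaw s (s + (N + 1) * T) (fun t => γ (J t)) q {p | p.final = y} =
      ENNReal.ofReal (Real.exp (-(M.β / 2 * X.H (γ N).ν y)) * X.evolve γ T q (1 / 2) N y) := by
  have hf : ∀ z, 0 ≤ (Pi.single y 1 : S → ℝ) z := fun z => by
    rw [Pi.single_apply]; split_ifs <;> simp
  have h := X.lintegral_pathLaw (γ := γ) hJ hT hq hf 0
  rw [Finset.sum_eq_single y (fun z _ hz => by simp [hz]) (by simp)] at h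
  simp only [zero_mul, Real.exp_zero, Pi.single_eq_same, zero_add, one_mul] at h
  have hset : MeasurableSet {p : Path S | p.final = y} :=
    measurable_final (MeasurableSet.of_discrete (s := {y}))
  rw [← h, ← lintegral_indicator_one hset]
  refine lintegral_congr fun p => ?_
  by_cases hp : p.final = y
  · rw [Set.indicator_of_mem (by exact hp), hp, Pi.single_eq_same, Pi.one_apply, ENNReal.ofReal_one]
  · rw [Set.indicator_of_notMem (by exact hp), Pi.single_eq_of_ne hp, ENNReal.ofReal_zero]

omit [DecidableEq S] in
/-- The expectation of a function of a random variable with finitely many values. -/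
lemma integral_comp_eq_sum {Ω : Type*} [MeasurableSpace Ω] {μ : Measure Ω} [IsFiniteMeasure μ]
    {Y : Ω → S} (hY : Measurable Y) (g : S → ℝ) :
    Integrable (fun ω => g (Y ω)) μ ∧ ∫ ω, g (Y ω) ∂μ = ∑ y, μ.real {ω | Y ω = y} * g y := by
  have hg : AEStronglyMeasurable g (μ.map Y) :=
    (Measurable.of_discrete (f := g)).aestronglyMeasurable
  refine ⟨(integrable_map_measure hg hY.aemeasurable).1 Integrable.of_finite, ?_⟩
  rw [← integral_map hY.aemeasurable hg, integral_fintype Integrable.of_finite]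
  refine Finset.sum_congr rfl fun y _ => ?_
  rw [map_measureReal_apply hY (MeasurableSet.of_discrete), smul_eq_mul]
  rfl

variable [Nonempty S] {τ : ℝ}

lemma isProbabilityMeasure_steadyLaw (hJ : IsStep J (-τ) T N) (hT : 0 ≤ T)
    (hτ : -τ + (N + 1) * T = τ) : IsProbabilityMeasure (X.steadyLaw τ fun t => γ (J t)) := by
  have hρ := X.stationary_spec (γ (J (-τ)))
  have h := X.pathLaw_univ (γ := γ) hJ hT hρ.1
  rw [hτ, hρ.2.1, ENNReal.ofReal_one] at h
  exact ⟨h⟩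

lemma integrable_exp_steadyLaw (hJ : IsStep J (-τ) T N) (hT : 0 ≤ T)
    (hτ : -τ + (N + 1) * T = τ) (u : ℝ) :
    Integrable (fun p => Real.exp (u * (M.β * X.W (-τ) τ (fun t => γ (J t)) p +
      X.Ψ (fun t => γ (J t)) p))) (X.steadyLaw τ fun t => γ (J t)) := by
  have h := (X.integral_pathLaw (γ := γ) hJ hT (X.stationary_spec (γ (J (-τ)))).1
    (f := fun _ => 1) (fun _ => zero_le_one) u).1
  simp only [hτ, mul_one] at h
  exact h

lemma integrableExpSet_steadyLaw (hJ : IsStep J (-τ) T N) (hT : 0 ≤ T)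
    (hτ : -τ + (N + 1) * T = τ) :
    interior (integrableExpSet (fun p => M.β * X.W (-τ) τ (fun t => γ (J t)) p +
      X.Ψ (fun t => γ (J t)) p) (X.steadyLaw τ fun t => γ (J t))) = Set.univ := by
  rw [Set.eq_univ_of_forall (s := integrableExpSet _ _)
    fun u => X.integrable_exp_steadyLaw hJ hT hτ u, interior_univ]

lemma cgf_steadyLaw (hJ : IsStep J (-τ) T N) (hT : 0 ≤ T) (hτ : -τ + (N + 1) * T = τ) :
    cgf (fun p => M.β * X.W (-τ) τ (fun t => γ (J t)) p + X.Ψ (fun t => γ (J t)) p)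
      (X.steadyLaw τ fun t => γ (J t)) = fun u => Real.log (X.genFun γ N T (u + 1 / 2)) := by
  ext u
  have h := (X.integral_pathLaw (γ := γ) hJ hT (X.stationary_spec (γ (J (-τ)))).1
    (f := fun _ => 1) (fun _ => zero_le_one) u).2
  simp only [hτ, mul_one, one_mul] at h
  have h' : ∑ y, Real.exp (-(M.β / 2 * X.H (γ N).ν y)) *
      X.evolve γ T (X.stationary (γ (J (-τ)))) (u + 1 / 2) N y = X.genFun γ N T (u + 1 / 2) := by
    simp only [genFun, hJ.left]
  rw [cgf, mgf, ← h', ← h]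
  rfl

lemma contDiff_log_genFun (hJ : IsStep J (-τ) T N) (hT : 0 ≤ T) (hτ : -τ + (N + 1) * T = τ)
    (k : ℕ) : ContDiff ℝ k fun p => Real.log (X.genFun γ N T p) := by
  have h : ContDiff ℝ k fun u => Real.log (X.genFun γ N T (u + 1 / 2)) := by
    rw [← X.cgf_steadyLaw hJ hT hτ, contDiff_iff_contDiffAt]
    refine fun u => (analyticAt_cgf ?_).contDiffAt
    rw [X.integrableExpSet_steadyLaw hJ hT hτ]
    trivial
  have h2 := h.comp (f := fun p : ℝ => p - 1 / 2) (by fun_prop)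
  simpa [Function.comp_def] using h2

lemma workCumulant_eq (hJ : IsStep J (-τ) T N) (hT : 0 ≤ T) (hτ : -τ + (N + 1) * T = τ) (k : ℕ) :
    X.workCumulant k τ (fun t => γ (J t)) =
      iteratedDeriv k (fun p => Real.log (X.genFun γ N T p)) (1 / 2) := by
  rw [workCumulant, cumulant, X.cgf_steadyLaw hJ hT hτ,
    iteratedDeriv_comp_add_const k (fun p => Real.log (X.genFun γ N T p)) (1 / 2)]
  simp

/-- The mean entropy production is the first cumulant of `β W + Ψ` minus the mean energy difference
between the final and the initial state. -/
lemma meanΘ_eq (hJ : IsStep J (-τ) T N) (hT : 0 ≤ T) (hτ : -τ + (N + 1) * T = τ) :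
    X.meanΘ τ (fun t => γ (J t)) = X.workCumulant 1 τ (fun t => γ (J t)) -
      M.β * (∑ y, Real.exp (-(M.β / 2 * X.H (γ N).ν y)) *
        X.evolve γ T (X.stationary (γ 0)) (1 / 2) N y * X.H (γ N).ν y -
        ∑ x, X.stationary (γ 0) x * X.H (γ 0).ν x) := by
  have := X.isProbabilityMeasure_steadyLaw (γ := γ) hJ hT hτ
  have hρ := X.stationary_spec (γ 0)
  have h0 : (0 : ℝ) ∈ interior (integrableExpSet (fun p => M.β * X.W (-τ) τ (fun t => γ (J t)) p +
      X.Ψ (fun t => γ (J t)) p) (X.steadyLaw τ fun t => γ (J t))) := by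
    rw [X.integrableExpSet_steadyLaw hJ hT hτ]
    trivial
  have hc : X.workCumulant 1 τ (fun t => γ (J t)) = ∫ p, (M.β * X.W (-τ) τ (fun t => γ (J t)) p +
      X.Ψ (fun t => γ (J t)) p) ∂X.steadyLaw τ fun t => γ (J t) := by
    rw [workCumulant, cumulant, iteratedDeriv_one, deriv_cgf_zero h0, probReal_univ, div_one]
  have hi := integrable_of_mem_interior_integrableExpSet h0
  obtain ⟨hf1, hf2⟩ := integral_comp_eq_sum (μ := X.steadyLaw τ fun t => γ (J t)) measurable_final
    (X.H (γ N).ν)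
  obtain ⟨hg1, hg2⟩ := integral_comp_eq_sum (μ := X.steadyLaw τ fun t => γ (J t))
    measurable_initial (X.H (γ 0).ν)
  have hright : J τ = N := by rw [← hJ.right, hτ]
  have hfin : ∀ y, (X.steadyLaw τ fun t => γ (J t)).real {p | p.final = y} =
      Real.exp (-(M.β / 2 * X.H (γ N).ν y)) *
        X.evolve γ T (X.stationary (γ 0)) (1 / 2) N y := by
    intro y
    have h := X.pathLaw_final (γ := γ) hJ hT hρ.1 y
    rw [hτ] at h
    rw [measureReal_def, steadyLaw, hJ.left, h, ENNReal.toReal_ofReal]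
    exact mul_nonneg (Real.exp_pos _).le (X.evolve_nonneg γ hT hρ.1 _ _ y)
  have hini : ∀ x, (X.steadyLaw τ fun t => γ (J t)).real {p | p.initial = x} =
      X.stationary (γ 0) x := by
    intro x
    have h := X.pathLaw_initial (γ := γ) hJ hT hρ.1 x
    rw [hτ] at h
    rw [measureReal_def, steadyLaw, hJ.left, h, ENNReal.toReal_ofReal (hρ.1 x)]
  simp only [hfin] at hf2
  simp only [hini] at hg2
  have hfg : Integrable (fun p : Path S => M.β * (X.H (γ N).ν p.final - X.H (γ 0).ν p.initial))
      (X.steadyLaw τ fun t => γ (J t)) := (hf1.sub hg1).const_mul _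
  rw [meanΘ, hc, ← hf2, ← hg2, ← integral_sub hf1 hg1, ← integral_const_mul, ← integral_sub hi hfg]
  refine integral_congr_ae (Eventually.of_forall fun p => ?_)
  simp only [X.Θ_eq (-τ) τ, hright, hJ.left]

omit [MeasurableSpace S] [DiscreteMeasurableSpace S] in
/-- For slow steps the final state is distributed according to the steady state. -/
lemma tendsto_evolve_half (γ : ℕ → Param d m) (N : ℕ) (y : S) :
    Tendsto (fun T => Real.exp (-(M.β / 2 * X.H (γ N).ν y)) *
      X.evolve γ T (X.stationary (γ 0)) (1 / 2) N y) atTop (𝓝 (X.stationary (γ N) y)) := by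
  have hK : ∀ j, Tendsto
      (fun T : ℝ => exp (T • M.hat (γ j).ε (X.coord (γ j)) ((γ j).ε * (1 / 2)))) atTop
      (𝓝 (Matrix.vecMulVec (M.phi (γ j).ε (X.coord (γ j)) (-((γ j).ε / 2)))
        (M.phi (γ j).ε (X.coord (γ j)) ((γ j).ε / 2)))) := by
    intro j
    have h := (M.isPerron_phi (γ j).ε (X.coord (γ j)) ((γ j).ε / 2)).tendsto
    rw [X.mu_half, zero_smul, sub_zero] at h
    rwa [mul_one_div]
  have h1 := fun y => (tendsto_propagate (f := atTop) (N := N)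
    (v := fun x => Real.exp (M.β / 2 * X.H (γ 0).ν x) * X.stationary (γ 0) x) (fun j _ => hK j)
    (D := fun _ j x => Real.exp (1 / 2 * M.β * (X.H (γ (j + 1)).ν x - X.H (γ j).ν x)))
    (fun _ _ _ => tendsto_const_nhds) y).const_mul (Real.exp (-(M.β / 2 * X.H (γ N).ν y)))
  simp only [propagate_vecMulVec] at h1
  set c : ℝ := (∏ j ∈ Finset.range N, ∑ x, M.phi (γ (j + 1)).ε (X.coord (γ (j + 1)))
      ((γ (j + 1)).ε / 2) x * (Real.exp (1 / 2 * M.β * (X.H (γ (j + 1)).ν x - X.H (γ j).ν x)) *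
      M.phi (γ j).ε (X.coord (γ j)) (-((γ j).ε / 2)) x)) *
    ∑ x, M.phi (γ 0).ε (X.coord (γ 0)) ((γ 0).ε / 2) x *
      (Real.exp (M.β / 2 * X.H (γ 0).ν x) * X.stationary (γ 0) x) with hc
  have h2 : ∀ y, Tendsto (fun T => Real.exp (-(M.β / 2 * X.H (γ N).ν y)) *
      X.evolve γ T (X.stationary (γ 0)) (1 / 2) N y) atTop
      (𝓝 (X.norm (γ N) * c * X.stationary (γ N) y)) := by
    intro y
    have e : X.norm (γ N) * c * X.stationary (γ N) y = Real.exp (-(M.β / 2 * X.H (γ N).ν y)) *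
        (M.phi (γ N).ε (X.coord (γ N)) (-((γ N).ε / 2)) y * c) := by
      rw [X.stationary_eq]
      field_simp [(X.norm_pos (γ N)).ne']
    rw [e]
    have h3 := h1 y
    rw [mul_assoc (M.phi _ _ _ y), ← hc] at h3
    exact h3
  have h3 := tendsto_finsetSum Finset.univ fun y _ => h2 y
  simp only [X.sum_evolve_half, ← Finset.mul_sum, (X.stationary_spec _).2.1, mul_one] at h3
  have h4 := tendsto_nhds_unique h3 tendsto_const_nhds
  simpa only [h4, one_mul] using h2 y

end Model
end SST

namespace SST

/-! ### The step protocol -/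

/-- The parameters on the `j`-th step. -/
noncomputable def stepParam {d m : ℕ} (ε : ℝ) (ν ν' : EuclideanSpace ℝ (Fin d))
    (κ κ' : EuclideanSpace ℝ (Fin m)) (N j : ℕ) : Param d m where
  ε := ε
  ν := (N : ℝ)⁻¹ • (((N : ℝ) - j) • ν + (j : ℝ) • ν')
  κ := (N : ℝ)⁻¹ • (((N : ℝ) - j) • κ + (j : ℝ) • κ')

lemma inv_smul_eq_lineMap {E : Type*} [AddCommGroup E] [Module ℝ E] (v v' : E) {N : ℕ}
    (hN : 1 ≤ N) (j : ℕ) : (N : ℝ)⁻¹ • (((N : ℝ) - j) • v + (j : ℝ) • v') =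
      AffineMap.lineMap v v' ((j : ℝ) / N) := by
  have hN' : (N : ℝ) ≠ 0 := Nat.cast_ne_zero.2 (by omega)
  rw [AffineMap.lineMap_apply_module, smul_add, smul_smul, smul_smul]
  congr 2 <;> field_simp

lemma stepParam_eq {d m : ℕ} (ε : ℝ) (ν ν' : EuclideanSpace ℝ (Fin d))
    (κ κ' : EuclideanSpace ℝ (Fin m)) {N : ℕ} (hN : 1 ≤ N) (j : ℕ) :
    stepParam ε ν ν' κ κ' N j = ⟨ε, AffineMap.lineMap ν ν' ((j : ℝ) / N),
      AffineMap.lineMap κ κ' ((j : ℝ) / N)⟩ := by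
  rw [stepParam, inv_smul_eq_lineMap _ _ hN, inv_smul_eq_lineMap _ _ hN]

/-- The number of the step to which the time `t` belongs. -/
noncomputable def stepIndex (N : ℕ) (τ t : ℝ) : ℕ := min N ⌊(t + τ) * (N + 1) / (2 * τ)⌋₊

lemma isStep_stepIndex (N : ℕ) {τ : ℝ} (hτ : 0 < τ) :
    IsStep (stepIndex N τ) (-τ) (2 * τ / (N + 1)) N where
  meas := measurable_const.min (Nat.measurable_floor.comp (by fun_prop))
  le t := min_le_left _ _
  left := by simp [stepIndex]
  right := by
    have h : (-τ + (N + 1) * (2 * τ / (N + 1)) + τ) * (N + 1) / (2 * τ) = ((N + 1 : ℕ) : ℝ) := by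
      push_cast
      field_simp
      ring
    rw [stepIndex, h, Nat.floor_natCast]
    omega
  mid j hj t ht := by
    have hN : (0 : ℝ) < N + 1 := by positivity
    have h : ⌊(t + τ) * (N + 1) / (2 * τ)⌋₊ = j := by
      have h1 := ht.1
      have h2 := ht.2
      have e : ∀ c : ℝ, c * (2 * τ / (N + 1)) = c * (2 * τ) / (N + 1) := fun c => by ring
      rw [e, ← sub_pos] at h1
      rw [e, ← sub_pos] at h2
      have h1' := mul_pos h1 hN
      have h2' := mul_pos h2 hN
      have e1 : (t - (-τ + j * (2 * τ) / (N + 1))) * (N + 1) =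
          (t + τ) * (N + 1) - j * (2 * τ) := by field_simp; ring
      have e2 : (-τ + (j + 1) * (2 * τ) / (N + 1) - t) * (N + 1) =
          (j + 1) * (2 * τ) - (t + τ) * (N + 1) := by field_simp; ring
      rw [e1] at h1'
      rw [e2] at h2'
      rw [Nat.floor_eq_iff (by
        refine div_nonneg ?_ (by positivity)
        have : 0 ≤ (j : ℝ) * (2 * τ) := by positivity
        linarith)]
      constructor
      · rw [le_div_iff₀ (by positivity)]; linarith
      · rw [div_lt_iff₀ (by positivity)]; linarith
    rw [stepIndex, h, min_eq_right hj]

lemma IsStep.reverse {J : ℝ → ℕ} {T τ : ℝ} {N : ℕ} (hJ : IsStep J (-τ) T N)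
    (hτ : -τ + (N + 1) * T = τ) : IsStep (fun t => N - J (-t)) (-τ) T N where
  meas := (Measurable.of_discrete (f := fun i : ℕ => N - i)).comp (hJ.meas.comp measurable_neg)
  le t := Nat.sub_le _ _
  left := by
    have h := hJ.right
    rw [hτ] at h
    simp [h]
  right := by
    rw [hτ, hJ.left, Nat.sub_zero]
  mid j hj t ht := by
    have h := hJ.mid (N - j) (Nat.sub_le _ _) (-t) (by
      rw [Nat.cast_sub hj]
      constructor
      · linarith [ht.2]
      · linarith [ht.1])
    simp only [h]
    omega

namespace Model

variable {S : Type*} [Fintype S] [DecidableEq S] [Nonempty S] {M : ModelClass S} {d m : ℕ}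
  (X : Model M d m)

section Limits

variable [MeasurableSpace S] [DiscreteMeasurableSpace S] (ε : ℝ)
  (ν ν' : EuclideanSpace ℝ (Fin d)) (κ κ' : EuclideanSpace ℝ (Fin m))

lemma reversed_stepProtocol (N : ℕ) (τ : ℝ) : reversed (stepProtocol ε ν ν' κ κ' N τ) =
    fun t => stepParam ε ν ν' κ κ' N (N - (N - stepIndex N τ (-t))) := by
  ext1 t
  have h : N - (N - stepIndex N τ (-t)) = stepIndex N τ (-t) := Nat.sub_sub_self (min_le_left _ _)
  rw [h]
  rfl

lemma tendsto_stepLength (N : ℕ) :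
    Tendsto (fun τ : ℝ => 2 * τ / (N + 1)) atTop atTop :=
  (tendsto_id.const_mul_atTop two_pos).atTop_div_const (by positivity)

/-- The differences between the cumulants converge for slow steps to derivatives of `limitFun`. -/
theorem tendsto_workCumulant_sub (N k : ℕ) :
    Tendsto (fun τ => X.workCumulant k τ (stepProtocol ε ν ν' κ κ' N τ) -
      X.workCumulant k τ (reversed (stepProtocol ε ν ν' κ κ' N τ))) atTop
      (𝓝 (iteratedDeriv k (X.limitFun (stepParam ε ν ν' κ κ' N) N) (1 / 2))) := by
  have h := (X.tendsto_iteratedDeriv_log_genFun (γ := stepParam ε ν ν' κ κ' N) (ε := ε)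
    (fun j => rfl) N k (1 / 2)).comp (tendsto_stepLength N)
  refine h.congr' ?_
  filter_upwards [eventually_gt_atTop 0] with τ hτ
  have hJ := isStep_stepIndex N hτ
  have hT : 0 ≤ 2 * τ / ((N : ℝ) + 1) := by positivity
  have hTτ : -τ + (N + 1) * (2 * τ / ((N : ℝ) + 1)) = τ := by field_simp; ring
  have hJ' := hJ.reverse hTτ
  rw [reversed_stepProtocol,
    X.workCumulant_eq (γ := fun j => stepParam ε ν ν' κ κ' N (N - j)) hJ' hT hTτ k]
  change _ = X.workCumulant k τ (fun t => stepParam ε ν ν' κ κ' N (stepIndex N τ t)) - _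
  rw [X.workCumulant_eq hJ hT hTτ k, Function.comp_apply,
    iteratedDeriv_fun_sub (X.contDiff_log_genFun hJ hT hTτ k).contDiffAt
      (X.contDiff_log_genFun hJ' hT hTτ k).contDiffAt]

theorem tendsto_truncatedSum (n N : ℕ) :
    Tendsto (fun τ => X.truncatedSum n τ (stepProtocol ε ν ν' κ κ' N τ)) atTop
      (𝓝 (∑ k ∈ Finset.Icc 1 (2 * n - 1), (-1 : ℝ) ^ k / (2 ^ k * (k.factorial : ℝ)) *
        iteratedDeriv k (X.limitFun (stepParam ε ν ν' κ κ' N) N) (1 / 2))) :=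
  tendsto_finsetSum _ fun k _ => (X.tendsto_workCumulant_sub ε ν ν' κ κ' N k).const_mul _

/-- The mean entropy productions converge for slow steps: the initial and the final distribution are
the steady states at the two ends. -/
theorem tendsto_meanΘ_sub (N : ℕ) :
    Tendsto (fun τ => (X.meanΘ τ (stepProtocol ε ν ν' κ κ' N τ) -
      X.meanΘ τ (reversed (stepProtocol ε ν ν' κ κ' N τ))) / 2) atTop
      (𝓝 (iteratedDeriv 1 (X.limitFun (stepParam ε ν ν' κ κ' N) N) (1 / 2) / 2 - M.β *
        (∑ x, X.H (stepParam ε ν ν' κ κ' N N).ν x * X.stationary (stepParam ε ν ν' κ κ' N N) x -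
        ∑ x, X.H (stepParam ε ν ν' κ κ' N 0).ν x *
          X.stationary (stepParam ε ν ν' κ κ' N 0) x))) := by
  set γ := stepParam ε ν ν' κ κ' N with hγ
  have hE : ∀ γ : ℕ → Param d m, Tendsto (fun τ : ℝ => ∑ y, Real.exp (-(M.β / 2 * X.H (γ N).ν y)) *
      X.evolve γ (2 * τ / (N + 1)) (X.stationary (γ 0)) (1 / 2) N y * X.H (γ N).ν y) atTop
      (𝓝 (∑ x, X.H (γ N).ν x * X.stationary (γ N) x)) := fun γ => by
    simp only [mul_comm (X.H (γ N).ν _)]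
    exact tendsto_finsetSum _ fun y _ =>
      ((X.tendsto_evolve_half γ N y).comp (tendsto_stepLength N)).mul_const _
  have h1 := hE γ
  have h2 := hE fun j => γ (N - j)
  simp only [Nat.sub_self, Nat.sub_zero] at h2
  have h := (((X.tendsto_workCumulant_sub ε ν ν' κ κ' N 1).sub
    (((h1.sub_const (∑ x, X.stationary (γ 0) x * X.H (γ 0).ν x)).sub
      (h2.sub_const (∑ x, X.stationary (γ N) x * X.H (γ N).ν x))).const_mul M.β)).div_const 2)
  refine (h.congr' ?_).trans (le_of_eq ?_)
  · filter_upwards [eventually_gt_atTop 0] with τ hτ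
    have hJ := isStep_stepIndex N hτ
    have hT : 0 ≤ 2 * τ / ((N : ℝ) + 1) := by positivity
    have hTτ : -τ + (N + 1) * (2 * τ / ((N : ℝ) + 1)) = τ := by field_simp; ring
    have hJ' := hJ.reverse hTτ
    rw [reversed_stepProtocol, X.meanΘ_eq (γ := fun j => γ (N - j)) hJ' hT hTτ]
    change _ = (X.meanΘ τ (fun t => γ (stepIndex N τ t)) - _) / 2
    rw [X.meanΘ_eq (γ := γ) hJ hT hTτ]
    simp only [Nat.sub_self, Nat.sub_zero]
    change ((X.workCumulant 1 τ fun t => γ (stepIndex N τ t)) - _ - _) / 2 = _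
    ring
  · congr 1
    simp only [mul_comm (X.stationary _ _)]
    ring

end Limits

/-! ### The Taylor remainder of the limit -/

/-- The cumulants at `p = 1 / 2` are the Taylor coefficients of `limitFun`, whose value at `p = 0`
is the difference between the free energies. -/
theorem taylorRem_limitFun [MeasurableSpace S] [DiscreteMeasurableSpace S] {γ : ℕ → Param d m}
    {ε : ℝ} (hγ : ∀ j, (γ j).ε = ε) (N : ℕ) {n : ℕ} (hn : 1 ≤ n) :
    taylorRem n (X.limitFun γ N) = M.β * (X.freeEnergy (γ 0) - X.freeEnergy (γ N)) -
      ∑ k ∈ Finset.Icc 1 (2 * n - 1), (-1 : ℝ) ^ k / (2 ^ k * (k.factorial : ℝ)) *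
        iteratedDeriv k (X.limitFun γ N) (1 / 2) := by
  have h0 : X.limitFun γ N 0 = M.β * (X.freeEnergy (γ 0) - X.freeEnergy (γ N)) := by
    simp only [limitFun, M.stepFun_zero, Finset.sum_const_zero, add_zero, mul_sub, X.freeEnergy_eq]
  have hhalf : X.limitFun γ N (1 / 2) = 0 := by
    have hb : ∀ α, X.boundary α (1 / 2) = -2 * Real.log (X.norm α) := fun α => by
      rw [boundary, ModelClass.bdry, mul_one_div]
      simp only [mul_comm (M.phi α.ε (X.coord α) (-(α.ε / 2)) _), sub_self]
      ring
    have hs : ∀ j, M.stepFun (γ 0).ε (X.coord (γ j)) (X.coord (γ (j + 1))) (1 / 2) =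
        2 * Real.log (X.norm (γ j)) - 2 * Real.log (X.norm (γ (j + 1))) := fun j => by
      have h1 := X.log_overlap_half (α := γ j) (α' := γ (j + 1)) (by rw [hγ, hγ])
      have h2 := X.log_overlap_half (α := γ (j + 1)) (α' := γ j) (by rw [hγ, hγ])
      rw [hγ] at h1 h2
      rw [ModelClass.stepFun, M.overlap_neg, hγ, h1, h2]
      ring
    rw [limitFun, hb, hb, Finset.sum_congr rfl fun j _ => hs j, Finset.sum_range_sub']
    ring
  have hI : Finset.Icc 1 (2 * n - 1) = Finset.Ico 1 (2 * n) := by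
    ext k
    simp only [Finset.mem_Icc, Finset.mem_Ico]
    omega
  rw [taylorRem, h0, hI, Finset.range_eq_Ico, Finset.sum_eq_sum_Ico_succ_bot (by omega),
    iteratedDeriv_zero, hhalf, mul_zero, zero_add]
  congr 1
  refine Finset.sum_congr rfl fun k _ => ?_
  rw [div_pow, div_div]

/-- The remainder is the sum of a boundary term and the remainders of the steps. -/
lemma taylorRem_limitFun_eq {γ : ℕ → Param d m} {ε : ℝ} (hγ : ∀ j, (γ j).ε = ε) (N : ℕ) {n : ℕ}
    (hn : 1 ≤ n) :
    taylorRem n (X.limitFun γ N) =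
      taylorRem n (fun p => M.bdry ε (X.coord (γ 0)) p - M.bdry ε (X.coord (γ N)) p) +
      ∑ j ∈ Finset.range N, M.stepRem n ε (X.coord (γ j)) (X.coord (γ (j + 1))) := by
  have hconst : ∀ c : ℝ, taylorRem n (fun _ => c) = 0 := fun c => by
    rw [taylorRem, Finset.sum_eq_single 0 (fun k _ hk => by
      rw [iteratedDeriv_const, if_neg hk, mul_zero]) (fun h => absurd (Finset.mem_range.2 (by omega)) h)]
    simp
  have e : X.limitFun γ N = fun p => (M.bdry ε (X.coord (γ 0)) p - M.bdry ε (X.coord (γ N)) p) +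
      ((2 * Real.log (X.norm (γ N)) - 2 * Real.log (X.norm (γ 0))) +
        ∑ j ∈ Finset.range N, M.stepFun ε (X.coord (γ j)) (X.coord (γ (j + 1))) p) := by
    ext p
    simp only [limitFun, boundary, hγ]
    ring
  rw [e, taylorRem_add ((M.contDiff_bdry _ _).sub (M.contDiff_bdry _ _)) (contDiff_const.add
    (ContDiff.sum fun j _ => M.contDiff_stepFun_right _ _ _)), taylorRem_add contDiff_const
    (ContDiff.sum fun j _ => M.contDiff_stepFun_right _ _ _), hconst, zero_add,
    taylorRem_sum _ fun j => M.contDiff_stepFun_right _ _ _]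
  rfl

end Model

/-- The Taylor remainder converges along refined partitions of a Lipschitz path; the second order
terms of the steps disappear in the limit, which gives a bound uniform over the models. -/
theorem ModelClass.exists_partition_bound {S : Type*} [Fintype S] [DecidableEq S] [Nonempty S]
    (M : ModelClass S) {n : ℕ} (hn : 1 ≤ n) (E₀ R : ℝ) :
    ∃ C : ℝ, 0 ≤ C ∧ ∀ ε ∈ Set.Icc 0 E₀, ∀ (z : ℝ → Coord S) (a b : ℝ), 0 ≤ a → 0 ≤ b →
      (∀ t ∈ Set.Icc (0 : ℝ) 1, z t ∈ Metric.closedBall (0 : Coord S) R) →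
      (∀ s ∈ Set.Icc (0 : ℝ) 1, ∀ t ∈ Set.Icc (0 : ℝ) 1, s ≤ t →
        ‖(z t).1 - (z s).1‖ ≤ a * (t - s) ∧ ‖(z t).2 - (z s).2‖ ≤ b * (t - s)) →
      ∃ r, Tendsto (fun N : ℕ => taylorRem n (fun p => M.bdry ε (z 0) p - M.bdry ε (z 1) p) +
        ∑ j ∈ Finset.range N, M.stepRem n ε (z (j / N)) (z ((j + 1) / N))) atTop (𝓝 r) ∧
        |r| ≤ C * ε ^ (2 * n) * (a + ε * b) := by
  obtain ⟨C₁, hC₁, h₁⟩ := M.exists_bdry_bound hn E₀ R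
  obtain ⟨C₂, hC₂, h₂⟩ := M.exists_stepRem_bound hn E₀ R
  refine ⟨C₁ * (|E₀| + 1) + C₂, by positivity, fun ε hε z a b ha hb hz hL => ?_⟩
  obtain ⟨C', hC', h₃⟩ := h₂ ε hε
  obtain ⟨D, hD, h₄⟩ := exists_defect_le
    ((M.contDiff_stepRem n ε).of_le (WithTop.coe_le_coe.2 (le_top : (2 : ℕ∞) ≤ ⊤)))
    (M.stepRem_self n ε) (isCompact_closedBall (0 : Coord S) R) (convex_closedBall _ _)
  have hn' : ∀ s ∈ Set.Icc (0 : ℝ) 1, ∀ t ∈ Set.Icc (0 : ℝ) 1, s ≤ t →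
      ‖z t - z s‖ ≤ (a + b) * (t - s) := by
    intro s hs t ht hst
    obtain ⟨h1, h2⟩ := hL s hs t ht hst
    have hst' : 0 ≤ t - s := sub_nonneg.2 hst
    refine (norm_prod_le_iff.2 ⟨h1.trans ?_, h2.trans ?_⟩) <;>
      nlinarith [mul_nonneg ha hst', mul_nonneg hb hst']
  have h01 : (0 : ℝ) ∈ Set.Icc (0 : ℝ) 1 := ⟨le_rfl, zero_le_one⟩
  have h11 : (1 : ℝ) ∈ Set.Icc (0 : ℝ) 1 := ⟨zero_le_one, le_rfl⟩
  obtain ⟨l, hl⟩ := exists_tendsto_partition_sum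
    (Ξ := fun s t => M.stepRem n ε (z s) (z t)) (C := D * (a + b) ^ 2) (by positivity)
    (fun s u t h0 hsu hut ht1 => by
      have hs : s ∈ Set.Icc (0 : ℝ) 1 := ⟨h0, by linarith⟩
      have hu : u ∈ Set.Icc (0 : ℝ) 1 := ⟨by linarith, by linarith⟩
      have ht : t ∈ Set.Icc (0 : ℝ) 1 := ⟨by linarith, ht1⟩
      refine (h₄ _ (hz s hs) _ (hz u hu) _ (hz t ht)).trans ?_
      have k1 := hn' s hs u hu hsu
      have k2 := hn' u hu t ht hut
      calc D * ‖z u - z s‖ * ‖z t - z u‖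
          ≤ D * ((a + b) * (u - s)) * ((a + b) * (t - u)) := by gcongr
        _ = _ := by ring)
  refine ⟨_, hl.const_add _, ?_⟩
  have hl2 : |l| ≤ C₂ * ε ^ (2 * n) * (a + ε * b) := by
    have hlim : Tendsto (fun N : ℕ => C₂ * ε ^ (2 * n) * (a + ε * b) + C' * (a + b) ^ 2 * (1 / (N : ℝ)))
        atTop (𝓝 (C₂ * ε ^ (2 * n) * (a + ε * b) + C' * (a + b) ^ 2 * 0)) :=
      (tendsto_one_div_atTop_nhds_zero_nat.const_mul _).const_add _
    rw [mul_zero, add_zero] at hlim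
    refine le_of_tendsto_of_tendsto hl.abs hlim ?_
    filter_upwards [eventually_ge_atTop 1] with N hN
    have hN' : (0 : ℝ) < N := by exact_mod_cast hN
    have hstep : ∀ j ∈ Finset.range N, |M.stepRem n ε (z (j / N)) (z ((j + 1) / N))| ≤
        C₂ * ε ^ (2 * n) * (a + ε * b) * (1 / N) + C' * (a + b) ^ 2 * (1 / N) ^ 2 := by
      intro j hj
      have hj' : (j : ℝ) + 1 ≤ N := by exact_mod_cast Finset.mem_range.1 hj
      have hs : (j : ℝ) / N ∈ Set.Icc (0 : ℝ) 1 :=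
        ⟨by positivity, (div_le_one hN').2 (by linarith)⟩
      have ht : ((j : ℝ) + 1) / N ∈ Set.Icc (0 : ℝ) 1 := ⟨by positivity, (div_le_one hN').2 hj'⟩
      have hst : (j : ℝ) / N ≤ (j + 1) / N := by gcongr; linarith
      have hsub : ((j : ℝ) + 1) / N - j / N = 1 / N := by ring
      have k := h₃ _ (hz _ hs) _ (hz _ ht)
      obtain ⟨k1, k2⟩ := hL _ hs _ ht hst
      have k3 := hn' _ hs _ ht hst
      rw [hsub] at k1 k2 k3
      have hε0 := hε.1
      calc _ ≤ _ := k
        _ ≤ C₂ * ε ^ (2 * n) * (a * (1 / N) + ε * (b * (1 / N))) +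
            C' * ((a + b) * (1 / N)) ^ 2 := by gcongr
        _ = _ := by ring
    calc _ ≤ ∑ j ∈ Finset.range N, |M.stepRem n ε (z (j / N)) (z ((j + 1) / N))| :=
          Finset.abs_sum_le_sum_abs _ _
      _ ≤ _ := Finset.sum_le_sum hstep
      _ = _ := by
        rw [Finset.sum_const, Finset.card_range, nsmul_eq_mul]
        field_simp
  have k := h₁ ε hε (z 1) (hz 1 h11) (z 0) (hz 0 h01)
  have k2 := hn' 0 h01 1 h11 zero_le_one
  rw [sub_zero, mul_one, norm_sub_rev] at k2
  have hε0 := hε.1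
  have hεE : ε ≤ |E₀| := hε.2.trans (le_abs_self _)
  have k3 : ε * ‖z 0 - z 1‖ ≤ (|E₀| + 1) * (a + ε * b) := by
    have h1 : ε * ‖z 0 - z 1‖ ≤ ε * (a + b) := by gcongr
    nlinarith [mul_nonneg (sub_nonneg.2 hεE) ha, mul_nonneg (abs_nonneg E₀) (mul_nonneg hε0 hb)]
  calc |_ + l| ≤ _ := abs_add_le _ _
    _ ≤ C₁ * ε ^ (2 * n) * ((|E₀| + 1) * (a + ε * b)) + C₂ * ε ^ (2 * n) * (a + ε * b) :=
        add_le_add (k.trans (by gcongr)) hl2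
    _ = _ := by ring

end SST

namespace SST

namespace Model

variable {S : Type*} [Fintype S] [DecidableEq S] {M : ModelClass S} {d m : ℕ} (X : Model M d m)

/-! ### The quasi-static limit -/

/-- The coordinates along the segments between the parameters. -/
noncomputable def segmentCoord (ε : ℝ) (ν ν' : EuclideanSpace ℝ (Fin d))
    (κ κ' : EuclideanSpace ℝ (Fin m)) (t : ℝ) : Coord S :=
  X.coord ⟨ε, AffineMap.lineMap ν ν' t, AffineMap.lineMap κ κ' t⟩

lemma segmentCoord_mem {ν ν' : EuclideanSpace ℝ (Fin d)} {κ κ' : EuclideanSpace ℝ (Fin m)}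
    (hν : segment ℝ ν ν' ⊆ X.𝒩) (hκ : segment ℝ κ κ' ⊆ X.𝒦) (ε : ℝ) {t : ℝ}
    (ht : t ∈ Set.Icc (0 : ℝ) 1) :
    X.segmentCoord ε ν ν' κ κ' t ∈ Metric.closedBall (0 : Coord S) (|M.Ebar| + 1) := by
  have h1 : AffineMap.lineMap ν ν' t ∈ X.𝒩 :=
    hν (by rw [segment_eq_image_lineMap]; exact ⟨t, ht, rfl⟩)
  have h2 : AffineMap.lineMap κ κ' t ∈ X.𝒦 :=
    hκ (by rw [segment_eq_image_lineMap]; exact ⟨t, ht, rfl⟩)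
  have hE := abs_nonneg M.Ebar
  have hE' := le_abs_self M.Ebar
  rw [mem_closedBall_zero_iff, norm_prod_le_iff]
  refine ⟨(pi_norm_le_iff_of_nonneg (by positivity)).2 fun x => ?_,
    (pi_norm_le_iff_of_nonneg (by positivity)).2 fun x =>
      (pi_norm_le_iff_of_nonneg (by positivity)).2 fun y => ?_⟩
  · have := X.H_bound _ h1 x
    rw [Real.norm_eq_abs]
    exact this.trans (by linarith)
  · simp only [segmentCoord, coord]
    split_ifs with h
    · have := X.ξ_bound _ h2 x y h.1 h.2
      rw [Real.norm_eq_abs]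
      exact this.trans (by linarith)
    · rw [norm_zero]
      positivity

lemma norm_segmentCoord_sub_le {ν ν' : EuclideanSpace ℝ (Fin d)} {κ κ' : EuclideanSpace ℝ (Fin m)}
    (hν : segment ℝ ν ν' ⊆ X.𝒩) (hκ : segment ℝ κ κ' ⊆ X.𝒦) (ε : ℝ) {s t : ℝ}
    (hs : s ∈ Set.Icc (0 : ℝ) 1) (ht : t ∈ Set.Icc (0 : ℝ) 1) (hst : s ≤ t) :
    ‖(X.segmentCoord ε ν ν' κ κ' t).1 - (X.segmentCoord ε ν ν' κ κ' s).1‖ ≤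
      M.lip * ‖ν - ν'‖ * (t - s) ∧
    ‖(X.segmentCoord ε ν ν' κ κ' t).2 - (X.segmentCoord ε ν ν' κ κ' s).2‖ ≤
      M.lip * ‖κ - κ'‖ * (t - s) := by
  have h1 : ∀ t ∈ Set.Icc (0 : ℝ) 1, AffineMap.lineMap ν ν' t ∈ X.𝒩 := fun t ht =>
    hν (by rw [segment_eq_image_lineMap]; exact ⟨t, ht, rfl⟩)
  have h2 : ∀ t ∈ Set.Icc (0 : ℝ) 1, AffineMap.lineMap κ κ' t ∈ X.𝒦 := fun t ht =>
    hκ (by rw [segment_eq_image_lineMap]; exact ⟨t, ht, rfl⟩)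
  have hst' : 0 ≤ t - s := sub_nonneg.2 hst
  have hd : dist t s = t - s := by rw [Real.dist_eq, abs_of_nonneg hst']
  constructor
  · refine (pi_norm_le_iff_of_nonneg (by positivity)).2 fun x => ?_
    have h := (X.H_lipschitz x).dist_le_mul _ (h1 t ht) _ (h1 s hs)
    rw [dist_lineMap_lineMap, hd, dist_eq_norm, dist_eq_norm] at h
    exact h.trans (le_of_eq (by ring))
  · refine (pi_norm_le_iff_of_nonneg (by positivity)).2 fun x =>
      (pi_norm_le_iff_of_nonneg (by positivity)).2 fun y => ?_
    simp only [segmentCoord, coord, Pi.sub_apply]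
    split_ifs with hxy
    · have h := (X.ξ_lipschitz x y hxy.1 hxy.2).dist_le_mul _ (h2 t ht) _ (h2 s hs)
      rw [dist_lineMap_lineMap, hd, dist_eq_norm, dist_eq_norm] at h
      exact h.trans (le_of_eq (by ring))
    · rw [sub_zero, norm_zero]
      positivity

end Model

/-- The truncated sums for slow protocols converge for refined steps, to the difference between the
free energies up to a controlled error. -/
theorem ModelClass.exists_truncatedSum_bound {S : Type*} [Fintype S] [DecidableEq S] [Nonempty S]
    [MeasurableSpace S] [DiscreteMeasurableSpace S] (M : ModelClass S) {n : ℕ} (hn : 1 ≤ n) :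
    ∃ C : ℝ, 0 < C ∧ ∀ (d m : ℕ) (X : Model M d m) (ε : ℝ)
      (ν ν' : EuclideanSpace ℝ (Fin d)) (κ κ' : EuclideanSpace ℝ (Fin m)),
      0 ≤ ε → ε ≤ M.epsBar → segment ℝ ν ν' ⊆ X.𝒩 → segment ℝ κ κ' ⊆ X.𝒦 →
      ∃ l, Tendsto (fun N => ∑ k ∈ Finset.Icc 1 (2 * n - 1),
        (-1 : ℝ) ^ k / (2 ^ k * (k.factorial : ℝ)) *
          iteratedDeriv k (X.limitFun (stepParam ε ν ν' κ κ' N) N) (1 / 2)) atTop (𝓝 l) ∧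
        |X.freeEnergy ⟨ε, ν', κ'⟩ - X.freeEnergy ⟨ε, ν, κ⟩ + 1 / M.β * l| ≤
          C * ε ^ (2 * n) * (‖ν - ν'‖ + ε * ‖κ - κ'‖) := by
  have hβ := M.β_pos
  obtain ⟨C, hC, h⟩ := M.exists_partition_bound hn M.epsBar (|M.Ebar| + 1)
  refine ⟨1 / M.β * (C * M.lip) + 1, by positivity, fun d m X ε ν ν' κ κ' hε hε' hν hκ => ?_⟩
  obtain ⟨r, hr, hrb⟩ := h ε ⟨hε, hε'⟩ (X.segmentCoord ε ν ν' κ κ') (M.lip * ‖ν - ν'‖)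
    (M.lip * ‖κ - κ'‖) (by positivity) (by positivity) (fun t ht => X.segmentCoord_mem hν hκ ε ht)
    (fun s hs t ht hst => X.norm_segmentCoord_sub_le hν hκ ε hs ht hst)
  have hlim := hr.const_sub (M.β * (X.freeEnergy ⟨ε, ν, κ⟩ - X.freeEnergy ⟨ε, ν', κ'⟩))
  refine ⟨_, hlim.congr' ?_, ?_⟩
  · filter_upwards [eventually_ge_atTop 1] with N hN
    have hN' : (N : ℝ) ≠ 0 := Nat.cast_ne_zero.2 (by omega)
    have e1 := X.taylorRem_limitFun (γ := stepParam ε ν ν' κ κ' N) (ε := ε) (fun _ => rfl) N hn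
    have e2 := X.taylorRem_limitFun_eq (γ := stepParam ε ν ν' κ κ' N) (ε := ε) (fun _ => rfl) N hn
    have hz : ∀ j, X.coord (stepParam ε ν ν' κ κ' N j) =
        X.segmentCoord ε ν ν' κ κ' ((j : ℝ) / N) := fun j => by
      rw [stepParam_eq _ _ _ _ _ hN]
      rfl
    rw [e1] at e2
    simp only [hz, Nat.cast_zero, zero_div, div_self hN', Nat.cast_add, Nat.cast_one] at e2
    rw [← e2, stepParam_eq _ _ _ _ _ hN, stepParam_eq _ _ _ _ _ hN, Nat.cast_zero, zero_div,
      div_self hN']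
    simp only [AffineMap.lineMap_apply_zero, AffineMap.lineMap_apply_one]
    ring
  · have e : X.freeEnergy ⟨ε, ν', κ'⟩ - X.freeEnergy ⟨ε, ν, κ⟩ + 1 / M.β *
        (M.β * (X.freeEnergy ⟨ε, ν, κ⟩ - X.freeEnergy ⟨ε, ν', κ'⟩) - r) = -(1 / M.β * r) := by
      field_simp
      ring
    rw [e, abs_neg, abs_mul, abs_of_pos (by positivity : 0 < 1 / M.β)]
    calc 1 / M.β * |r| ≤ 1 / M.β *
          (C * ε ^ (2 * n) * (M.lip * ‖ν - ν'‖ + ε * (M.lip * ‖κ - κ'‖))) := by gcongr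
      _ = 1 / M.β * (C * M.lip) * (ε ^ (2 * n) * (‖ν - ν'‖ + ε * ‖κ - κ'‖)) := by ring
      _ ≤ (1 / M.β * (C * M.lip) + 1) * (ε ^ (2 * n) * (‖ν - ν'‖ + ε * ‖κ - κ'‖)) := by
        gcongr
        linarith
      _ = _ := by ring

end SST

theorem mainTheorem6 {S : Type*} [Fintype S] [DecidableEq S] [Nonempty S]
    [MeasurableSpace S] [DiscreteMeasurableSpace S] (M : SST.ModelClass S) :
    ∃ B : ℝ, 0 < B ∧ ∃ C : ℕ → ℝ, (∀ n, 0 < C n) ∧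
      ∀ (d m : ℕ) (X : SST.Model M d m) (ε : ℝ)
        (ν ν' : EuclideanSpace ℝ (Fin d)) (κ κ' : EuclideanSpace ℝ (Fin m)),
        0 ≤ ε → ε ≤ M.epsBar → segment ℝ ν ν' ⊆ X.𝒩 → segment ℝ κ κ' ⊆ X.𝒦 →
        (∀ n : ℕ, 1 ≤ n → ∃ l : ℝ,
          SST.HasIteratedLimit
            (fun N τ => X.truncatedSum n τ (SST.stepProtocol ε ν ν' κ κ' N τ)) l ∧
          |X.freeEnergy ⟨ε, ν', κ'⟩ - X.freeEnergy ⟨ε, ν, κ⟩ + 1 / M.β * l|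
            ≤ C n * ε ^ (2 * n) * (‖ν - ν'‖ + B * ε * ‖κ - κ'‖)) ∧
        (∃ l : ℝ,
          SST.HasIteratedLimit
            (fun N τ => (X.meanΘ τ (SST.stepProtocol ε ν ν' κ κ' N τ)
              - X.meanΘ τ (SST.reversed (SST.stepProtocol ε ν ν' κ κ' N τ))) / 2) l ∧
          |X.entropy ⟨ε, ν', κ'⟩ - X.entropy ⟨ε, ν, κ⟩ + l|
            ≤ M.β * C 1 * ε ^ 2 * (‖ν - ν'‖ + B * ε * ‖κ - κ'‖) ∧
          (ν = ν' →
            |X.entropy ⟨ε, ν', κ'⟩ - X.entropy ⟨ε, ν, κ⟩ + l|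
              ≤ B * (M.β * C 1) * ε ^ 3 * ‖κ - κ'‖)) := by
  have hβ := M.β_pos
  choose C hC h using fun n : ℕ => M.exists_truncatedSum_bound (n := n + 1) (by omega)
  refine ⟨1, one_pos, fun n => C (n - 1), fun n => hC _, ?_⟩
  intro d m X ε ν ν' κ κ' hε hε' hν hκ
  refine ⟨fun n hn => ?_, ?_⟩
  · obtain ⟨l, hl, hb⟩ := h (n - 1) d m X ε ν ν' κ κ' hε hε' hν hκ
    rw [Nat.sub_add_cancel hn] at hl hb
    refine ⟨l, ⟨_, fun N _ => X.tendsto_truncatedSum ε ν ν' κ κ' n N, hl⟩, ?_⟩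
    rw [one_mul]
    exact hb
  · obtain ⟨l, hl, hb⟩ := h 0 d m X ε ν ν' κ κ' hε hε' hν hκ
    set D : ℝ := ∑ x, X.H ν' x * X.stationary ⟨ε, ν', κ'⟩ x - ∑ x, X.H ν x * X.stationary ⟨ε, ν, κ⟩ x
      with hD
    -- for `n = 1` the truncated sum is minus one half of the difference between the means
    have hl' : Tendsto (fun N => iteratedDeriv 1
        (X.limitFun (SST.stepParam ε ν ν' κ κ' N) N) (1 / 2) / 2) atTop (𝓝 (-l)) := by
      refine hl.neg.congr fun N => ?_
      norm_num
      ring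
    have key : |X.entropy ⟨ε, ν', κ'⟩ - X.entropy ⟨ε, ν, κ⟩ + (-l - M.β * D)| ≤
        M.β * C 0 * ε ^ 2 * (‖ν - ν'‖ + 1 * ε * ‖κ - κ'‖) := by
      have e : X.entropy ⟨ε, ν', κ'⟩ - X.entropy ⟨ε, ν, κ⟩ + (-l - M.β * D) =
          -(M.β * (X.freeEnergy ⟨ε, ν', κ'⟩ - X.freeEnergy ⟨ε, ν, κ⟩ + 1 / M.β * l)) := by
        simp only [SST.Model.entropy, hD]
        field_simp
        ring
      rw [e, abs_neg, abs_mul, abs_of_pos hβ, one_mul, mul_assoc M.β, mul_assoc M.β]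
      exact mul_le_mul_of_nonneg_left hb hβ.le
    refine ⟨-l - M.β * D, ⟨_, fun N _ => X.tendsto_meanΘ_sub ε ν ν' κ κ' N, ?_⟩, key, ?_⟩
    · refine (hl'.sub_const (M.β * D)).congr' ?_
      filter_upwards [eventually_ge_atTop 1] with N hN
      have hN' : (N : ℝ) ≠ 0 := Nat.cast_ne_zero.2 (by omega)
      simp only [SST.stepParam_eq _ _ _ _ _ hN, Nat.cast_zero, zero_div, div_self hN',
        AffineMap.lineMap_apply_zero, AffineMap.lineMap_apply_one, hD]
    · rintro rfl
      refine key.trans (le_of_eq ?_)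
      rw [sub_self, norm_zero]
      ring
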